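/- **Setting.** Let $M$ be a smooth manifold, $\pi:TM\to M$ its tangent bundle, $A\subset TM\setminus\{0\}$ open and conic ($\lambda v\in A$ for $v\in A$, $\lambda>0$), and let $L:A\to\mathbb R$ be a pseudo-Finsler metric: $L$ is smooth, $L(\lambda v)=\lambda^2L(v)$ for $\lambda>0$, and for every $v\in A$ the fundamental tensor $g_v(u,w)=\frac12\frac{\partial^2}{\partial s\partial t}L(v+su+tw)|_{s=t=0}$ on $T_{\pi(v)}M$ is non-degenerate. The Cartan tensor is $C_v(u,w,z)=\frac12\frac{\partial}{\partial t}g_{v+tz}(u,w)|_{t=0}$. An $A$-anisotropic connection assigns to $v\in A$ and vector fields $X,Y$ a vector $\nabla^v_XY\in T_{\pi(v)}M$, smoothly in $v$, additive in both arguments, function-linear in $X$ and satisfying the Leibniz rule $\nabla^v_X(fY)=X(f)Y+f\nabla^v_XY$. For a vector field $V$ with values in $A$ put $\nabla^V_XY|_p:=\nabla^{V_p}_XY$. The Levi-Civita–Chern connection of $L$ is the unique anisotropic connection with $\nabla^v_XY-\nabla^v_YX=[X,Y]$ and $X(g_V(Y,Z))=g_V(\nabla^V_XY,Z)+g_V(Y,\nabla^V_XZ)+2C_V(\nabla^V_XV,Y,Z)$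 for all local fields $V$ with values in $A$. The vertical derivative of an anisotropic object $T$ is $(\partial^\nu T)_v(\ldots,z)=\frac{\partial}{\partial t}T_{v+tz}(\ldots)|_{t=0}$; the vertical derivative of a connection is $P_v(u,w,z)=\frac{\partial}{\partial t}\nabla^{v+tz}_uW|_{t=0}$, with $W$ any extension of $w$. For a vector-valued anisotropic tensor $T$ with $k$ vector arguments and any extension $V$ of $v$, $(\nabla_XT)_v(X_1,\ldots,X_k)=\nabla^v_X(T_V(X_1,\ldots,X_k))-(\partial^\nu T)_v(X_1,\ldots,X_k,\nabla^v_XV)-\sum_iT_v(\ldots,\nabla^v_XX_i,\ldots)$; for $k=0$ this defines $\nabla^v_XW$ for an anisotropic vector field $W$. The curvature tensor is $R_v(X,Y)Z=\nabla^v_X(\nabla_YZ)-\nabla^v_Y(\nabla_XZ)-\nabla^v_{[X,Y]}Z$. Let $S$ be a (possibly only immersed) submanifold of $M$ which is non-degenerate: $g_v|_{T_{\pi(v)}S\times T_{\pi(v)}S}$ is non-degenerate for all $v\in A\cap TS$. Denote by $\top_{g_v},\bot_{g_v}$ the $g_v$-orthogonal projections onto $T_{\pi(v)}S$ and its $g_v$-orthogonal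 complement. Let $\widetilde\nabla$ and $\nabla$ be the Levi-Civita–Chern connections of $(M,L)$ and of $(S,L|_{A\cap TS})$, $\widetilde R,R$ their curvature tensors and $\widetilde P,P$ their vertical derivatives. For vector fields $X$ tangent to $S$ and $Y$ along $S$, $\widetilde\nabla^v_XY$ is computed with any extensions to $M$. For $X,Y$ tangent to $S$, put $$\mathrm{II}_v(X,Y)=(\widetilde\nabla^v_XY)^{\bot_{g_v}},\qquad Q_v(X,Y)=(\widetilde\nabla^v_XY)^{\top_{g_v}}-\nabla^v_XY.$$ Here $Q_v$ is taken for $v\in A\cap TS$; $\mathrm{II}_v$ is defined by the same formula also for all $v\in A$ close to $A\cap TS$ with $\pi(v)\in S$ (where $g_v|_{TS}$ is still non-degenerate), so that $(\partial^\nu\mathrm{II})_v(u,w,\xi)$ makes sense for $v\in A\cap TS$ and every $\xi\in T_{\pi(v)}M$. $\partial^\nu Q$ and $\nabla Q$ are the vertical and $\nabla$-derivative of $Q$ on $S$, and $$(\nabla_X\mathrm{II})_v(Y,Z)=\big(\widetilde\nabla^v_X(\mathrm{II}(Y,Z))\big)^{\bot_{g_v}}-\mathrm{II}_v(\nabla^v_XY,Z)-\mathrm{II}_v(Y,\nabla^v_XZ),$$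 where $\widetilde\nabla^v_X(\mathrm{II}(Y,Z))=\widetilde\nabla^v_X(\mathrm{II}_V(Y,Z))-(\partial^\nu\mathrm{II})_v(Y,Z,\widetilde\nabla^v_XV)$ for any extension $V$ of $v$ along $S$. **Theorem (Gauss–Codazzi equations).** For all $v\in A\cap TS$, $u,w,z,b\in T_{\pi(v)}S$ and $n\in(T_{\pi(v)}S)^{\bot_{g_v}}$, $$\begin{aligned} g_v(\widetilde R_v(u,w)z,b)={}&g_v(R_v(u,w)z,b)-g_v(\mathrm{II}_v(w,z),\mathrm{II}_v(u,b))+g_v(\mathrm{II}_v(u,z),\mathrm{II}_v(w,b))\\ &-2C_v(\mathrm{II}_v(u,v),\mathrm{II}_v(w,z),b)+2C_v(\mathrm{II}_v(w,v),\mathrm{II}_v(u,z),b)\\ &+g_v(\widetilde P_v(u,z,\mathrm{II}_v(w,v))-\widetilde P_v(w,z,\mathrm{II}_v(u,v)),b)\\ &+g_v(P_v(u,z,Q_v(w,v))-P_v(w,z,Q_v(u,v)),b)\\ &+g_v((\nabla_uQ)_v(w,z)-(\nabla_wQ)_v(u,z),b)\\ &+g_v((\partial^\nu Q)_v(u,z,Q_v(w,v))-(\partial^\nu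 Q)_v(w,z,Q_v(u,v)),b)\\ &+g_v(Q_v(u,Q_v(w,z))-Q_v(w,Q_v(u,z)),b),\\[4pt] g_v(\widetilde R_v(u,w)z,n)={}&g_v((\nabla_u\mathrm{II})_v(w,z),n)-g_v((\nabla_w\mathrm{II})_v(u,z),n)\\ &+g_v(\mathrm{II}_v(u,Q_v(w,z)),n)-g_v(\mathrm{II}_v(w,Q_v(u,z)),n)\\ &+g_v((\partial^\nu\mathrm{II})_v(w,z,\mathrm{II}_v(u,v)),n)-g_v((\partial^\nu\mathrm{II})_v(u,z,\mathrm{II}_v(w,v)),n)\\ &+g_v(\widetilde P_v(u,z,\mathrm{II}_v(w,v)),n)-g_v(\widetilde P_v(w,z,\mathrm{II}_v(u,v)),n). \end{aligned}$$ -/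

import Mathlib

open scoped Manifold ContDiff Topology

noncomputable section

namespace PseudoFinsler

variable {E : Type*} [NormedAddCommGroup E] [NormedSpace ℝ E]
  {M : Type*} [TopologicalSpace M] [ChartedSpace E M] [IsManifold 𝓘(ℝ, E) ∞ M]
  {F : Type*} [NormedAddCommGroup F] [NormedSpace ℝ F]
  {S : Type*} [TopologicalSpace S] [ChartedSpace F S] [IsManifold 𝓘(ℝ, F) ∞ S]

/-! ### Pseudo-Finsler metrics -/

section Metric

/-- The fundamental tensor `g_v(u, w) = 1/2 ∂²/∂s∂t L(v + s u + t w)` at `s = t = 0`. -/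
def fundTensor (L : TangentBundle 𝓘(ℝ, E) M → ℝ) {p : M} (v u w : TangentSpace 𝓘(ℝ, E) p) : ℝ :=
  (1 / 2) * deriv (fun s : ℝ => deriv (fun t : ℝ => L ⟨p, v + s • u + t • w⟩) 0) 0

/-- The Cartan tensor `C_v(u, w, z) = 1/2 ∂/∂t g_{v + t z}(u, w)` at `t = 0`. -/
def cartanTensor (L : TangentBundle 𝓘(ℝ, E) M → ℝ) {p : M}
    (v u w z : TangentSpace 𝓘(ℝ, E) p) : ℝ :=
  (1 / 2) * deriv (fun t : ℝ => fundTensor L (v + t • z) u w) 0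

/-- `L` (of which only the values on `A` matter) is a pseudo-Finsler metric with domain the conic
open set `A ⊆ TM \ 0`. -/
structure IsPseudoFinsler (A : Set (TangentBundle 𝓘(ℝ, E) M))
    (L : TangentBundle 𝓘(ℝ, E) M → ℝ) : Prop where
  isOpen : IsOpen A
  ne_zero : ∀ (p : M) (v : TangentSpace 𝓘(ℝ, E) p),
    (⟨p, v⟩ : TangentBundle 𝓘(ℝ, E) M) ∈ A → v ≠ 0
  conic : ∀ (p : M) (v : TangentSpace 𝓘(ℝ, E) p) (c : ℝ), 0 < c →
    (⟨p, v⟩ : TangentBundle 𝓘(ℝ, E) M) ∈ A → (⟨p, c • v⟩ : TangentBundle 𝓘(ℝ, E) M) ∈ A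
  smooth : ContMDiffOn (𝓘(ℝ, E)).tangent 𝓘(ℝ, ℝ) ∞ L A
  homogeneous : ∀ (p : M) (v : TangentSpace 𝓘(ℝ, E) p) (c : ℝ), 0 < c →
    (⟨p, v⟩ : TangentBundle 𝓘(ℝ, E) M) ∈ A → L ⟨p, c • v⟩ = c ^ 2 * L ⟨p, v⟩
  nondegenerate : ∀ (p : M) (v : TangentSpace 𝓘(ℝ, E) p),
    (⟨p, v⟩ : TangentBundle 𝓘(ℝ, E) M) ∈ A →
    ∀ u : TangentSpace 𝓘(ℝ, E) p, (∀ w, fundTensor L v u w = 0) → u = 0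

end Metric

/-! ### Anisotropic connections -/

section Connection

/-- The vector field `X`, possibly defined only locally, is smooth near `p`. -/
def SmoothFieldAt (X : Π x : M, TangentSpace 𝓘(ℝ, E) x) (p : M) : Prop :=
  ContMDiffAt 𝓘(ℝ, E) (𝓘(ℝ, E)).tangent ∞ (fun x => (⟨x, X x⟩ : TangentBundle 𝓘(ℝ, E) M)) p

/-- The derivative `u(f)` of a function `f` in the direction of the tangent vector `u ∈ T_pM`. -/
def dirDeriv (f : M → ℝ) (p : M) (u : TangentSpace 𝓘(ℝ, E) p) : ℝ :=
  mfderiv 𝓘(ℝ, E) 𝓘(ℝ, ℝ) f p u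

/-- An `A`-anisotropic connection: `toFun p v Y u` is `∇^v_u Y` for `v ∈ A ∩ T_pM`, `u ∈ T_pM` and a
vector field `Y` which is smooth near `p`. Linearity over functions in the lower slot means that
`∇^v_X Y` depends on `X` only through `X p`, linearly, so this slot holds a vector of `T_pM`. -/
structure AnisotropicConnection (A : Set (TangentBundle 𝓘(ℝ, E) M)) where
  toFun : Π (p : M), TangentSpace 𝓘(ℝ, E) p → (Π x : M, TangentSpace 𝓘(ℝ, E) x) →
    TangentSpace 𝓘(ℝ, E) p →ₗ[ℝ] TangentSpace 𝓘(ℝ, E) p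
  add : ∀ (p : M) (v : TangentSpace 𝓘(ℝ, E) p) (Y Z : Π x : M, TangentSpace 𝓘(ℝ, E) x)
    (u : TangentSpace 𝓘(ℝ, E) p), (⟨p, v⟩ : TangentBundle 𝓘(ℝ, E) M) ∈ A →
    SmoothFieldAt Y p → SmoothFieldAt Z p →
    toFun p v (fun x => Y x + Z x) u = toFun p v Y u + toFun p v Z u
  leibniz : ∀ (p : M) (v : TangentSpace 𝓘(ℝ, E) p) (f : M → ℝ)
    (Y : Π x : M, TangentSpace 𝓘(ℝ, E) x) (u : TangentSpace 𝓘(ℝ, E) p),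
    (⟨p, v⟩ : TangentBundle 𝓘(ℝ, E) M) ∈ A →
    ContMDiffAt 𝓘(ℝ, E) 𝓘(ℝ, ℝ) ∞ f p → SmoothFieldAt Y p →
    toFun p v (fun x => f x • Y x) u
      = dirDeriv f p u • Y p + f p • toFun p v Y u
  smooth : ∀ (U : Set M) (X Y : Π x : M, TangentSpace 𝓘(ℝ, E) x), IsOpen U →
    (∀ x ∈ U, SmoothFieldAt X x) → (∀ x ∈ U, SmoothFieldAt Y x) →
    ContMDiffOn (𝓘(ℝ, E)).tangent (𝓘(ℝ, E)).tangent ∞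
      (fun v : TangentBundle 𝓘(ℝ, E) M =>
        (⟨v.1, toFun v.1 v.2 Y (X v.1)⟩ : TangentBundle 𝓘(ℝ, E) M))
      (A ∩ {v | v.1 ∈ U})

/-- A local extension of the tangent vector `u ∈ T_pM` to a vector field which is smooth near `p`
(the one with constant components in the preferred chart at `p`). -/
def extField {p : M} (u : TangentSpace 𝓘(ℝ, E) p) : Π x : M, TangentSpace 𝓘(ℝ, E) x :=
  FiberBundle.extend E (E := fun x : M => TangentSpace 𝓘(ℝ, E) x) u

variable {A : Set (TangentBundle 𝓘(ℝ, E) M)}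

/-- `D` is the Levi-Civita–Chern connection of `(M, L)`: it is torsion-free and compatible with
the fundamental tensor. -/
structure IsLeviCivitaChern (L : TangentBundle 𝓘(ℝ, E) M → ℝ)
    (D : AnisotropicConnection A) : Prop where
  torsion_free : ∀ (p : M) (v : TangentSpace 𝓘(ℝ, E) p) (X Y : Π x : M, TangentSpace 𝓘(ℝ, E) x),
    (⟨p, v⟩ : TangentBundle 𝓘(ℝ, E) M) ∈ A → SmoothFieldAt X p → SmoothFieldAt Y p →
    D.toFun p v Y (X p) - D.toFun p v X (Y p) = VectorField.mlieBracket 𝓘(ℝ, E) X Y p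
  metric : ∀ (p : M) (V Y Z : Π x : M, TangentSpace 𝓘(ℝ, E) x) (u : TangentSpace 𝓘(ℝ, E) p),
    (⟨p, V p⟩ : TangentBundle 𝓘(ℝ, E) M) ∈ A →
    SmoothFieldAt V p → SmoothFieldAt Y p → SmoothFieldAt Z p →
    dirDeriv (fun x => fundTensor L (V x) (Y x) (Z x)) p u
      = fundTensor L (V p) (D.toFun p (V p) Y u) (Z p)
        + fundTensor L (V p) (Y p) (D.toFun p (V p) Z u)
        + 2 * cartanTensor L (V p) (D.toFun p (V p) V u) (Y p) (Z p)

/-- The vertical derivative `P_v(u, w, z) = ∂/∂t ∇^{v + t z}_u W` at `t = 0` of an anisotropic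
connection, where `W` extends `w`. -/
def vertDeriv (D : AnisotropicConnection A) {p : M} (v u w z : TangentSpace 𝓘(ℝ, E) p) :
    TangentSpace 𝓘(ℝ, E) p :=
  deriv (fun t : ℝ => D.toFun p (v + t • z) (extField w) u) 0

/-- The derivative `∇^v_u W = ∇^v_u (W_V) - (∂^ν W)_v(∇^v_u V)` of an anisotropic vector field `W`,
where `V` extends `v`. -/
def derivAniso (D : AnisotropicConnection A) {p : M} (v u : TangentSpace 𝓘(ℝ, E) p)
    (W : Π x : M, TangentSpace 𝓘(ℝ, E) x → TangentSpace 𝓘(ℝ, E) x) : TangentSpace 𝓘(ℝ, E) p :=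
  D.toFun p v (fun x => W x (extField v x)) u
    - deriv (fun t : ℝ => W p (v + t • D.toFun p v (extField v) u)) 0

/-- The curvature tensor `R_v(u, w) z = ∇^v_X (∇_Y Z) - ∇^v_Y (∇_X Z) - ∇^v_{[X, Y]} Z`, where
`X, Y, Z` extend `u, w, z`. -/
def curvature (D : AnisotropicConnection A) {p : M} (v u w z : TangentSpace 𝓘(ℝ, E) p) :
    TangentSpace 𝓘(ℝ, E) p :=
  derivAniso D v u (fun x y => D.toFun x y (extField z) (extField w x))
    - derivAniso D v w (fun x y => D.toFun x y (extField z) (extField u x))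
    - D.toFun p v (extField z) (VectorField.mlieBracket 𝓘(ℝ, E) (extField u) (extField w) p)

end Connection

/-! ### Submanifolds

A submanifold is given by a smooth immersion `i : S → M`. -/

section Submanifold

/-- The differential of `i`, through which `T_xS` is regarded as a subspace of `T_{i x}M`. -/
def push (i : S → M) {x : S} (u : TangentSpace 𝓘(ℝ, F) x) : TangentSpace 𝓘(ℝ, E) (i x) :=
  mfderiv 𝓘(ℝ, F) 𝓘(ℝ, E) i x u

/-- `A ∩ TS`, as a set of tangent vectors of `S`. -/
def restrictDomain (i : S → M) (A : Set (TangentBundle 𝓘(ℝ, E) M)) :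
    Set (TangentBundle 𝓘(ℝ, F) S) :=
  {v | (⟨i v.1, push i v.2⟩ : TangentBundle 𝓘(ℝ, E) M) ∈ A}

/-- The restriction of `L` to `TS`. -/
def restrictMetric (i : S → M) (L : TangentBundle 𝓘(ℝ, E) M → ℝ) : TangentBundle 𝓘(ℝ, F) S → ℝ :=
  fun v => L ⟨i v.1, push i v.2⟩

/-- `i : S → M` is a non-degenerate (immersed) submanifold of the pseudo-Finsler manifold. -/
structure IsNondegenerateSubmanifold (A : Set (TangentBundle 𝓘(ℝ, E) M))
    (L : TangentBundle 𝓘(ℝ, E) M → ℝ) (i : S → M) : Prop where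
  smooth : ContMDiff 𝓘(ℝ, F) 𝓘(ℝ, E) ∞ i
  immersion : ∀ x : S, Function.Injective (mfderiv 𝓘(ℝ, F) 𝓘(ℝ, E) i x)
  nondegenerate : ∀ (x : S) (v : TangentSpace 𝓘(ℝ, F) x),
    (⟨x, v⟩ : TangentBundle 𝓘(ℝ, F) S) ∈ restrictDomain i A →
    ∀ u : TangentSpace 𝓘(ℝ, F) x,
      (∀ w : TangentSpace 𝓘(ℝ, F) x, fundTensor L (push i v) (push i u) (push i w) = 0) → u = 0

open Classical in
/-- The tangent part of `ξ ∈ T_{i x}M` with respect to `g_v`, as a vector of `T_xS`: the unique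
`a ∈ T_xS` such that `ξ - a` is `g_v`-orthogonal to `T_xS`. -/
def tanPart (L : TangentBundle 𝓘(ℝ, E) M → ℝ) (i : S → M) {x : S}
    (v ξ : TangentSpace 𝓘(ℝ, E) (i x)) : TangentSpace 𝓘(ℝ, F) x :=
  if h : ∃! a : TangentSpace 𝓘(ℝ, F) x, ∀ b : TangentSpace 𝓘(ℝ, F) x,
      fundTensor L v (ξ - push i a) (push i b) = 0
  then h.choose else 0

/-- The part of `ξ ∈ T_{i x}M` which is `g_v`-orthogonal to `T_xS`. -/
def norPart (L : TangentBundle 𝓘(ℝ, E) M → ℝ) (i : S → M) {x : S}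
    (v ξ : TangentSpace 𝓘(ℝ, E) (i x)) : TangentSpace 𝓘(ℝ, E) (i x) :=
  ξ - push i (tanPart (F := F) L i v ξ)

variable {A : Set (TangentBundle 𝓘(ℝ, E) M)} {B : Set (TangentBundle 𝓘(ℝ, F) S)}

open Classical in
/-- The covariant derivative `∇^v_u W` of a vector field `W` along `S`, not necessarily tangent
to `S`, for `v ∈ T_{i x}M` and `u ∈ T_xS`: it is computed with any local extension of `W` to `M`. -/
def derivAlong (D : AnisotropicConnection A) (i : S → M) {x : S} (v : TangentSpace 𝓘(ℝ, E) (i x))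
    (u : TangentSpace 𝓘(ℝ, F) x) (W : Π s : S, TangentSpace 𝓘(ℝ, E) (i s)) :
    TangentSpace 𝓘(ℝ, E) (i x) :=
  if h : ∃ W' : Π y : M, TangentSpace 𝓘(ℝ, E) y,
      SmoothFieldAt W' (i x) ∧ ∀ᶠ s in 𝓝 x, W' (i s) = W s
  then D.toFun (i x) v h.choose (push i u) else 0

/-- The second fundamental form `II_v(u, w)`, for every `v` at a point of `S` (not necessarily
tangent to `S`): the orthogonal part of `∇^v_u W`, where the field `W` on `S` extends `w`. -/
def secondFF (L : TangentBundle 𝓘(ℝ, E) M → ℝ) (D : AnisotropicConnection A) (i : S → M) {x : S}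
    (v : TangentSpace 𝓘(ℝ, E) (i x)) (u w : TangentSpace 𝓘(ℝ, F) x) : TangentSpace 𝓘(ℝ, E) (i x) :=
  norPart (F := F) L i v (derivAlong D i v u (fun s => push i (extField w s)))

/-- The induced connection `(∇^v_u W)^⊤` on `S`, for `v ∈ T_xS`. -/
def inducedConn (L : TangentBundle 𝓘(ℝ, E) M → ℝ) (D : AnisotropicConnection A) (i : S → M) {x : S}
    (v u : TangentSpace 𝓘(ℝ, F) x) (W : Π s : S, TangentSpace 𝓘(ℝ, F) s) : TangentSpace 𝓘(ℝ, F) x :=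
  tanPart L i (push i v) (derivAlong D i (push i v) u (fun s => push i (W s)))

/-- The difference tensor `Q` between the induced connection of `S` and an intrinsic
connection `D'` of `S`. -/
def diffTensor (L : TangentBundle 𝓘(ℝ, E) M → ℝ) (D : AnisotropicConnection A) (i : S → M)
    (D' : AnisotropicConnection B) {x : S} (v u w : TangentSpace 𝓘(ℝ, F) x) :
    TangentSpace 𝓘(ℝ, F) x :=
  inducedConn L D i v u (extField w) - D'.toFun x v (extField w) u

/-- The vertical derivative `(∂^ν T)_v(u, w, z)` of an anisotropic tensor `T` of type `(1, 2)`. -/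
def vertDerivTensor
    (T : Π x : S, TangentSpace 𝓘(ℝ, F) x → TangentSpace 𝓘(ℝ, F) x → TangentSpace 𝓘(ℝ, F) x →
      TangentSpace 𝓘(ℝ, F) x)
    {x : S} (v u w z : TangentSpace 𝓘(ℝ, F) x) : TangentSpace 𝓘(ℝ, F) x :=
  deriv (fun t : ℝ => T x (v + t • z) u w) 0

/-- The derivative `(∇_u T)_v(w, z)` of an anisotropic tensor `T` of type `(1, 2)`:
`∇^V_X (T_V(Y, Z)) - (∂^ν T)_V(Y, Z, ∇^V_X V) - T_V(∇^V_X Y, Z) - T_V(Y, ∇^V_X Z)`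
for extensions `V, Y, Z` of `v, w, z`. -/
def covDerivTensor (D' : AnisotropicConnection B)
    (T : Π x : S, TangentSpace 𝓘(ℝ, F) x → TangentSpace 𝓘(ℝ, F) x → TangentSpace 𝓘(ℝ, F) x →
      TangentSpace 𝓘(ℝ, F) x)
    {x : S} (v u w z : TangentSpace 𝓘(ℝ, F) x) : TangentSpace 𝓘(ℝ, F) x :=
  D'.toFun x v (fun s => T s (extField v s) (extField w s) (extField z s)) u
    - vertDerivTensor T v w z (D'.toFun x v (extField v) u)
    - T x v (D'.toFun x v (extField w) u) z
    - T x v w (D'.toFun x v (extField z) u)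

/-- The vertical derivative `(∂^ν II)_v(u, w, ξ)`, for arbitrary `v, ξ ∈ T_{i x}M`. -/
def vertDerivSecondFF (L : TangentBundle 𝓘(ℝ, E) M → ℝ) (D : AnisotropicConnection A) (i : S → M)
    {x : S} (v : TangentSpace 𝓘(ℝ, E) (i x)) (u w : TangentSpace 𝓘(ℝ, F) x)
    (ξ : TangentSpace 𝓘(ℝ, E) (i x)) : TangentSpace 𝓘(ℝ, E) (i x) :=
  deriv (fun t : ℝ => secondFF L D i (v + t • ξ) u w) 0

/-- The derivative `∇^v_u (II(Y, Z)) = ∇^v_u (II_V(Y, Z)) - (∂^ν II)_v(Y, Z, ∇^v_u V)`, with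
respect to the connection of `M`, of the anisotropic field `II(Y, Z)` along `S`, where `Y, Z` are
fields on `S` and the field `V` along `S` extends `v ∈ T_xS`. -/
def derivSecondFF (L : TangentBundle 𝓘(ℝ, E) M → ℝ) (D : AnisotropicConnection A) (i : S → M)
    {x : S} (v u : TangentSpace 𝓘(ℝ, F) x) (Y Z : Π s : S, TangentSpace 𝓘(ℝ, F) s) :
    TangentSpace 𝓘(ℝ, E) (i x) :=
  derivAlong D i (push i v) u (fun s => secondFF L D i (push i (extField v s)) (Y s) (Z s))
    - vertDerivSecondFF L D i (push i v) (Y x) (Z x)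
        (derivAlong D i (push i v) u (fun s => push i (extField v s)))

/-- The derivative `(∇_u II)_v(w, z) = (∇^v_u (II(Y, Z)))^⊥ - II_v(∇^v_u Y, Z) - II_v(Y, ∇^v_u Z)`
of the second fundamental form, where `Y, Z` extend `w, z`; the first derivative is that of `M`,
the last two are those of `S`. -/
def covDerivSecondFF (L : TangentBundle 𝓘(ℝ, E) M → ℝ) (D : AnisotropicConnection A) (i : S → M)
    (D' : AnisotropicConnection B) {x : S} (v u w z : TangentSpace 𝓘(ℝ, F) x) :
    TangentSpace 𝓘(ℝ, E) (i x) :=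
  norPart (F := F) L i (push i v) (derivSecondFF L D i v u (extField w) (extField z))
    - secondFF L D i (push i v) (D'.toFun x v (extField w) u) z
    - secondFF L D i (push i v) w (D'.toFun x v (extField z) u)

end Submanifold

end PseudoFinsler

end

open PseudoFinsler

/-! In the charts at `x` and `i x` the immersion becomes a map ι : F → E with differential d, the
metric g(y, η) is half the vertical Hessian of L, and the connection is a bilinear-valued function
Γ(y, η). Curvature differentiates Γ in the horizontal direction (u, -Γ(u, v)) (`comps_curvature`).
Metric compatibility becomes a formula for the y-derivative of g (`christoffel_metric`), and
vanishing torsion becomes symmetry of the Christoffel symbols (`christoffel_symm`).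

Everything comes from one identity: D²ι(u, z) + Γ(du, dz) = d q(u, z) + B(u, z), with q tangential
and B normal for g. It is used at (s, η) for every ambient η near d v, not only for tangent η. Here
B is II, and q - γ is Q, where γ are the Christoffel symbols of the connection of S. Differentiate
it in the direction (u, h) with h = D²ι(u, v) - d q(u, v) = B(u, v) - Γ(du, dv). By the first
expression, this is the image of the q-horizontal direction (u, -q(u, v)) under (s, v) ↦ (s, dv). By
the second, it is Γ-horizontal in the ambient space up to the vertical shift (0, B(u, v)). That
shift, which has no effect when Γ and g do not depend on η, produces all terms with II(u, v) and
II(w, v). After antisymmetrization in u, w the third derivatives of ι cancel, leaving the curvature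
of q plus terms in B and its derivative (`coordCurvature_immersion`).

For the Gauss equation, g(B(w, z), db) = 0 is differentiated in the same direction. Metric
compatibility turns the tangential part of the derivative of B into -g(B, B) and a vertical
derivative of g along B(u, v), which is the Cartan term (`metric_normal_deriv`). The curvature of q
= γ + Q is expanded in `coordCurvature_add`. For the Codazzi equation, pairing with n kills all
tangential terms, and the derivative of B is ∇II up to the vertical shift, which gives the ∂^ν II
terms. `gauss_codazzi_coord` combines these; the other lemmas identify the invariant objects with
their coordinate expressions. -/

noncomputable section

namespace PseudoFinsler

/-! ### Components of vectors and fields in charts. -/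

section Coordinates

variable {E : Type*} [NormedAddCommGroup E] [NormedSpace ℝ E]
  {M : Type*} [TopologicalSpace M] [ChartedSpace E M] [IsManifold 𝓘(ℝ, E) ∞ M]

/-- The components of a tangent vector in the preferred chart at `p₀`. -/
def comps (p₀ : M) {p : M} (u : TangentSpace 𝓘(ℝ, E) p) : E :=
  (trivializationAt E (fun x : M => TangentSpace 𝓘(ℝ, E) x) p₀).continuousLinearMapAt ℝ p u

/-- The tangent vector at `p` with given components in the preferred chart at `p₀`. -/
def ofComps (p₀ p : M) (a : E) : TangentSpace 𝓘(ℝ, E) p :=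
  (trivializationAt E (fun x : M => TangentSpace 𝓘(ℝ, E) x) p₀).symmL ℝ p a

theorem comps_ofComps {p₀ p : M} (hp : p ∈ (chartAt E p₀).source) (a : E) :
    comps p₀ (ofComps p₀ p a) = a :=
  (trivializationAt E (fun x : M => TangentSpace 𝓘(ℝ, E) x) p₀).continuousLinearMapAt_symmL hp a

theorem ofComps_comps {p₀ p : M} (hp : p ∈ (chartAt E p₀).source) (u : TangentSpace 𝓘(ℝ, E) p) :
    ofComps p₀ p (comps p₀ u) = u :=
  (trivializationAt E (fun x : M => TangentSpace 𝓘(ℝ, E) x) p₀).symmL_continuousLinearMapAt hp u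

theorem comps_add (p₀ : M) {p : M} (u w : TangentSpace 𝓘(ℝ, E) p) :
    comps p₀ (u + w) = comps p₀ u + comps p₀ w := map_add _ _ _

theorem comps_sub (p₀ : M) {p : M} (u w : TangentSpace 𝓘(ℝ, E) p) :
    comps p₀ (u - w) = comps p₀ u - comps p₀ w := map_sub _ _ _

theorem comps_smul (p₀ : M) {p : M} (c : ℝ) (u : TangentSpace 𝓘(ℝ, E) p) :
    comps p₀ (c • u) = c • comps p₀ u := map_smul _ _ _

theorem ofComps_add (p₀ p : M) (a b : E) :
    ofComps p₀ p (a + b) = ofComps p₀ p a + ofComps p₀ p b := map_add _ _ _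

theorem ofComps_smul (p₀ p : M) (c : ℝ) (a : E) :
    ofComps p₀ p (c • a) = c • ofComps p₀ p a := map_smul _ _ _

theorem comps_zero (p₀ p : M) : comps p₀ (0 : TangentSpace 𝓘(ℝ, E) p) = 0 := map_zero _

theorem extField_apply {p₀ x : M} (hx : x ∈ (chartAt E p₀).source) (u : TangentSpace 𝓘(ℝ, E) p₀) :
    extField u x = ofComps p₀ x (comps p₀ u) := by
  have h : p₀ ∈ (trivializationAt E (fun x : M => TangentSpace 𝓘(ℝ, E) x) p₀).baseSet :=
    mem_chart_source E p₀
  unfold comps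
  rw [Bundle.Trivialization.continuousLinearMapAt_apply_of_mem (R := ℝ) _ h]
  exact (Bundle.Trivialization.symmL_apply
    (trivializationAt E (fun x : M => TangentSpace 𝓘(ℝ, E) x) p₀) hx _).symm

theorem comps_eq_mfderiv {p₀ p : M} (hp : p ∈ (chartAt E p₀).source)
    (u : TangentSpace 𝓘(ℝ, E) p) :
    comps p₀ u = mfderiv 𝓘(ℝ, E) 𝓘(ℝ, E) (extChartAt 𝓘(ℝ, E) p₀) p u := by
  unfold comps
  rw [TangentBundle.continuousLinearMapAt_trivializationAt hp]
  rfl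

/-- A function `M → N` with values in a normed space, read in the chart at `p₀`. -/
theorem mfderiv_eq_fderiv_comps {G : Type*} [NormedAddCommGroup G] [NormedSpace ℝ G]
    {p₀ p : M} (hp : p ∈ (chartAt E p₀).source) {f : M → G}
    (hf : DifferentiableAt ℝ (f ∘ (extChartAt 𝓘(ℝ, E) p₀).symm) (extChartAt 𝓘(ℝ, E) p₀ p))
    (u : TangentSpace 𝓘(ℝ, E) p) :
    (mfderiv 𝓘(ℝ, E) 𝓘(ℝ, G) f p u : G)
      = fderiv ℝ (f ∘ (extChartAt 𝓘(ℝ, E) p₀).symm) (extChartAt 𝓘(ℝ, E) p₀ p) (comps p₀ u) := by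
  have h1 : f =ᶠ[𝓝 p] (f ∘ (extChartAt 𝓘(ℝ, E) p₀).symm) ∘ (extChartAt 𝓘(ℝ, E) p₀) := by
    filter_upwards [(chartAt E p₀).open_source.mem_nhds hp] with y hy
    simp only [Function.comp]
    rw [(extChartAt 𝓘(ℝ, E) p₀).left_inv (by rwa [extChartAt_source])]
  rw [h1.mfderiv_eq, mfderiv_comp p hf.mdifferentiableAt (mdifferentiableAt_extChartAt hp),
    mfderiv_eq_fderiv, comps_eq_mfderiv hp]
  rfl

theorem contMDiffAt_comp_chart_symm {N : Type*} {G : Type*} [NormedAddCommGroup G] [NormedSpace ℝ G]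
    {H : Type*} [TopologicalSpace H] {J : ModelWithCorners ℝ G H} [TopologicalSpace N]
    [ChartedSpace H N] {p₀ p : M} (hp : p ∈ (chartAt E p₀).source) {f : M → N} :
    ContMDiffAt 𝓘(ℝ, E) J ∞ f p ↔
      ContMDiffAt 𝓘(ℝ, E) J ∞ (f ∘ (extChartAt 𝓘(ℝ, E) p₀).symm) (extChartAt 𝓘(ℝ, E) p₀ p) := by
  have hp' : p ∈ (extChartAt 𝓘(ℝ, E) p₀).source := by rwa [extChartAt_source]
  have h2 : (extChartAt 𝓘(ℝ, E) p₀).symm (extChartAt 𝓘(ℝ, E) p₀ p) = p :=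
    (extChartAt 𝓘(ℝ, E) p₀).left_inv hp'
  constructor
  · intro h
    refine ContMDiffAt.comp (I' := 𝓘(ℝ, E)) _ (by rwa [h2]) ?_
    have := contMDiffOn_extChartAt_symm (I := 𝓘(ℝ, E)) (n := ∞) p₀
    exact this.contMDiffAt (extChartAt_target_mem_nhds' ((extChartAt 𝓘(ℝ, E) p₀).map_source hp'))
  · intro h
    have h1 : f =ᶠ[𝓝 p] (f ∘ (extChartAt 𝓘(ℝ, E) p₀).symm) ∘ (extChartAt 𝓘(ℝ, E) p₀) := by
      filter_upwards [(chartAt E p₀).open_source.mem_nhds hp] with y hy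
      simp only [Function.comp]
      rw [(extChartAt 𝓘(ℝ, E) p₀).left_inv (by rwa [extChartAt_source])]
    refine ContMDiffAt.congr_of_eventuallyEq ?_ h1
    exact ContMDiffAt.comp (I' := 𝓘(ℝ, E)) _ h (contMDiffAt_extChartAt' hp)

theorem smoothFieldAt_iff {p₀ p : M} (hp : p ∈ (chartAt E p₀).source)
    {Y : Π x : M, TangentSpace 𝓘(ℝ, E) x} :
    SmoothFieldAt Y p ↔
      ContDiffAt ℝ ∞ (fun y => comps p₀ (Y ((extChartAt 𝓘(ℝ, E) p₀).symm y)))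
        (extChartAt 𝓘(ℝ, E) p₀ p) := by
  unfold SmoothFieldAt
  rw [← contMDiffAt_iff_contDiffAt]
  have h3 := Bundle.Trivialization.contMDiffAt_section_iff (IB := 𝓘(ℝ, E)) (n := ∞) (s := Y)
    (trivializationAt E (fun x : M => TangentSpace 𝓘(ℝ, E) x) p₀) (x₀ := p) hp
  refine h3.trans ?_
  have h4 : (fun x => ((trivializationAt E (fun x : M => TangentSpace 𝓘(ℝ, E) x) p₀)
      ⟨x, Y x⟩).2) =ᶠ[𝓝 p] fun x => comps p₀ (Y x) := by
    filter_upwards [(chartAt E p₀).open_source.mem_nhds hp] with y hy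
    exact (Bundle.Trivialization.continuousLinearMapAt_apply_of_mem (R := ℝ) _ hy _).symm
  rw [h4.contMDiffAt_iff]
  exact contMDiffAt_comp_chart_symm hp

/-- The vector field near `p₀` with prescribed components in the preferred chart at `p₀`. -/
def fieldOfComps (p₀ : M) (Y : E → E) : Π x : M, TangentSpace 𝓘(ℝ, E) x :=
  fun x => ofComps p₀ x (Y (extChartAt 𝓘(ℝ, E) p₀ x))

omit [IsManifold 𝓘(ℝ, E) ∞ M] in
theorem eventually_chart_symm {p₀ : M} {y : E} (hy : y ∈ (extChartAt 𝓘(ℝ, E) p₀).target) :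
    ∀ᶠ y' in 𝓝 y, y' ∈ (extChartAt 𝓘(ℝ, E) p₀).target ∧
      (extChartAt 𝓘(ℝ, E) p₀).symm y' ∈ (chartAt E p₀).source ∧
      extChartAt 𝓘(ℝ, E) p₀ ((extChartAt 𝓘(ℝ, E) p₀).symm y') = y' := by
  filter_upwards [extChartAt_target_mem_nhds' hy] with y' hy'
  refine ⟨hy', ?_, (extChartAt 𝓘(ℝ, E) p₀).right_inv hy'⟩
  rw [← extChartAt_source 𝓘(ℝ, E)]
  exact (extChartAt 𝓘(ℝ, E) p₀).map_target hy'

theorem comps_fieldOfComps {p₀ : M} {y : E} (hy : y ∈ (extChartAt 𝓘(ℝ, E) p₀).target) (Y : E → E) :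
    (fun y' => comps p₀ (fieldOfComps p₀ Y ((extChartAt 𝓘(ℝ, E) p₀).symm y'))) =ᶠ[𝓝 y] Y := by
  filter_upwards [eventually_chart_symm hy] with y' hy'
  unfold fieldOfComps
  rw [comps_ofComps hy'.2.1, hy'.2.2]

theorem smoothFieldAt_fieldOfComps {p₀ p : M} (hp : p ∈ (chartAt E p₀).source) {Y : E → E}
    (hY : ContDiffAt ℝ ∞ Y (extChartAt 𝓘(ℝ, E) p₀ p)) : SmoothFieldAt (fieldOfComps p₀ Y) p := by
  rw [smoothFieldAt_iff hp]
  refine hY.congr_of_eventuallyEq (comps_fieldOfComps ?_ Y)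
  exact (extChartAt 𝓘(ℝ, E) p₀).map_source (by rwa [extChartAt_source])

theorem smoothFieldAt_ofComps {p₀ p : M} (hp : p ∈ (chartAt E p₀).source) (a : E) :
    SmoothFieldAt (fun x => ofComps p₀ x a) p :=
  smoothFieldAt_fieldOfComps hp (Y := fun _ => a) contDiffAt_const

theorem comps_extField {p : M} (u : TangentSpace 𝓘(ℝ, E) p) :
    (fun y => comps p (extField u ((extChartAt 𝓘(ℝ, E) p).symm y)))
      =ᶠ[𝓝 (extChartAt 𝓘(ℝ, E) p p)] fun _ => comps p u := by
  filter_upwards [eventually_chart_symm (mem_extChartAt_target (I := 𝓘(ℝ, E)) p)] with y hy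
  rw [extField_apply hy.2.1, comps_ofComps hy.2.1]

theorem smoothFieldAt_extField {p : M} (u : TangentSpace 𝓘(ℝ, E) p) :
    SmoothFieldAt (extField u) p := by
  rw [smoothFieldAt_iff (mem_chart_source E p)]
  exact contDiffAt_const.congr_of_eventuallyEq (comps_extField u)

/-- The tangent vector with given coordinates in the chart of `TM` induced by the preferred chart
at `p₀`. -/
def ofCoords (p₀ : M) (a : E × E) : TangentBundle 𝓘(ℝ, E) M :=
  ⟨(extChartAt 𝓘(ℝ, E) p₀).symm a.1, ofComps p₀ _ a.2⟩

theorem contMDiffOn_ofCoords (p₀ : M) :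
    ContMDiffOn 𝓘(ℝ, E × E) (𝓘(ℝ, E)).tangent ∞ (ofCoords p₀)
      {a : E × E | a.1 ∈ (extChartAt 𝓘(ℝ, E) p₀).target} := by
  have hm : ∀ a ∈ {a : E × E | a.1 ∈ (extChartAt 𝓘(ℝ, E) p₀).target},
      (extChartAt 𝓘(ℝ, E) p₀).symm a.1 ∈ (chartAt E p₀).source := by
    intro a ha
    rw [← extChartAt_source 𝓘(ℝ, E)]
    exact (extChartAt 𝓘(ℝ, E) p₀).map_target ha
  rw [(trivializationAt E (fun x : M => TangentSpace 𝓘(ℝ, E) x) p₀).contMDiffOn_iff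
    (fun a ha => by
      rw [Bundle.Trivialization.mem_source]
      exact hm a ha)]
  constructor
  · exact (contMDiffOn_extChartAt_symm (I := 𝓘(ℝ, E)) (n := ∞) p₀).comp
      (contDiff_fst.contMDiff.contMDiffOn) (fun a ha => ha)
  · refine (contDiff_snd.contMDiff.contMDiffOn (s := _)).congr (f := Prod.snd) ?_
    intro a ha
    rw [← Bundle.Trivialization.continuousLinearMapAt_apply_of_mem (R := ℝ) _ (hm a ha)]
    exact comps_ofComps (hm a ha) _

/-- The coordinates of the vectors in `A`. -/
def coordDomain (p₀ : M) (A : Set (TangentBundle 𝓘(ℝ, E) M)) : Set (E × E) :=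
  {a | a.1 ∈ (extChartAt 𝓘(ℝ, E) p₀).target ∧ ofCoords p₀ a ∈ A}

theorem isOpen_coordDomain (p₀ : M) {A : Set (TangentBundle 𝓘(ℝ, E) M)} (hA : IsOpen A) :
    IsOpen (coordDomain p₀ A) :=
  (contMDiffOn_ofCoords p₀).continuousOn.isOpen_inter_preimage
    ((isOpen_extChartAt_target p₀).preimage continuous_fst) hA

theorem mem_coordDomain {p₀ p : M} (hp : p ∈ (chartAt E p₀).source)
    {A : Set (TangentBundle 𝓘(ℝ, E) M)} {v : TangentSpace 𝓘(ℝ, E) p}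
    (hv : (⟨p, v⟩ : TangentBundle 𝓘(ℝ, E) M) ∈ A) :
    ((extChartAt 𝓘(ℝ, E) p₀ p, comps p₀ v) : E × E) ∈ coordDomain p₀ A := by
  have hp' : p ∈ (extChartAt 𝓘(ℝ, E) p₀).source := by rwa [extChartAt_source]
  refine ⟨(extChartAt 𝓘(ℝ, E) p₀).map_source hp', ?_⟩
  unfold ofCoords
  simp only
  rw [(extChartAt 𝓘(ℝ, E) p₀).left_inv hp', ofComps_comps hp]
  exact hv

/-- The set is a variable equal to `Set.univ` because `mlieBracket` unfolds to a bracket within a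
preimage intersected with the range of the model, which is only propositionally `Set.univ`. -/
theorem lieBracket_eq_zero_of_eventually_const {V W : E → E} {y a b : E} {s : Set E}
    (hV : V =ᶠ[𝓝 y] fun _ => a) (hW : W =ᶠ[𝓝 y] fun _ => b) (hs : s = Set.univ) :
    VectorField.lieBracketWithin ℝ V W s y = 0 := by
  rw [hs, VectorField.lieBracketWithin_univ, VectorField.lieBracket, hV.fderiv_eq, hW.fderiv_eq]
  simp

/-- Both extensions have constant components in the same chart, so they commute. This removes the
bracket term from the curvature and turns vanishing torsion into symmetry of the Christoffel
symbols. -/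
theorem mlieBracket_extField {p : M} (u w : TangentSpace 𝓘(ℝ, E) p) :
    VectorField.mlieBracket 𝓘(ℝ, E) (extField u) (extField w) p = 0 := by
  have key : ∀ u : TangentSpace 𝓘(ℝ, E) p, ∃ a : E, ∀ᶠ y in 𝓝 (extChartAt 𝓘(ℝ, E) p p),
      VectorField.mpullbackWithin 𝓘(ℝ, E) 𝓘(ℝ, E) (extChartAt 𝓘(ℝ, E) p).symm (extField u)
        (Set.range 𝓘(ℝ, E)) y = a := by
    intro u
    use comps p u
    filter_upwards [eventually_chart_symm (mem_extChartAt_target (I := 𝓘(ℝ, E)) p)] with y hy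
    rw [VectorField.mpullbackWithin_apply, extField_apply hy.2.1]
    have hs := TangentBundle.symmL_trivializationAt (I := 𝓘(ℝ, E)) hy.2.1
    rw [hy.2.2] at hs
    obtain ⟨e, he⟩ := isInvertible_mfderivWithin_extChartAt_symm (I := 𝓘(ℝ, E)) hy.1
    have h1 : ∀ a : E, ofComps p ((extChartAt 𝓘(ℝ, E) p).symm y) a = e a := by
      rw [← he] at hs
      exact fun a => DFunLike.congr_fun hs a
    rw [← he, ContinuousLinearMap.inverse_equiv, h1]
    exact e.symm_apply_apply _
  have hset : (extChartAt 𝓘(ℝ, E) p).symm ⁻¹' Set.univ ∩ Set.range 𝓘(ℝ, E) = Set.univ := by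
    simp
  obtain ⟨a, ha⟩ := key u
  obtain ⟨b, hb⟩ := key w
  have := lieBracket_eq_zero_of_eventually_const ha hb hset
  exact (congrArg (mfderiv 𝓘(ℝ, E) 𝓘(ℝ, E) (extChartAt 𝓘(ℝ, E) p) p).inverse this).trans
    (map_zero _)

end Coordinates

/-! ### The vertical Hessian of a function and the symmetries of its derivative. -/

section VerticalHessian

variable {E : Type*} [NormedAddCommGroup E] [NormedSpace ℝ E]

/-- Half of the Hessian of `l` in the second variable. -/
def verticalHessian (l : E × E → ℝ) (a : E × E) : E →L[ℝ] E →L[ℝ] ℝ :=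
  (1 / 2 : ℝ) • ((ContinuousLinearMap.compL ℝ E (E × E) ℝ).flip
    (ContinuousLinearMap.inr ℝ E E)).comp
      ((fderiv ℝ (fderiv ℝ l) a).comp (ContinuousLinearMap.inr ℝ E E))

theorem verticalHessian_apply (l : E × E → ℝ) (a : E × E) (u w : E) :
    verticalHessian l a u w = 1 / 2 * fderiv ℝ (fderiv ℝ l) a (0, u) (0, w) := rfl

variable {l : E × E → ℝ} {a : E × E}

theorem two_le_infty : (2 : WithTop ℕ∞) ≤ ∞ := ENat.LEInfty.out

theorem contDiffAt_fderiv_of_smooth {G H : Type*} [NormedAddCommGroup G] [NormedSpace ℝ G]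
    [NormedAddCommGroup H] [NormedSpace ℝ H] {f : G → H} {x : G} (hf : ContDiffAt ℝ ∞ f x) :
    ContDiffAt ℝ ∞ (fderiv ℝ f) x :=
  hf.fderiv_right (by simp)

theorem ContDiffAt.differentiableAt_of_smooth {G H : Type*} [NormedAddCommGroup G]
    [NormedSpace ℝ G] [NormedAddCommGroup H] [NormedSpace ℝ H] {f : G → H} {x : G}
    (hf : ContDiffAt ℝ ∞ f x) : DifferentiableAt ℝ f x :=
  hf.differentiableAt (by simp)

theorem contDiffAt_verticalHessian (hl : ContDiffAt ℝ ∞ l a) :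
    ContDiffAt ℝ ∞ (verticalHessian l) a := by
  have h2 := contDiffAt_fderiv_of_smooth (contDiffAt_fderiv_of_smooth hl)
  exact (contDiffAt_const.clm_comp (h2.clm_comp contDiffAt_const)).const_smul _

theorem verticalHessian_symm (hl : ContDiffAt ℝ ∞ l a) (u w : E) :
    verticalHessian l a u w = verticalHessian l a w u := by
  rw [verticalHessian_apply, verticalHessian_apply]
  rw [(hl.isSymmSndFDerivAt (by simp only [minSmoothness_of_isRCLikeNormedField]; exact two_le_infty)).eq]

theorem fderiv_verticalHessian_apply (hl : ContDiffAt ℝ ∞ l a) (z : E × E) (u w : E) :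
    fderiv ℝ (verticalHessian l) a z u w
      = fderiv ℝ (fun a' => verticalHessian l a' u w) a z := by
  have h := (ContDiffAt.differentiableAt_of_smooth (contDiffAt_verticalHessian hl)).hasFDerivAt
  have h1 := (h.clm_apply (hasFDerivAt_const u a)).clm_apply (hasFDerivAt_const w a)
  rw [h1.fderiv]
  simp

theorem fderiv_verticalHessian_symm (hl : ∀ᶠ a' in 𝓝 a, ContDiffAt ℝ ∞ l a') (z : E × E)
    (u w : E) :
    fderiv ℝ (verticalHessian l) a z u w = fderiv ℝ (verticalHessian l) a z w u := by
  rw [fderiv_verticalHessian_apply hl.self_of_nhds, fderiv_verticalHessian_apply hl.self_of_nhds]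
  have : (fun a' => verticalHessian l a' u w) =ᶠ[𝓝 a] fun a' => verticalHessian l a' w u := by
    filter_upwards [hl] with a' ha'
    exact verticalHessian_symm ha' u w
  rw [this.fderiv_eq]

/-- Schwarz's theorem for the function a' ↦ Dl(a')(0, w), whose second vertical derivative is, up to
the factor 1/2, the derivative of the vertical Hessian. Together with `fderiv_verticalHessian_symm`
it gives the total symmetry of the Cartan tensor. -/
theorem fderiv_verticalHessian_swap (hl : ContDiffAt ℝ ∞ l a) (z u w : E) :
    fderiv ℝ (verticalHessian l) a (0, z) u w = fderiv ℝ (verticalHessian l) a (0, u) z w := by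
  have hh : ContDiffAt ℝ ∞ (fun a' => fderiv ℝ l a' (0, w)) a :=
    (contDiffAt_fderiv_of_smooth hl).clm_apply contDiffAt_const
  have h2 := contDiffAt_fderiv_of_smooth (contDiffAt_fderiv_of_smooth hl)
  have h1 : ∀ᶠ a' in 𝓝 a, DifferentiableAt ℝ (fderiv ℝ l) a' :=
    ((contDiffAt_fderiv_of_smooth hl).of_le (m := 1) (by simp)).eventually (by simp) |>.mono
      fun a' ha' => ha'.differentiableAt (by simp)
  have key : ∀ u z : E, fderiv ℝ (verticalHessian l) a (0, z) u w
      = 1 / 2 * fderiv ℝ (fderiv ℝ (fun a' => fderiv ℝ l a' (0, w))) a (0, z) (0, u) := by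
    intro u z
    rw [fderiv_verticalHessian_apply hl]
    have e : (fun a' => verticalHessian l a' u w)
        =ᶠ[𝓝 a] fun a' => 1 / 2 * fderiv ℝ (fun a' => fderiv ℝ l a' (0, w)) a' (0, u) := by
      filter_upwards [h1] with a' ha'
      rw [verticalHessian_apply]
      have := (ha'.hasFDerivAt.clm_apply (hasFDerivAt_const ((0, w) : E × E) a')).fderiv
      rw [this]
      simp
    have h3 := (ContDiffAt.differentiableAt_of_smooth (contDiffAt_fderiv_of_smooth hh)).hasFDerivAt
    have h4 := ((h3.clm_apply (hasFDerivAt_const ((0, u) : E × E) a)).const_mul (1 / 2 : ℝ)).fderiv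
    rw [e.fderiv_eq, h4]
    simp
  rw [key, key, (hh.isSymmSndFDerivAt (by simp only [minSmoothness_of_isRCLikeNormedField]; exact two_le_infty)).eq]

end VerticalHessian

/-! ### The fundamental and Cartan tensors in coordinates. -/

section Metric

variable {E : Type*} [NormedAddCommGroup E] [NormedSpace ℝ E]
  {M : Type*} [TopologicalSpace M] [ChartedSpace E M] [IsManifold 𝓘(ℝ, E) ∞ M]
  {A : Set (TangentBundle 𝓘(ℝ, E) M)} {L : TangentBundle 𝓘(ℝ, E) M → ℝ}

/-- The fundamental tensor in coordinates. -/
def coordMetric (L : TangentBundle 𝓘(ℝ, E) M → ℝ) (p₀ : M) : E × E → E →L[ℝ] E →L[ℝ] ℝ :=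
  verticalHessian (L ∘ ofCoords p₀)

theorem contDiffAt_comp_ofCoords (hA : IsOpen A)
    (hL : ContMDiffOn (𝓘(ℝ, E)).tangent 𝓘(ℝ, ℝ) ∞ L A) {p₀ : M} {a : E × E}
    (ha : a ∈ coordDomain p₀ A) : ContDiffAt ℝ ∞ (L ∘ ofCoords p₀) a := by
  rw [← contMDiffAt_iff_contDiffAt]
  refine ContMDiffAt.comp a (hL.contMDiffAt (hA.mem_nhds ha.2)) ?_
  exact (contMDiffOn_ofCoords p₀).contMDiffAt
    (((isOpen_extChartAt_target p₀).preimage continuous_fst).mem_nhds ha.1)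

theorem eventually_mem_coordDomain (hA : IsOpen A) {p₀ : M} {a : E × E}
    (ha : a ∈ coordDomain p₀ A) : ∀ᶠ a' in 𝓝 a, a' ∈ coordDomain p₀ A :=
  (isOpen_coordDomain p₀ hA).mem_nhds ha

theorem ofCoords_comps {p₀ p : M} (hp : p ∈ (chartAt E p₀).source) (v : TangentSpace 𝓘(ℝ, E) p) :
    ofCoords p₀ (extChartAt 𝓘(ℝ, E) p₀ p, comps p₀ v) = ⟨p, v⟩ := by
  have hp' : p ∈ (extChartAt 𝓘(ℝ, E) p₀).source := by rwa [extChartAt_source]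
  unfold ofCoords
  simp only
  rw [(extChartAt 𝓘(ℝ, E) p₀).left_inv hp', ofComps_comps hp]

/-- The base space `K` is separate from `E` because vertical lines occur over the ambient chart and
also over the chart of S with ambient fibre vectors. -/
theorem deriv_comp_vertical {G K : Type*} [NormedAddCommGroup G] [NormedSpace ℝ G]
    [NormedAddCommGroup K] [NormedSpace ℝ K] {f : K × E → G} {y : K} {v z : E} (hf : DifferentiableAt ℝ f (y, v)) :
    deriv (fun t : ℝ => f (y, v + t • z)) 0 = fderiv ℝ f (y, v) (0, z) := by
  have h1 : HasDerivAt (fun t : ℝ => ((y, v + t • z) : K × E)) (0, z) 0 := by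
    refine (hasDerivAt_const _ _).prodMk ?_
    simpa using ((hasDerivAt_id (0 : ℝ)).smul_const z).const_add v
  have h2 : HasFDerivAt f (fderiv ℝ f (y, v)) (y, v + (0 : ℝ) • z) := by
    simpa using hf.hasFDerivAt
  exact (h2.comp_hasDerivAt (0 : ℝ) h1).deriv

theorem eventually_vertical {K : Type*} [NormedAddCommGroup K] {y : K} {v z : E}
    {P : K × E → Prop} (h : ∀ᶠ a in 𝓝 (y, v), P a) :
    ∀ᶠ t : ℝ in 𝓝 0, P (y, v + t • z) := by
  have hc : Continuous fun t : ℝ => ((y, v + t • z) : K × E) := by fun_prop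
  have : Filter.Tendsto (fun t : ℝ => ((y, v + t • z) : K × E)) (𝓝 0) (𝓝 (y, v)) := by
    simpa using hc.tendsto 0
  exact this.eventually h

theorem fundTensor_eq (hA : IsOpen A) (hL : ContMDiffOn (𝓘(ℝ, E)).tangent 𝓘(ℝ, ℝ) ∞ L A)
    {p₀ p : M} (hp : p ∈ (chartAt E p₀).source) {v : TangentSpace 𝓘(ℝ, E) p}
    (hv : (⟨p, v⟩ : TangentBundle 𝓘(ℝ, E) M) ∈ A) (u w : TangentSpace 𝓘(ℝ, E) p) :
    fundTensor L v u w = coordMetric L p₀ (extChartAt 𝓘(ℝ, E) p₀ p, comps p₀ v)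
      (comps p₀ u) (comps p₀ w) := by
  have hd := mem_coordDomain hp hv
  set y := extChartAt 𝓘(ℝ, E) p₀ p
  have h1 : ∀ v : TangentSpace 𝓘(ℝ, E) p, L ⟨p, v⟩ = (L ∘ ofCoords p₀) (y, comps p₀ v) := by
    intro v
    simp only [Function.comp]
    rw [ofCoords_comps hp]
  unfold fundTensor
  simp only [h1, comps_add, comps_smul]
  -- The inner derivative is identified only for small s, where v + s u still lies in `A` and L is
  -- smooth; the germ at 0 is all that the outer derivative sees.
  have h2 : (fun s : ℝ => deriv (fun t : ℝ =>
        (L ∘ ofCoords p₀) (y, comps p₀ v + s • comps p₀ u + t • comps p₀ w)) 0)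
      =ᶠ[𝓝 0] fun s : ℝ => fderiv ℝ (L ∘ ofCoords p₀) (y, comps p₀ v + s • comps p₀ u)
        (0, comps p₀ w) := by
    filter_upwards [eventually_vertical (z := comps p₀ u) (eventually_mem_coordDomain hA hd)]
      with s hs
    exact deriv_comp_vertical
      (ContDiffAt.differentiableAt_of_smooth (contDiffAt_comp_ofCoords hA hL hs))
  rw [h2.deriv_eq]
  have h3 := ContDiffAt.differentiableAt_of_smooth
    (contDiffAt_fderiv_of_smooth (contDiffAt_comp_ofCoords hA hL hd))
  rw [deriv_comp_vertical (f := fun a => fderiv ℝ (L ∘ ofCoords p₀) a (0, comps p₀ w))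
    (h3.clm_apply (differentiableAt_const _))]
  rw [(h3.hasFDerivAt.clm_apply (hasFDerivAt_const ((0, comps p₀ w) : E × E) _)).fderiv]
  unfold coordMetric
  rw [verticalHessian_apply]
  simp

theorem cartanTensor_eq (hA : IsOpen A) (hL : ContMDiffOn (𝓘(ℝ, E)).tangent 𝓘(ℝ, ℝ) ∞ L A)
    {p₀ p : M} (hp : p ∈ (chartAt E p₀).source) {v : TangentSpace 𝓘(ℝ, E) p}
    (hv : (⟨p, v⟩ : TangentBundle 𝓘(ℝ, E) M) ∈ A) (u w z : TangentSpace 𝓘(ℝ, E) p) :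
    cartanTensor L v u w z = 1 / 2 * fderiv ℝ (coordMetric L p₀)
      (extChartAt 𝓘(ℝ, E) p₀ p, comps p₀ v) (0, comps p₀ z) (comps p₀ u) (comps p₀ w) := by
  have hd := mem_coordDomain hp hv
  unfold cartanTensor
  have h2 : (fun t : ℝ => fundTensor L (v + t • z) u w) =ᶠ[𝓝 0] fun t : ℝ =>
      coordMetric L p₀ (extChartAt 𝓘(ℝ, E) p₀ p, comps p₀ v + t • comps p₀ z)
        (comps p₀ u) (comps p₀ w) := by
    filter_upwards [eventually_vertical (z := comps p₀ z) (eventually_mem_coordDomain hA hd)]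
      with t ht
    rw [← comps_smul, ← comps_add] at ht ⊢
    refine fundTensor_eq hA hL hp ?_ u w
    rw [← ofCoords_comps hp]
    exact ht.2
  have hl := contDiffAt_comp_ofCoords hA hL hd
  have h3 := ContDiffAt.differentiableAt_of_smooth (contDiffAt_verticalHessian hl)
  rw [h2.deriv_eq, deriv_comp_vertical (f := fun a => coordMetric L p₀ a (comps p₀ u) (comps p₀ w))
    ((h3.clm_apply (differentiableAt_const _)).clm_apply (differentiableAt_const _))]
  unfold coordMetric
  rw [fderiv_verticalHessian_apply hl]

end Metric

/-! ### Locality of anisotropic connections and their Christoffel symbols. -/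

section Christoffel

variable {E : Type*} [NormedAddCommGroup E] [NormedSpace ℝ E]
  {M : Type*} [TopologicalSpace M] [ChartedSpace E M] [IsManifold 𝓘(ℝ, E) ∞ M]
  {A : Set (TangentBundle 𝓘(ℝ, E) M)}

/-- Locality follows from the Leibniz rule without bump functions. The indicator f of {Y = Z} is 1
near p, hence smooth at p with zero derivative there, and f Y = f Z everywhere; the Leibniz rule for
both products then compares the two derivatives. -/
theorem AnisotropicConnection.congr_of_eventuallyEq (D : AnisotropicConnection A) {p : M}
    {v : TangentSpace 𝓘(ℝ, E) p} (hv : (⟨p, v⟩ : TangentBundle 𝓘(ℝ, E) M) ∈ A)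
    {Y Z : Π x : M, TangentSpace 𝓘(ℝ, E) x} (hY : SmoothFieldAt Y p) (hZ : SmoothFieldAt Z p)
    (h : ∀ᶠ x in 𝓝 p, Y x = Z x) (u : TangentSpace 𝓘(ℝ, E) p) :
    D.toFun p v Y u = D.toFun p v Z u := by
  classical
  let f : M → ℝ := fun x => if Y x = Z x then 1 else 0
  have hf : f =ᶠ[𝓝 p] fun _ => 1 := by
    filter_upwards [h] with x hx
    simp [f, hx]
  have hfs : ContMDiffAt 𝓘(ℝ, E) 𝓘(ℝ, ℝ) ∞ f p := contMDiffAt_const.congr_of_eventuallyEq hf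
  have hd : dirDeriv f p u = 0 := by
    unfold dirDeriv
    rw [hf.mfderiv_eq, mfderiv_const]
    rfl
  have hfp : f p = 1 := hf.self_of_nhds
  have e : (fun x => f x • Y x) = fun x => f x • Z x := by
    funext x
    by_cases hx : Y x = Z x
    · simp only [hx]
    · simp [f, hx]
  have h1 := D.leibniz p v f Y u hv hfs hY
  have h2 := D.leibniz p v f Z u hv hfs hZ
  rw [e, h2, hd, hfp] at h1
  simpa using h1.symm

theorem AnisotropicConnection.zero_field (D : AnisotropicConnection A) {p : M}
    {v : TangentSpace 𝓘(ℝ, E) p} (hv : (⟨p, v⟩ : TangentBundle 𝓘(ℝ, E) M) ∈ A)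
    {Y : Π x : M, TangentSpace 𝓘(ℝ, E) x} (hY : SmoothFieldAt Y p)
    (u : TangentSpace 𝓘(ℝ, E) p) :
    D.toFun p v (fun _ => 0) u = 0 := by
  have h := D.leibniz p v (fun _ => 0) Y u hv contMDiffAt_const hY
  have hd : dirDeriv (fun _ : M => (0 : ℝ)) p u = 0 := by
    unfold dirDeriv
    rw [mfderiv_const]
    rfl
  rw [hd] at h
  simpa using h

theorem dirDeriv_eq {p₀ p : M} (hp : p ∈ (chartAt E p₀).source) {f : M → ℝ} {f' : E → ℝ}
    (hf' : DifferentiableAt ℝ f' (extChartAt 𝓘(ℝ, E) p₀ p))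
    (hf : ∀ᶠ y in 𝓝 (extChartAt 𝓘(ℝ, E) p₀ p), f ((extChartAt 𝓘(ℝ, E) p₀).symm y) = f' y)
    (u : TangentSpace 𝓘(ℝ, E) p) :
    dirDeriv f p u = fderiv ℝ f' (extChartAt 𝓘(ℝ, E) p₀ p) (comps p₀ u) := by
  have e : f ∘ (extChartAt 𝓘(ℝ, E) p₀).symm =ᶠ[𝓝 (extChartAt 𝓘(ℝ, E) p₀ p)] f' := hf
  unfold dirDeriv
  rw [← e.fderiv_eq]
  exact mfderiv_eq_fderiv_comps hp (hf'.congr_of_eventuallyEq e) u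

/-- The components at `p₀` of the derivative of the field with constant components `w`. -/
def connSymbol (D : AnisotropicConnection A) (p₀ : M) (q : TangentBundle 𝓘(ℝ, E) M) (u w : E) : E :=
  comps p₀ (D.toFun q.1 q.2 (fun x => ofComps p₀ x w) (ofComps p₀ q.1 u))

theorem connSymbol_add_left (D : AnisotropicConnection A) (p₀ : M) (q : TangentBundle 𝓘(ℝ, E) M)
    (u u' w : E) : connSymbol D p₀ q (u + u') w = connSymbol D p₀ q u w + connSymbol D p₀ q u' w := by
  unfold connSymbol
  rw [ofComps_add, map_add, comps_add]

theorem connSymbol_smul_left (D : AnisotropicConnection A) (p₀ : M) (q : TangentBundle 𝓘(ℝ, E) M)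
    (c : ℝ) (u w : E) : connSymbol D p₀ q (c • u) w = c • connSymbol D p₀ q u w := by
  unfold connSymbol
  rw [ofComps_smul, map_smul, comps_smul]

/-- Induction on the sum with additivity and the Leibniz rule. Constant coefficients give linearity
of the symbols in the differentiated field; variable coefficients give the derivative of an
arbitrary field. -/
theorem comps_conn_sum (D : AnisotropicConnection A) {p₀ p : M} (hp : p ∈ (chartAt E p₀).source)
    {v : TangentSpace 𝓘(ℝ, E) p} (hv : (⟨p, v⟩ : TangentBundle 𝓘(ℝ, E) M) ∈ A) {ι : Type*}
    (s : Finset ι) (c : ι → E → ℝ) (b : ι → E)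
    (hc : ∀ k, ContDiffAt ℝ ∞ (c k) (extChartAt 𝓘(ℝ, E) p₀ p)) (u : TangentSpace 𝓘(ℝ, E) p) :
    comps p₀ (D.toFun p v (fieldOfComps p₀ (fun y => ∑ k ∈ s, c k y • b k)) u)
      = ∑ k ∈ s, (fderiv ℝ (c k) (extChartAt 𝓘(ℝ, E) p₀ p) (comps p₀ u) • b k
          + c k (extChartAt 𝓘(ℝ, E) p₀ p) • connSymbol D p₀ ⟨p, v⟩ (comps p₀ u) (b k)) := by
  classical
  have hp' : p ∈ (extChartAt 𝓘(ℝ, E) p₀).source := by rwa [extChartAt_source]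
  induction s using Finset.induction_on with
  | empty =>
    have : fieldOfComps p₀ (fun y : E => ∑ k ∈ (∅ : Finset ι), c k y • b k)
        = fun x : M => (0 : TangentSpace 𝓘(ℝ, E) x) := by
      funext x
      simp only [Finset.sum_empty]
      exact map_zero _
    rw [this, D.zero_field hv (smoothFieldAt_ofComps hp (0 : E)), comps_zero]
    simp
  | insert k s hk ih =>
    have e : fieldOfComps p₀ (fun y : E => ∑ k ∈ insert k s, c k y • b k)
        = fun x : M => (c k (extChartAt 𝓘(ℝ, E) p₀ x)) • ofComps p₀ x (b k)
          + fieldOfComps p₀ (fun y : E => ∑ k ∈ s, c k y • b k) x := by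
      funext x
      unfold fieldOfComps
      simp only [Finset.sum_insert hk]
      rw [ofComps_add, ofComps_smul]
    have hk1 : ContMDiffAt 𝓘(ℝ, E) 𝓘(ℝ, ℝ) ∞ (fun x => c k (extChartAt 𝓘(ℝ, E) p₀ x)) p :=
      ContMDiffAt.comp (I' := 𝓘(ℝ, E)) p (hc k).contMDiffAt (contMDiffAt_extChartAt' hp)
    have hk2 : SmoothFieldAt
        (fun x : M => (c k (extChartAt 𝓘(ℝ, E) p₀ x)) • ofComps p₀ x (b k)) p := by
      have := smoothFieldAt_fieldOfComps (Y := fun y => c k y • b k) hp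
        ((hc k).smul contDiffAt_const)
      unfold fieldOfComps at this
      simpa only [ofComps_smul] using this
    have hs : SmoothFieldAt (fieldOfComps p₀ (fun y : E => ∑ k ∈ s, c k y • b k)) p :=
      smoothFieldAt_fieldOfComps hp
        (ContDiffAt.sum fun k _ => (hc k).smul contDiffAt_const)
    have hd : dirDeriv (fun x => c k (extChartAt 𝓘(ℝ, E) p₀ x)) p u
        = fderiv ℝ (c k) (extChartAt 𝓘(ℝ, E) p₀ p) (comps p₀ u) := by
      refine dirDeriv_eq hp (ContDiffAt.differentiableAt_of_smooth (hc k)) ?_ u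
      filter_upwards [eventually_chart_symm ((extChartAt 𝓘(ℝ, E) p₀).map_source hp')] with y hy
      rw [hy.2.2]
    rw [e, D.add p v _ _ u hv hk2 hs,
      D.leibniz p v _ _ u hv hk1 (smoothFieldAt_ofComps hp (b k)), comps_add, ih,
      Finset.sum_insert hk, comps_add, comps_smul, comps_smul, comps_ofComps hp, hd]
    unfold connSymbol
    simp only
    rw [ofComps_comps hp]

variable [FiniteDimensional ℝ E]

/-- The Christoffel symbols, in the preferred chart at `p₀`, of an anisotropic connection, as a
function with bilinear values. -/
def christoffel (D : AnisotropicConnection A) (p₀ : M) (a : E × E) : E →L[ℝ] E →L[ℝ] E :=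
  ∑ j, ∑ k, ((Module.finBasis ℝ E).coord j).toContinuousLinearMap.smulRight
    (((Module.finBasis ℝ E).coord k).toContinuousLinearMap.smulRight
      (connSymbol D p₀ (ofCoords p₀ a) (Module.finBasis ℝ E j) (Module.finBasis ℝ E k)))

/-- Additivity and the Leibniz rule are available only at vectors of `A`, so linearity in this slot,
unlike the left one, is conditional. For this reason `christoffel` is built by expansion in a basis:
it is bilinear at every point and agrees with `connSymbol` on `coordDomain`. -/
theorem connSymbol_sum_right (D : AnisotropicConnection A) {p₀ : M} {q : TangentBundle 𝓘(ℝ, E) M}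
    (hp : q.1 ∈ (chartAt E p₀).source) (hq : q ∈ A) (u w : E) :
    connSymbol D p₀ q u w = ∑ k, (Module.finBasis ℝ E).coord k w
      • connSymbol D p₀ q u (Module.finBasis ℝ E k) := by
  have h := comps_conn_sum D hp (v := q.2) hq Finset.univ
    (fun k _ => (Module.finBasis ℝ E).coord k w) (Module.finBasis ℝ E)
    (fun _ => contDiffAt_const) (ofComps p₀ q.1 u)
  have e : (fun _ : E => ∑ k, (Module.finBasis ℝ E).coord k w • Module.finBasis ℝ E k)
      = fun _ => w := by
    funext _
    exact (Module.finBasis ℝ E).sum_repr w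
  rw [e] at h
  simp only [comps_ofComps hp, fderiv_const_apply, zero_apply, zero_smul, zero_add] at h
  exact h

theorem connSymbol_sum_left (D : AnisotropicConnection A) (p₀ : M) (q : TangentBundle 𝓘(ℝ, E) M)
    (u w : E) :
    connSymbol D p₀ q u w = ∑ j, (Module.finBasis ℝ E).coord j u
      • connSymbol D p₀ q (Module.finBasis ℝ E j) w := by
  let f : E →ₗ[ℝ] E :=
    { toFun := fun u => connSymbol D p₀ q u w
      map_add' := fun u u' => connSymbol_add_left D p₀ q u u' w
      map_smul' := fun c u => connSymbol_smul_left D p₀ q c u w }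
  change f u = ∑ j, (Module.finBasis ℝ E).coord j u • f (Module.finBasis ℝ E j)
  conv_lhs => rw [← (Module.finBasis ℝ E).sum_repr u]
  rw [map_sum]
  simp

omit [FiniteDimensional ℝ E] in
theorem mem_source_of_mem_coordDomain {p₀ : M} {a : E × E} (ha : a ∈ coordDomain p₀ A) :
    (ofCoords p₀ a).1 ∈ (chartAt E p₀).source := by
  rw [← extChartAt_source 𝓘(ℝ, E)]
  exact (extChartAt 𝓘(ℝ, E) p₀).map_target ha.1

theorem christoffel_apply (D : AnisotropicConnection A) {p₀ : M} {a : E × E}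
    (ha : a ∈ coordDomain p₀ A) (u w : E) :
    christoffel D p₀ a u w = connSymbol D p₀ (ofCoords p₀ a) u w := by
  unfold christoffel
  rw [connSymbol_sum_left]
  simp only [_root_.sum_apply, ContinuousLinearMap.smulRight_apply,
    _root_.smul_apply]
  refine Finset.sum_congr rfl fun j _ => ?_
  rw [connSymbol_sum_right D (mem_source_of_mem_coordDomain ha) ha.2, Finset.smul_sum]
  rfl

theorem contDiffOn_christoffel (D : AnisotropicConnection A) (p₀ : M) :
    ContDiffOn ℝ ∞ (christoffel D p₀) (coordDomain p₀ A) := by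
  rw [contDiffOn_clm_apply]
  intro u
  rw [contDiffOn_clm_apply]
  intro w
  have hU : IsOpen (chartAt E p₀).source := (chartAt E p₀).open_source
  have h1 := D.smooth (chartAt E p₀).source (fun x => ofComps p₀ x u) (fun x => ofComps p₀ x w) hU
    (fun x hx => smoothFieldAt_ofComps hx u) (fun x hx => smoothFieldAt_ofComps hx w)
  have h2 := ((trivializationAt E (fun x : M => TangentSpace 𝓘(ℝ, E) x) p₀).contMDiffOn_iff
    (IB := 𝓘(ℝ, E)) (n := ∞) (fun v hv => by
      rw [Bundle.Trivialization.mem_source]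
      exact hv.2)).1 h1
  have h3 := h2.2.comp ((contMDiffOn_ofCoords p₀).mono
    (fun a ha => ha.1 : coordDomain p₀ A ⊆ _))
    (fun a ha => ⟨ha.2, mem_source_of_mem_coordDomain ha⟩)
  rw [contMDiffOn_iff_contDiffOn] at h3
  refine h3.congr fun a ha => ?_
  rw [christoffel_apply D ha]
  exact Bundle.Trivialization.continuousLinearMapAt_apply_of_mem (R := ℝ) _
    (mem_source_of_mem_coordDomain ha) _

theorem contDiffAt_christoffel (D : AnisotropicConnection A) (hA : IsOpen A) {p₀ : M} {a : E × E}
    (ha : a ∈ coordDomain p₀ A) : ContDiffAt ℝ ∞ (christoffel D p₀) a :=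
  (contDiffOn_christoffel D p₀).contDiffAt ((isOpen_coordDomain p₀ hA).mem_nhds ha)

/-- By locality Y may be replaced by the field with components Y', which is then expanded in a basis
of E. The components Y' are a separate argument so that they need to agree with those of Y only near
the point. -/
theorem comps_conn (D : AnisotropicConnection A) {p₀ p : M} (hp : p ∈ (chartAt E p₀).source)
    {v : TangentSpace 𝓘(ℝ, E) p} (hv : (⟨p, v⟩ : TangentBundle 𝓘(ℝ, E) M) ∈ A)
    {Y : Π x : M, TangentSpace 𝓘(ℝ, E) x} {Y' : E → E}
    (hY' : ContDiffAt ℝ ∞ Y' (extChartAt 𝓘(ℝ, E) p₀ p))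
    (hY : ∀ᶠ y in 𝓝 (extChartAt 𝓘(ℝ, E) p₀ p),
      comps p₀ (Y ((extChartAt 𝓘(ℝ, E) p₀).symm y)) = Y' y)
    (u : TangentSpace 𝓘(ℝ, E) p) :
    comps p₀ (D.toFun p v Y u) = fderiv ℝ Y' (extChartAt 𝓘(ℝ, E) p₀ p) (comps p₀ u)
      + christoffel D p₀ (extChartAt 𝓘(ℝ, E) p₀ p, comps p₀ v) (comps p₀ u)
          (Y' (extChartAt 𝓘(ℝ, E) p₀ p)) := by
  have hp' : p ∈ (extChartAt 𝓘(ℝ, E) p₀).source := by rwa [extChartAt_source]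
  have hYs : SmoothFieldAt Y p := (smoothFieldAt_iff hp).2 (hY'.congr_of_eventuallyEq hY)
  have e : (fun y => ∑ k, (Module.finBasis ℝ E).coord k (Y' y) • Module.finBasis ℝ E k) = Y' := by
    funext y
    exact (Module.finBasis ℝ E).sum_repr (Y' y)
  have h1 : ∀ᶠ x in 𝓝 p, Y x = fieldOfComps p₀ Y' x := by
    have hc : Filter.Tendsto (extChartAt 𝓘(ℝ, E) p₀) (𝓝 p) (𝓝 (extChartAt 𝓘(ℝ, E) p₀ p)) :=
      continuousAt_extChartAt' hp'
    filter_upwards [hc.eventually hY, (chartAt E p₀).open_source.mem_nhds hp] with x hx hxs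
    rw [(extChartAt 𝓘(ℝ, E) p₀).left_inv (by rwa [extChartAt_source])] at hx
    unfold fieldOfComps
    rw [← hx, ofComps_comps hxs]
  rw [D.congr_of_eventuallyEq hv hYs (smoothFieldAt_fieldOfComps hp hY') h1 u]
  have hc : ∀ k, ContDiffAt ℝ ∞ (fun y => (Module.finBasis ℝ E).coord k (Y' y))
      (extChartAt 𝓘(ℝ, E) p₀ p) := fun k =>
    ((Module.finBasis ℝ E).coord k).toContinuousLinearMap.contDiff.contDiffAt.comp _ hY'
  have h2 := comps_conn_sum D hp hv Finset.univ
    (fun k y => (Module.finBasis ℝ E).coord k (Y' y)) (Module.finBasis ℝ E) hc u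
  rw [e] at h2
  rw [h2, christoffel_apply D (mem_coordDomain hp hv), ofCoords_comps hp,
    connSymbol_sum_right D hp hv, Finset.sum_add_distrib]
  congr 1
  have hd : ∀ k, fderiv ℝ (fun y => (Module.finBasis ℝ E).coord k (Y' y))
      (extChartAt 𝓘(ℝ, E) p₀ p) (comps p₀ u) = (Module.finBasis ℝ E).coord k
        (fderiv ℝ Y' (extChartAt 𝓘(ℝ, E) p₀ p) (comps p₀ u)) := by
    intro k
    have := ((Module.finBasis ℝ E).coord k).toContinuousLinearMap.hasFDerivAt.comp _
      (ContDiffAt.differentiableAt_of_smooth hY').hasFDerivAt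
    exact DFunLike.congr_fun this.fderiv (comps p₀ u)
  simp only [hd]
  exact (Module.finBasis ℝ E).sum_repr _

end Christoffel

/-! ### Curvature of an immersion in coordinates. -/

section Local

variable {E : Type*} [NormedAddCommGroup E] [NormedSpace ℝ E]
  {F : Type*} [NormedAddCommGroup F] [NormedSpace ℝ F]

/-- The curvature tensor of an anisotropic connection in terms of its Christoffel symbols. -/
def coordCurvature (Γ : E × E → E →L[ℝ] E →L[ℝ] E) (a : E × E) (u w z : E) : E :=
  fderiv ℝ Γ a (u, -Γ a u a.2) w z + Γ a u (Γ a w z)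
    - (fderiv ℝ Γ a (w, -Γ a w a.2) u z + Γ a w (Γ a u z))

/-- The covariant derivative of an anisotropic tensor of type `(1, 2)` in terms of the Christoffel
symbols. -/
def coordCovDeriv (γ Q : F × F → F →L[ℝ] F →L[ℝ] F) (a : F × F) (u w z : F) : F :=
  fderiv ℝ Q a (u, -γ a u a.2) w z + γ a u (Q a w z) - Q a (γ a u w) z - Q a w (γ a u z)

/-- The horizontal direction of γ + Q is that of γ minus the vertical vector Q(u, v). This shift
accounts for the vertical derivatives of γ and of Q along Q(·, v). The terms Q(γ(u, w), z) in the
two covariant derivatives cancel by symmetry of γ. -/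
theorem coordCurvature_add {γ Q : F × F → F →L[ℝ] F →L[ℝ] F} {a : F × F}
    (hγ : DifferentiableAt ℝ γ a) (hQ : DifferentiableAt ℝ Q a)
    (hsymm : ∀ u w, γ a u w = γ a w u) (u w z : F) :
    coordCurvature (fun a => γ a + Q a) a u w z
      = coordCurvature γ a u w z
        + (fderiv ℝ γ a (0, Q a w a.2) u z - fderiv ℝ γ a (0, Q a u a.2) w z)
        + (coordCovDeriv γ Q a u w z - coordCovDeriv γ Q a w u z)
        + (fderiv ℝ Q a (0, Q a w a.2) u z - fderiv ℝ Q a (0, Q a u a.2) w z)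
        + (Q a u (Q a w z) - Q a w (Q a u z)) := by
  have hf : fderiv ℝ (fun a => γ a + Q a) a = fderiv ℝ γ a + fderiv ℝ Q a := 
    fderiv_fun_add (𝕜 := ℝ) (E := F × F) (F := F →L[ℝ] F →L[ℝ] F) hγ hQ
  have hs : ∀ u : F, ((u, -(γ a u a.2 + Q a u a.2)) : F × F)
      = (u, -γ a u a.2) - (0, Q a u a.2) := by
    intro u
    ext
    · simp
    · simp
      abel
  unfold coordCurvature coordCovDeriv
  simp only [hf, _root_.add_apply, hs, map_sub, map_add, _root_.sub_apply, hsymm w u]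
  abel

/-- The second derivative of an immersion `ι : F → E` relative to the connection with Christoffel
symbols `Γ`. -/
def immersionHessian (ι : F → E) (Γ : E × E → E →L[ℝ] E →L[ℝ] E) (a : F × E) :
    F →L[ℝ] F →L[ℝ] E :=
  fderiv ℝ (fderiv ℝ ι) a.1 + ((ContinuousLinearMap.compL ℝ F E E).flip (fderiv ℝ ι a.1)).comp
    ((Γ (ι a.1, a.2)).comp (fderiv ℝ ι a.1))

theorem immersionHessian_apply (ι : F → E) (Γ : E × E → E →L[ℝ] E →L[ℝ] E) (a : F × E) (u z : F) :
    immersionHessian ι Γ a u z = fderiv ℝ (fderiv ℝ ι) a.1 u z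
      + Γ (ι a.1, a.2) (fderiv ℝ ι a.1 u) (fderiv ℝ ι a.1 z) := rfl

variable {ι : F → E} {s v : F} {Γ : E × E → E →L[ℝ] E →L[ℝ] E}
  {q : F × E → F →L[ℝ] F →L[ℝ] F} {B : F × E → F →L[ℝ] F →L[ℝ] E}

theorem hasFDerivAt_fst_comp {G : Type*} [NormedAddCommGroup G] [NormedSpace ℝ G] {f : F → G}
    {f' : F →L[ℝ] G} {a : F × E} (hf : HasFDerivAt f f' a.1) :
    HasFDerivAt (fun a : F × E => f a.1) (f'.comp (ContinuousLinearMap.fst ℝ F E)) a :=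
  hf.comp a hasFDerivAt_fst

theorem hasFDerivAt_comp_immersion {G : Type*} [NormedAddCommGroup G] [NormedSpace ℝ G]
    {f : E × E → G} {a : F × E} (hι : DifferentiableAt ℝ ι a.1)
    (hf : DifferentiableAt ℝ f (ι a.1, a.2)) :
    HasFDerivAt (fun a : F × E => f (ι a.1, a.2))
      ((fderiv ℝ f (ι a.1, a.2)).comp
        (((fderiv ℝ ι a.1).comp (ContinuousLinearMap.fst ℝ F E)).prod
          (ContinuousLinearMap.snd ℝ F E))) a :=
  hf.hasFDerivAt.comp a ((hasFDerivAt_fst_comp hι.hasFDerivAt).prodMk hasFDerivAt_snd)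

theorem fderiv_immersionHessian (hι : ContDiffAt ℝ ∞ ι s) {η : E}
    (hΓ : DifferentiableAt ℝ Γ (ι s, η)) (w z u : F) (ξ : E) :
    fderiv ℝ (fun a => immersionHessian ι Γ a w z) (s, η) (u, ξ)
      = fderiv ℝ (fderiv ℝ (fderiv ℝ ι)) s u w z
        + fderiv ℝ Γ (ι s, η) (fderiv ℝ ι s u, ξ) (fderiv ℝ ι s w) (fderiv ℝ ι s z)
        + Γ (ι s, η) (fderiv ℝ (fderiv ℝ ι) s u w) (fderiv ℝ ι s z)
        + Γ (ι s, η) (fderiv ℝ ι s w) (fderiv ℝ (fderiv ℝ ι) s u z) := by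
  have h1 := contDiffAt_fderiv_of_smooth hι
  have h2 := contDiffAt_fderiv_of_smooth h1
  have d1 := (ContDiffAt.differentiableAt_of_smooth h1).hasFDerivAt
  have d2 := (ContDiffAt.differentiableAt_of_smooth h2).hasFDerivAt
  have e1 := ((hasFDerivAt_fst_comp (a := (s, η)) d2).clm_apply
    (hasFDerivAt_const w ((s, η) : F × E))).clm_apply (hasFDerivAt_const z ((s, η) : F × E))
  have e2 : ∀ b : F, HasFDerivAt (fun a : F × E => fderiv ℝ ι a.1 b) _ (s, η) := fun b =>
    (hasFDerivAt_fst_comp (a := (s, η)) d1).clm_apply (hasFDerivAt_const b ((s, η) : F × E))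
  have e3 := hasFDerivAt_comp_immersion (a := (s, η)) (f := Γ)
    (ContDiffAt.differentiableAt_of_smooth hι) hΓ
  have e3 := (e3.clm_apply (e2 w)).clm_apply (e2 z)
  have e4 := e1.add e3
  have e5 : HasFDerivAt (fun a => immersionHessian ι Γ a w z) _ (s, η) := e4
  rw [e5.fderiv]
  simp
  abel

/-- The curvature of the ambient connection on vectors tangent to a submanifold, for a
decomposition `q + B` of the second derivative of the immersion. -/
theorem coordCurvature_immersion (hι : ContDiffAt ℝ ∞ ι s)
    (hΓ : DifferentiableAt ℝ Γ (ι s, fderiv ℝ ι s v))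
    (hq : DifferentiableAt ℝ q (s, fderiv ℝ ι s v)) (hB : DifferentiableAt ℝ B (s, fderiv ℝ ι s v))
    (hdec : ∀ᶠ a in 𝓝 (s, fderiv ℝ ι s v), ∀ u z,
      immersionHessian ι Γ a u z = fderiv ℝ ι a.1 (q a u z) + B a u z) (u w z : F) :
    let d := fderiv ℝ ι s
    let a := (s, d v)
    let Γ₀ := Γ (ι s, d v)
    let h := fun u : F => fderiv ℝ (fderiv ℝ ι) s u v - d (q a u v)
    coordCurvature Γ (ι s, d v) (d u) (d w) (d z)
      = d (coordCurvature (fun a => q (a.1, fderiv ℝ ι a.1 a.2)) (s, v) u w z)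
        + ((B a u (q a w z) + (fderiv ℝ B a (u, h u) w z + Γ₀ (d u) (B a w z))
            - fderiv ℝ Γ (ι s, d v) (0, B a u v) (d w) (d z))
          - (B a w (q a u z) + (fderiv ℝ B a (w, h w) u z + Γ₀ (d w) (B a u z))
            - fderiv ℝ Γ (ι s, d v) (0, B a w v) (d u) (d z))) := by
  intro d a Γ₀ h
  have h1 := contDiffAt_fderiv_of_smooth hι
  have h2 := contDiffAt_fderiv_of_smooth h1
  have d1 := (ContDiffAt.differentiableAt_of_smooth h1).hasFDerivAt
  have d2 := (ContDiffAt.differentiableAt_of_smooth h2).hasFDerivAt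
  have sym2 : ∀ u w, fderiv ℝ (fderiv ℝ ι) s u w = fderiv ℝ (fderiv ℝ ι) s w u := fun u w =>
    (hι.isSymmSndFDerivAt (by
      simp only [minSmoothness_of_isRCLikeNormedField]; exact two_le_infty)).eq u w
  have sym3 : ∀ u w, fderiv ℝ (fderiv ℝ (fderiv ℝ ι)) s u w
      = fderiv ℝ (fderiv ℝ (fderiv ℝ ι)) s w u := fun u w =>
    (h1.isSymmSndFDerivAt (by
      simp only [minSmoothness_of_isRCLikeNormedField]; exact two_le_infty)).eq u w
  have hdec0 : ∀ u z, fderiv ℝ (fderiv ℝ ι) s u z + Γ₀ (d u) (d z) = d (q a u z) + B a u z :=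
    hdec.self_of_nhds
  -- The decomposition at (u, v) gives the second reading of h: minus the ambient connection term,
  -- corrected by the normal vector B(u, v).
  have hh : ∀ u, h u = B a u v - Γ₀ (d u) (d v) := by
    intro u
    have := hdec0 u v
    simp only [h]
    rw [sub_eq_sub_iff_add_eq_add, this]
    abel
  have hqt : HasFDerivAt (fun a : F × F => q (a.1, fderiv ℝ ι a.1 a.2)) _ (s, v) :=
    HasFDerivAt.comp (g := q) (f := fun a : F × F => (a.1, fderiv ℝ ι a.1 a.2)) (s, v)
      hq.hasFDerivAt ((hasFDerivAt_fst (p := ((s, v) : F × F))).prodMk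
        ((HasFDerivAt.comp (s, v) (f := Prod.fst) d1 hasFDerivAt_fst).clm_apply hasFDerivAt_snd))
  -- The map (s, v) ↦ (s, dι_s v) sends the q-horizontal direction (u, -q(u, v)) to (u, h u).
  have hqt' : ∀ u, fderiv ℝ (fun a : F × F => q (a.1, fderiv ℝ ι a.1 a.2)) (s, v)
      (u, -q (s, fderiv ℝ ι s v) u v) = fderiv ℝ q a (u, h u) := by
    intro u
    rw [hqt.fderiv]
    simp [h, a, d]
    congr 2
    abel
  -- The decomposition holds in a neighbourhood, so both sides have the same derivative in the
  -- direction (u, h u); the equation is solved for the derivative of Γ.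
  have key : ∀ u w, fderiv ℝ Γ (ι s, d v) (d u, h u) (d w) (d z)
      = d (fderiv ℝ q a (u, h u) w z) + fderiv ℝ (fderiv ℝ ι) s u (q a w z)
        + fderiv ℝ B a (u, h u) w z
        - fderiv ℝ (fderiv ℝ (fderiv ℝ ι)) s u w z - Γ₀ (fderiv ℝ (fderiv ℝ ι) s u w) (d z)
        - Γ₀ (d w) (fderiv ℝ (fderiv ℝ ι) s u z) := by
    intro u w
    have k2 := fderiv_immersionHessian hι hΓ w z u (h u)
    have k3 : (fun a => immersionHessian ι Γ a w z)
        =ᶠ[𝓝 a] fun a => fderiv ℝ ι a.1 (q a w z) + B a w z := hdec.mono fun a ha => ha w z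
    have kq := (hq.hasFDerivAt.clm_apply (hasFDerivAt_const w a)).clm_apply (hasFDerivAt_const z a)
    have kB := (hB.hasFDerivAt.clm_apply (hasFDerivAt_const w a)).clm_apply (hasFDerivAt_const z a)
    have k4 := (((hasFDerivAt_fst_comp (a := a) d1).clm_apply kq).add kB).fderiv
    have k5 : fderiv ℝ (fun a : F × E => fderiv ℝ ι a.1 (q a w z) + B a w z) a = _ := k4
    rw [k3.fderiv_eq, k5] at k2
    simp at k2
    linear_combination (norm := module) -k2
  -- The curvature needs the derivative of Γ in the Γ-horizontal direction; the vertical remainder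
  -- along B(u, v) becomes the vertical derivative of the ambient connection.
  have split : ∀ u, ((d u, h u) : E × E) = (d u, -Γ₀ (d u) (d v)) + (0, B a u v) := by
    intro u
    rw [hh]
    ext <;> simp
    abel
  have hzz : ∀ u w, Γ₀ (d u) (Γ₀ (d w) (d z)) = Γ₀ (d u) (d (q a w z)) + Γ₀ (d u) (B a w z)
      - Γ₀ (d u) (fderiv ℝ (fderiv ℝ ι) s w z) := by
    intro u w
    rw [← map_add, ← map_sub, ← hdec0]
    simp
  have hqq : ∀ u w, fderiv ℝ (fderiv ℝ ι) s u (q a w z)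
      = d (q a u (q a w z)) + B a u (q a w z) - Γ₀ (d u) (d (q a w z)) := by
    intro u w
    rw [← hdec0]
    simp
  have key' : ∀ u w, fderiv ℝ Γ (ι s, d v) (d u, -Γ₀ (d u) (d v)) (d w) (d z)
      = d (fderiv ℝ q a (u, h u) w z) + fderiv ℝ (fderiv ℝ ι) s u (q a w z)
        + fderiv ℝ B a (u, h u) w z
        - fderiv ℝ (fderiv ℝ (fderiv ℝ ι)) s u w z - Γ₀ (fderiv ℝ (fderiv ℝ ι) s u w) (d z)
        - Γ₀ (d w) (fderiv ℝ (fderiv ℝ ι) s u z)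
        - fderiv ℝ Γ (ι s, d v) (0, B a u v) (d w) (d z) := by
    intro u w
    have := key u w
    rw [split, map_add] at this
    rw [← this]
    simp
  unfold coordCurvature
  simp only [hqt']
  change fderiv ℝ Γ (ι s, d v) (d u, -Γ₀ (d u) (d v)) (d w) (d z) + Γ₀ (d u) (Γ₀ (d w) (d z))
    - (fderiv ℝ Γ (ι s, d v) (d w, -Γ₀ (d w) (d v)) (d u) (d z) + Γ₀ (d w) (Γ₀ (d u) (d z)))
    = d (fderiv ℝ q a (u, h u) w z + q a u (q a w z)
      - (fderiv ℝ q a (w, h w) u z + q a w (q a u z))) + _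
  -- Third derivatives of ι and the terms Γ(D²ι(u, w), dz) are symmetric in u, w and cancel. The
  -- terms Γ(dw, D²ι(u, z)) cancel between `key'` and `hzz`.
  rw [key', key', hzz, hzz, hqq, hqq, sym3 w u, sym2 w u]
  simp only [map_add, map_sub]
  abel

/-- The tangential part of the derivative of the normal part `B`, from compatibility with the
metric. -/
theorem metric_normal_deriv {g : E × E → E →L[ℝ] E →L[ℝ] ℝ} (hι : ContDiffAt ℝ ∞ ι s)
    (hB : DifferentiableAt ℝ B (s, fderiv ℝ ι s v))
    (hg : DifferentiableAt ℝ g (ι s, fderiv ℝ ι s v))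
    (hmet : ∀ u y z, fderiv ℝ g (ι s, fderiv ℝ ι s v) (u, 0) y z
      = g (ι s, fderiv ℝ ι s v) (Γ (ι s, fderiv ℝ ι s v) u y) z
        + g (ι s, fderiv ℝ ι s v) y (Γ (ι s, fderiv ℝ ι s v) u z)
        + fderiv ℝ g (ι s, fderiv ℝ ι s v)
            (0, Γ (ι s, fderiv ℝ ι s v) u (fderiv ℝ ι s v)) y z)
    (hdec : ∀ u z, immersionHessian ι Γ (s, fderiv ℝ ι s v) u z
      = fderiv ℝ ι s (q (s, fderiv ℝ ι s v) u z) + B (s, fderiv ℝ ι s v) u z)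
    (hperp : ∀ᶠ a in 𝓝 (s, fderiv ℝ ι s v), ∀ w z b,
      g (ι a.1, a.2) (B a w z) (fderiv ℝ ι a.1 b) = 0) (u w z b : F) :
    let d := fderiv ℝ ι s
    let a := (s, d v)
    g (ι s, d v) (fderiv ℝ B a (u, fderiv ℝ (fderiv ℝ ι) s u v - d (q a u v)) w z
        + Γ (ι s, d v) (d u) (B a w z)) (d b)
      = -g (ι s, d v) (B a w z) (B a u b)
        - fderiv ℝ g (ι s, d v) (0, B a u v) (B a w z) (d b) := by
  intro d a
  have d1 := (ContDiffAt.differentiableAt_of_smooth (contDiffAt_fderiv_of_smooth hι)).hasFDerivAt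
  have kB := (hB.hasFDerivAt.clm_apply (hasFDerivAt_const w a)).clm_apply (hasFDerivAt_const z a)
  have kb : HasFDerivAt (fun a : F × E => fderiv ℝ ι a.1 b) _ a :=
    (hasFDerivAt_fst_comp (a := a) d1).clm_apply (hasFDerivAt_const b a)
  have kg := hasFDerivAt_comp_immersion (a := a) (f := g)
    (ContDiffAt.differentiableAt_of_smooth hι) hg
  have k := ((kg.clm_apply kB).clm_apply kb).fderiv
  -- Orthogonality holds for all nearby (s, η), including non-tangent η, so it may be differentiated
  -- in the direction (u, h), which need not keep η tangent to first order in the original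
  -- coordinates of TS alone.
  have e : (fun a : F × E => g (ι a.1, a.2) (B a w z) (fderiv ℝ ι a.1 b)) =ᶠ[𝓝 a] fun _ => 0 :=
    hperp.mono fun a ha => ha w z b
  rw [e.fderiv_eq] at k
  have k1 := DFunLike.congr_fun k (u, fderiv ℝ (fderiv ℝ ι) s u v - d (q a u v))
  simp at k1
  have hh : fderiv ℝ (fderiv ℝ ι) s u v - d (q a u v) = B a u v - Γ (ι s, d v) (d u) (d v) := by
    rw [sub_eq_sub_iff_add_eq_add]
    exact (hdec u v).trans (add_comm _ _)
  -- The first and third pieces form the horizontal direction, governed by metric compatibility; the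
  -- second gives the vertical derivative of g along B(u, v).
  have split : ((d u, B a u v - Γ (ι s, d v) (d u) (d v)) : E × E)
      = (d u, 0) + (0, B a u v) - (0, Γ (ι s, d v) (d u) (d v)) := by
    ext
    · simp
    · simp
  -- Metric compatibility completes D²ι(u, b) to the full Hessian of ι, whose tangential part is
  -- orthogonal to B(w, z), so only B(u, b) survives.
  have hBb : B a u b = fderiv ℝ (fderiv ℝ ι) s u b + Γ (ι s, d v) (d u) (d b) - d (q a u b) :=
    eq_sub_of_add_eq' (hdec u b).symm
  have hp : g (ι s, d v) (B a w z) (d (q a u b)) = 0 := hperp.self_of_nhds w z (q a u b)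
  have hm := hmet (d u) (B a w z) (d b)
  have k2 : 0 = g (ι s, d v) (B a w z) (fderiv ℝ (fderiv ℝ ι) s u b)
      + (g (ι s, d v) (fderiv ℝ B a (u, fderiv ℝ (fderiv ℝ ι) s u v - d (q a u v)) w z) (d b)
      + fderiv ℝ g (ι s, d v) (d u, fderiv ℝ (fderiv ℝ ι) s u v - d (q a u v)) (B a w z) (d b)) := k1
  rw [hh, split, map_sub, map_add] at k2
  rw [hh, hBb]
  simp only [map_add, map_sub, _root_.add_apply, _root_.sub_apply, hp] at k2 ⊢
  change _ = g (ι s, d v) _ _ + g (ι s, d v) _ _ + _ at hm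
  linarith


end Local

/-! ### Curvature, vertical derivative, torsion and metric compatibility in coordinates. -/

section CoordinateTensors

variable {E : Type*} [NormedAddCommGroup E] [NormedSpace ℝ E]
  {M : Type*} [TopologicalSpace M] [ChartedSpace E M] [IsManifold 𝓘(ℝ, E) ∞ M]
  {A : Set (TangentBundle 𝓘(ℝ, E) M)} {L : TangentBundle 𝓘(ℝ, E) M → ℝ}

/-- At the centre of its own chart the trivialization is the identity of the model space. A `deriv`
taken inside a tangent space can therefore be computed on components. -/
theorem comps_self (p : M) (u : TangentSpace 𝓘(ℝ, E) p) : comps p u = u := by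
  have h : p ∈ (chartAt E p).source := mem_chart_source E p
  unfold comps
  rw [TangentBundle.continuousLinearMapAt_trivializationAt_eq_core h]
  exact (tangentBundleCore 𝓘(ℝ, E) M).coordChange_self (achart E p) p h u

theorem comps_deriv (p : M) (f : ℝ → TangentSpace 𝓘(ℝ, E) p) (t : ℝ) :
    comps p (deriv f t) = deriv (fun t => comps p (f t)) t := by
  have h : (fun t => comps p (f t)) = (f : ℝ → E) := funext fun t => comps_self p (f t)
  rw [h, comps_self]
  rfl

theorem ofCoords_eq_extField {p : M} {y : E} (hy : (extChartAt 𝓘(ℝ, E) p).symm y ∈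
    (chartAt E p).source) (v : TangentSpace 𝓘(ℝ, E) p) :
    ofCoords p (y, comps p v)
      = ⟨(extChartAt 𝓘(ℝ, E) p).symm y, extField v ((extChartAt 𝓘(ℝ, E) p).symm y)⟩ := by
  rw [extField_apply hy]
  rfl

omit [NormedSpace ℝ E] in
theorem tendsto_prodMk_const (y v : E) :
    Filter.Tendsto (fun y' : E => ((y', v) : E × E)) (𝓝 y) (𝓝 (y, v)) :=
  (continuous_id.prodMk continuous_const).tendsto y

theorem fderiv_prodMk_const {G : Type*} [NormedAddCommGroup G] [NormedSpace ℝ G] {f : E × E → G}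
    {y v : E} (hf : DifferentiableAt ℝ f (y, v)) (u : E) :
    fderiv ℝ (fun y' => f (y', v)) y u = fderiv ℝ f (y, v) (u, 0) := by
  have h := HasFDerivAt.comp y (f := fun y' : E => ((y', v) : E × E)) hf.hasFDerivAt
    ((hasFDerivAt_id y).prodMk (hasFDerivAt_const v y))
  exact DFunLike.congr_fun h.fderiv u

theorem fderiv_apply_apply {G H K : Type*} [NormedAddCommGroup G] [NormedSpace ℝ G]
    [NormedAddCommGroup H] [NormedSpace ℝ H] [NormedAddCommGroup K] [NormedSpace ℝ K]
    {f : G → H →L[ℝ] H →L[ℝ] K} {a : G} (hf : DifferentiableAt ℝ f a) (u w : H) (ξ : G) :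
    fderiv ℝ (fun a => f a u w) a ξ = fderiv ℝ f a ξ u w := by
  have h := (hf.hasFDerivAt.clm_apply (hasFDerivAt_const u a)).clm_apply (hasFDerivAt_const w a)
  rw [h.fderiv]
  simp

theorem ContDiffAt.apply_apply {G H K : Type*} [NormedAddCommGroup G] [NormedSpace ℝ G]
    [NormedAddCommGroup H] [NormedSpace ℝ H] [NormedAddCommGroup K] [NormedSpace ℝ K]
    {f : G → H →L[ℝ] H →L[ℝ] K} {a : G} (hf : ContDiffAt ℝ ∞ f a) (u w : H) :
    ContDiffAt ℝ ∞ (fun a => f a u w) a :=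
  (hf.clm_apply contDiffAt_const).clm_apply contDiffAt_const

theorem contDiffAt_prodMk_const {G : Type*} [NormedAddCommGroup G] [NormedSpace ℝ G]
    {f : E × E → G} {y v : E} (hf : ContDiffAt ℝ ∞ f (y, v)) :
    ContDiffAt ℝ ∞ (fun y' => f (y', v)) y :=
  ContDiffAt.comp (g := f) y hf (contDiffAt_id.prodMk contDiffAt_const)

theorem mem_of_mem_coordDomain {p : M} {v : TangentSpace 𝓘(ℝ, E) p}
    (hv : ((extChartAt 𝓘(ℝ, E) p p, comps p v) : E × E) ∈ coordDomain p A) :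
    (⟨p, v⟩ : TangentBundle 𝓘(ℝ, E) M) ∈ A := by
  have := hv.2
  rwa [ofCoords_comps (mem_chart_source E p)] at this

variable [FiniteDimensional ℝ E]

theorem comps_conn_extField (D : AnisotropicConnection A) {p : M} {v : TangentSpace 𝓘(ℝ, E) p}
    (hv : (⟨p, v⟩ : TangentBundle 𝓘(ℝ, E) M) ∈ A) (u w : TangentSpace 𝓘(ℝ, E) p) :
    comps p (D.toFun p v (extField w) u)
      = christoffel D p (extChartAt 𝓘(ℝ, E) p p, comps p v) (comps p u) (comps p w) := by
  rw [comps_conn D (mem_chart_source E p) hv contDiffAt_const (comps_extField w) u]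
  simp

theorem comps_vertDeriv (D : AnisotropicConnection A) (hA : IsOpen A) {p : M}
    {v : TangentSpace 𝓘(ℝ, E) p} (hv : (⟨p, v⟩ : TangentBundle 𝓘(ℝ, E) M) ∈ A)
    (u w z : TangentSpace 𝓘(ℝ, E) p) :
    comps p (vertDeriv D v u w z)
      = fderiv ℝ (christoffel D p) (extChartAt 𝓘(ℝ, E) p p, comps p v) (0, comps p z)
          (comps p u) (comps p w) := by
  have hd := mem_coordDomain (mem_chart_source E p) hv
  have hΓ := ContDiffAt.differentiableAt_of_smooth (contDiffAt_christoffel D hA hd)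
  unfold vertDeriv
  rw [comps_deriv]
  have e : (fun t : ℝ => comps p (D.toFun p (v + t • z) (extField w) u)) =ᶠ[𝓝 0] fun t =>
      christoffel D p (extChartAt 𝓘(ℝ, E) p p, comps p v + t • comps p z) (comps p u)
        (comps p w) := by
    filter_upwards [eventually_vertical (z := comps p z) (eventually_mem_coordDomain hA hd)]
      with t ht
    rw [← comps_smul, ← comps_add] at ht ⊢
    exact comps_conn_extField D (mem_of_mem_coordDomain ht) u w
  rw [e.deriv_eq, deriv_comp_vertical
    (f := fun a => christoffel D p a (comps p u) (comps p w))
    (ContDiffAt.differentiableAt_of_smooth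
      (ContDiffAt.apply_apply (contDiffAt_christoffel D hA hd) _ _)), fderiv_apply_apply hΓ]

theorem comps_conn_at (D : AnisotropicConnection A) {p₀ p : M} (hp : p ∈ (chartAt E p₀).source)
    {v : TangentSpace 𝓘(ℝ, E) p} (hv : (⟨p, v⟩ : TangentBundle 𝓘(ℝ, E) M) ∈ A)
    (u w : TangentSpace 𝓘(ℝ, E) p₀) :
    comps p₀ (D.toFun p v (extField w) (extField u p))
      = christoffel D p₀ (extChartAt 𝓘(ℝ, E) p₀ p, comps p₀ v) (comps p₀ u) (comps p₀ w) := by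
  have hp' : p ∈ (extChartAt 𝓘(ℝ, E) p₀).source := by rwa [extChartAt_source]
  have e : ∀ᶠ y in 𝓝 (extChartAt 𝓘(ℝ, E) p₀ p),
      comps p₀ (extField w ((extChartAt 𝓘(ℝ, E) p₀).symm y)) = comps p₀ w := by
    filter_upwards [eventually_chart_symm ((extChartAt 𝓘(ℝ, E) p₀).map_source hp')] with y hy
    rw [extField_apply hy.2.1, comps_ofComps hy.2.1]
  rw [comps_conn D hp hv contDiffAt_const e, extField_apply hp, comps_ofComps hp]
  simp

/-- With V of constant components, the derivative along V is taken in the direction (u, 0), and ∇_u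
V has components Γ(u, v). Subtracting the vertical derivative along ∇_u V leaves the horizontal
direction (u, -Γ(u, v)). -/
theorem comps_derivAniso_conn (D : AnisotropicConnection A) (hA : IsOpen A) {p : M}
    {v : TangentSpace 𝓘(ℝ, E) p} (hv : (⟨p, v⟩ : TangentBundle 𝓘(ℝ, E) M) ∈ A)
    (u w z : TangentSpace 𝓘(ℝ, E) p) :
    let a := (extChartAt 𝓘(ℝ, E) p p, comps p v)
    let Γ := christoffel D p
    comps p (derivAniso D v u (fun x y => D.toFun x y (extField z) (extField w x)))
      = fderiv ℝ Γ a (comps p u, -Γ a (comps p u) (comps p v)) (comps p w) (comps p z)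
        + Γ a (comps p u) (Γ a (comps p w) (comps p z)) := by
  intro a Γ
  have hd : a ∈ coordDomain p A := mem_coordDomain (mem_chart_source E p) hv
  have hs := contDiffAt_christoffel D hA hd
  have hΓ := ContDiffAt.differentiableAt_of_smooth hs
  have hev := (tendsto_prodMk_const (extChartAt 𝓘(ℝ, E) p p) (comps p v)).eventually
    (eventually_mem_coordDomain hA hd)
  have hΓw : ContDiffAt ℝ ∞ (fun a => Γ a (comps p w) (comps p z)) a :=
    ContDiffAt.apply_apply hs _ _
  have e1 : ∀ᶠ y in 𝓝 (extChartAt 𝓘(ℝ, E) p p),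
      comps p ((fun x => D.toFun x (extField v x) (extField z) (extField w x))
        ((extChartAt 𝓘(ℝ, E) p).symm y)) = Γ (y, comps p v) (comps p w) (comps p z) := by
    filter_upwards [hev, eventually_chart_symm (mem_extChartAt_target (I := 𝓘(ℝ, E)) p)]
      with y hy hy'
    have hyA := hy.2
    rw [ofCoords_eq_extField hy'.2.1] at hyA
    rw [comps_conn_at D hy'.2.1 hyA, hy'.2.2, extField_apply hy'.2.1, comps_ofComps hy'.2.1]
  have e2 : comps p (D.toFun p v (extField v) u) = Γ a (comps p u) (comps p v) :=
    comps_conn_extField D hv u v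
  unfold derivAniso
  rw [comps_sub, comps_conn D (mem_chart_source E p) hv (contDiffAt_prodMk_const hΓw) e1, comps_deriv,
    fderiv_prodMk_const (ContDiffAt.differentiableAt_of_smooth hΓw), fderiv_apply_apply hΓ]
  have e3 : (fun t : ℝ => comps p (D.toFun p (v + t • D.toFun p v (extField v) u) (extField z)
      (extField w p))) =ᶠ[𝓝 0] fun t =>
      Γ (extChartAt 𝓘(ℝ, E) p p, comps p v + t • Γ a (comps p u) (comps p v))
        (comps p w) (comps p z) := by
    filter_upwards [eventually_vertical (z := Γ a (comps p u) (comps p v))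
      (eventually_mem_coordDomain hA hd)] with t ht
    rw [← e2, ← comps_smul, ← comps_add] at ht ⊢
    exact comps_conn_at D (mem_chart_source E p) (mem_of_mem_coordDomain ht) w z
  rw [e3.deriv_eq, deriv_comp_vertical (f := fun a => Γ a (comps p w) (comps p z))
    (ContDiffAt.differentiableAt_of_smooth hΓw), fderiv_apply_apply hΓ]
  have split : ((comps p u, -Γ a (comps p u) (comps p v)) : E × E)
      = (comps p u, 0) - (0, Γ a (comps p u) (comps p v)) := by
    ext
    · simp
    · simp
  rw [split, map_sub]
  simp only [_root_.sub_apply]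
  abel

theorem comps_curvature (D : AnisotropicConnection A) (hA : IsOpen A) {p : M}
    {v : TangentSpace 𝓘(ℝ, E) p} (hv : (⟨p, v⟩ : TangentBundle 𝓘(ℝ, E) M) ∈ A)
    (u w z : TangentSpace 𝓘(ℝ, E) p) :
    comps p (curvature D v u w z)
      = coordCurvature (christoffel D p) (extChartAt 𝓘(ℝ, E) p p, comps p v)
          (comps p u) (comps p w) (comps p z) := by
  unfold curvature coordCurvature
  rw [mlieBracket_extField, map_zero, sub_zero, comps_sub, comps_derivAniso_conn D hA hv,
    comps_derivAniso_conn D hA hv]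

theorem christoffel_symm {D : AnisotropicConnection A} (hD : IsLeviCivitaChern L D) {p : M}
    {v : TangentSpace 𝓘(ℝ, E) p} (hv : (⟨p, v⟩ : TangentBundle 𝓘(ℝ, E) M) ∈ A) (u w : E) :
    christoffel D p (extChartAt 𝓘(ℝ, E) p p, comps p v) u w
      = christoffel D p (extChartAt 𝓘(ℝ, E) p p, comps p v) w u := by
  have hp := mem_chart_source E p
  have h := hD.torsion_free p v (extField (ofComps p p u)) (extField (ofComps p p w)) hv
    (smoothFieldAt_extField _) (smoothFieldAt_extField _)
  rw [mlieBracket_extField, sub_eq_zero] at h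
  have h' := congrArg (fun u => comps p u) h
  simp only [comps_conn_at D hp hv, comps_ofComps hp] at h'
  exact h'

/-- The compatibility axiom is applied to fields with constant components. In the Cartan tensor the
direction of differentiation is the last argument z; total symmetry moves ∇_u V into that slot. -/
theorem christoffel_metric (hA : IsOpen A) (hL : ContMDiffOn (𝓘(ℝ, E)).tangent 𝓘(ℝ, ℝ) ∞ L A)
    {D : AnisotropicConnection A} (hD : IsLeviCivitaChern L D) {p : M}
    {v : TangentSpace 𝓘(ℝ, E) p} (hv : (⟨p, v⟩ : TangentBundle 𝓘(ℝ, E) M) ∈ A) (u y z : E) :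
    let a := (extChartAt 𝓘(ℝ, E) p p, comps p v)
    let Γ := christoffel D p a
    let g := coordMetric L p
    fderiv ℝ g a (u, 0) y z
      = g a (Γ u y) z + g a y (Γ u z) + fderiv ℝ g a (0, Γ u (comps p v)) y z := by
  intro a Γ g
  have hp := mem_chart_source E p
  have hd : a ∈ coordDomain p A := mem_coordDomain hp hv
  have hl := contDiffAt_comp_ofCoords hA hL hd
  have hg : ContDiffAt ℝ ∞ g a := contDiffAt_verticalHessian hl
  have hv' : extField v p = v := FiberBundle.extend_apply_self E v
  have hext : ∀ u : TangentSpace 𝓘(ℝ, E) p, comps p (extField u p) = comps p u := fun u =>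
    congrArg (fun u => comps p u) (FiberBundle.extend_apply_self E u)
  have h := hD.metric p (extField v) (extField (ofComps p p y)) (extField (ofComps p p z))
    (ofComps p p u) (by rwa [hv']) (smoothFieldAt_extField _) (smoothFieldAt_extField _)
    (smoothFieldAt_extField _)
  rw [hv'] at h
  have hgyz := ContDiffAt.apply_apply hg y z
  have e : ∀ᶠ y' in 𝓝 (extChartAt 𝓘(ℝ, E) p p), fundTensor L
      (extField v ((extChartAt 𝓘(ℝ, E) p).symm y'))
      (extField (ofComps p p y) ((extChartAt 𝓘(ℝ, E) p).symm y'))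
      (extField (ofComps p p z) ((extChartAt 𝓘(ℝ, E) p).symm y')) = g (y', comps p v) y z := by
    have hev := (tendsto_prodMk_const (extChartAt 𝓘(ℝ, E) p p) (comps p v)).eventually
      (eventually_mem_coordDomain hA hd)
    filter_upwards [hev, eventually_chart_symm (mem_extChartAt_target (I := 𝓘(ℝ, E)) p)]
      with y' hy hy'
    have hyA := hy.2
    rw [ofCoords_eq_extField hy'.2.1] at hyA
    rw [fundTensor_eq hA hL hy'.2.1 hyA, hy'.2.2]
    simp only [extField_apply hy'.2.1, comps_ofComps hy'.2.1, comps_ofComps hp]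
    rfl
  rw [dirDeriv_eq hp (ContDiffAt.differentiableAt_of_smooth (contDiffAt_prodMk_const hgyz)) e,
    fundTensor_eq hA hL hp hv, fundTensor_eq hA hL hp hv, cartanTensor_eq hA hL hp hv,
    fderiv_prodMk_const (ContDiffAt.differentiableAt_of_smooth hgyz),
    fderiv_apply_apply (ContDiffAt.differentiableAt_of_smooth hg)] at h
  simp only [comps_conn_extField D hv, hext, comps_ofComps hp] at h
  have s1 := fderiv_verticalHessian_swap hl z (Γ u (comps p v)) y
  have s2 := fderiv_verticalHessian_symm
    ((eventually_mem_coordDomain hA hd).mono fun a ha => contDiffAt_comp_ofCoords hA hL ha)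
    (0, Γ u (comps p v)) y z
  have s3 : fderiv ℝ g a (0, z) (Γ u (comps p v)) y = fderiv ℝ g a (0, Γ u (comps p v)) y z :=
    s1.trans s2.symm
  rw [← s3]
  refine h.trans ?_
  change _ + _ + 2 * (1 / 2 * fderiv ℝ g a (0, z) (Γ u (comps p v)) y) = _
  rw [← mul_assoc]
  norm_num
  rfl

end CoordinateTensors

/-! ### Orthogonal projection to an immersion, and the tangential and normal Hessians. -/

section TangentProjection

variable {E : Type*} [NormedAddCommGroup E] [NormedSpace ℝ E]
  {F : Type*} [NormedAddCommGroup F] [NormedSpace ℝ F]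
  {ι : F → E} {Γ : E × E → E →L[ℝ] E →L[ℝ] E} {g : E × E → E →L[ℝ] E →L[ℝ] ℝ} {a : F × E}

/-- The metric `g` pulled back by the immersion `ι`. -/
def tangentGram (ι : F → E) (g : E × E → E →L[ℝ] E →L[ℝ] ℝ) (a : F × E) : F →L[ℝ] F →L[ℝ] ℝ :=
  ((ContinuousLinearMap.compL ℝ F E ℝ).flip (fderiv ℝ ι a.1)).comp
    ((g (ι a.1, a.2)).comp (fderiv ℝ ι a.1))

theorem tangentGram_apply (ι : F → E) (g : E × E → E →L[ℝ] E →L[ℝ] ℝ) (a : F × E) (b c : F) :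
    tangentGram ι g a b c = g (ι a.1, a.2) (fderiv ℝ ι a.1 b) (fderiv ℝ ι a.1 c) := rfl

/-- The `g`-orthogonal projection to the tangent space of the immersion `ι`. -/
def tangentProj (ι : F → E) (g : E × E → E →L[ℝ] E →L[ℝ] ℝ) (a : F × E) : E →L[ℝ] F :=
  (tangentGram ι g a).inverse.comp
    (((ContinuousLinearMap.compL ℝ F E ℝ).flip (fderiv ℝ ι a.1)).comp (g (ι a.1, a.2)))

theorem tangentGram_tangentProj (h : (tangentGram ι g a).IsInvertible) (ξ : E) (b : F) :
    tangentGram ι g a (tangentProj ι g a ξ) b = g (ι a.1, a.2) ξ (fderiv ℝ ι a.1 b) := by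
  unfold tangentProj
  rw [ContinuousLinearMap.comp_apply, h.self_apply_inverse]
  rfl

theorem tangentProj_orthogonal (h : (tangentGram ι g a).IsInvertible) (ξ : E) (b : F) :
    g (ι a.1, a.2) (ξ - fderiv ℝ ι a.1 (tangentProj ι g a ξ)) (fderiv ℝ ι a.1 b) = 0 := by
  have := tangentGram_tangentProj h ξ b
  rw [tangentGram_apply] at this
  rw [map_sub, _root_.sub_apply, this, sub_self]

theorem eq_tangentProj (h : (tangentGram ι g a).IsInvertible) {ξ : E} {c : F}
    (hc : ∀ b, g (ι a.1, a.2) (ξ - fderiv ℝ ι a.1 c) (fderiv ℝ ι a.1 b) = 0) :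
    c = tangentProj ι g a ξ := by
  obtain ⟨e, he⟩ := h
  apply e.injective
  ext b
  have h1 := tangentGram_tangentProj ⟨e, he⟩ ξ b
  have h2 := hc b
  rw [map_sub, _root_.sub_apply, sub_eq_zero] at h2
  rw [h2, ← tangentGram_apply, ← he] at h1
  exact h1.symm

theorem tangentProj_fderiv (h : (tangentGram ι g a).IsInvertible) (c : F) :
    tangentProj ι g a (fderiv ℝ ι a.1 c) = c :=
  (eq_tangentProj h fun b => by simp).symm

theorem contDiffAt_comp_immersion {G : Type*} [NormedAddCommGroup G] [NormedSpace ℝ G]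
    {f : E × E → G} (hι : ContDiffAt ℝ ∞ ι a.1) (hf : ContDiffAt ℝ ∞ f (ι a.1, a.2)) :
    ContDiffAt ℝ ∞ (fun a : F × E => f (ι a.1, a.2)) a :=
  ContDiffAt.comp (g := f) a hf ((hι.comp a contDiffAt_fst).prodMk contDiffAt_snd)

theorem contDiffAt_fderiv_fst (hι : ContDiffAt ℝ ∞ ι a.1) :
    ContDiffAt ℝ ∞ (fun a : F × E => fderiv ℝ ι a.1) a :=
  (contDiffAt_fderiv_of_smooth hι).comp a contDiffAt_fst

theorem contDiffAt_restrict {G : Type*} [NormedAddCommGroup G] [NormedSpace ℝ G]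
    {f : E × E → E →L[ℝ] G} (hι : ContDiffAt ℝ ∞ ι a.1)
    (hf : ContDiffAt ℝ ∞ f (ι a.1, a.2)) :
    ContDiffAt ℝ ∞ (fun a : F × E => (f (ι a.1, a.2)).comp (fderiv ℝ ι a.1)) a :=
  (contDiffAt_comp_immersion hι hf).clm_comp (contDiffAt_fderiv_fst hι)

theorem ContDiffAt.clm_map {G H K : Type*} [NormedAddCommGroup G] [NormedSpace ℝ G]
    [NormedAddCommGroup H] [NormedSpace ℝ H] [NormedAddCommGroup K] [NormedSpace ℝ K]
    (T : G →L[ℝ] H) {f : K → G} {x : K} (hf : ContDiffAt ℝ ∞ f x) :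
    ContDiffAt ℝ ∞ (fun x => T (f x)) x :=
  T.contDiff.contDiffAt.comp x hf

theorem contDiffAt_compL_flip_fderiv (G : Type*) [NormedAddCommGroup G] [NormedSpace ℝ G]
    (hι : ContDiffAt ℝ ∞ ι a.1) :
    ContDiffAt ℝ ∞ (fun a : F × E =>
      (ContinuousLinearMap.compL ℝ F E G).flip (fderiv ℝ ι a.1)) a :=
  ContDiffAt.clm_map (G := F →L[ℝ] E) (H := (E →L[ℝ] G) →L[ℝ] F →L[ℝ] G)
    (ContinuousLinearMap.compL ℝ F E G).flip (contDiffAt_fderiv_fst hι)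

theorem contDiffAt_tangentGram (hι : ContDiffAt ℝ ∞ ι a.1) (hg : ContDiffAt ℝ ∞ g (ι a.1, a.2)) :
    ContDiffAt ℝ ∞ (tangentGram ι g) a :=
  (contDiffAt_compL_flip_fderiv ℝ hι).clm_comp (contDiffAt_restrict hι hg)

theorem contDiffAt_immersionHessian (hι : ContDiffAt ℝ ∞ ι a.1)
    (hΓ : ContDiffAt ℝ ∞ Γ (ι a.1, a.2)) : ContDiffAt ℝ ∞ (immersionHessian ι Γ) a :=
  ((contDiffAt_fderiv_of_smooth (contDiffAt_fderiv_of_smooth hι)).comp a contDiffAt_fst).add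
    ((contDiffAt_compL_flip_fderiv E hι).clm_comp (contDiffAt_restrict hι hΓ))

/-- The projection is built from the inverse of the Gram form, and inversion of operators is smooth
near an invertible one. -/
theorem contDiffAt_tangentProj [CompleteSpace F] (h : (tangentGram ι g a).IsInvertible)
    (hι : ContDiffAt ℝ ∞ ι a.1) (hg : ContDiffAt ℝ ∞ g (ι a.1, a.2)) :
    ContDiffAt ℝ ∞ (tangentProj ι g) a := by
  refine ContDiffAt.clm_comp ?_
    ((contDiffAt_compL_flip_fderiv ℝ hι).clm_comp (contDiffAt_comp_immersion hι hg))
  obtain ⟨e, he⟩ := h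
  have h1 := contDiffAt_map_inverse (n := ∞) e
  rw [he] at h1
  exact h1.comp a (contDiffAt_tangentGram hι hg)

theorem eventually_isInvertible_tangentGram [CompleteSpace F]
    (h : (tangentGram ι g a).IsInvertible)
    (hι : ContDiffAt ℝ ∞ ι a.1) (hg : ContDiffAt ℝ ∞ g (ι a.1, a.2)) :
    ∀ᶠ a in 𝓝 a, (tangentGram ι g a).IsInvertible := by
  obtain ⟨e, he⟩ := h
  have h1 := ContinuousLinearEquiv.nhds e
  rw [he] at h1
  exact (contDiffAt_tangentGram hι hg).continuousAt.eventually h1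

/-- Non-degeneracy says that F → F* is injective, and both spaces have the same finite dimension. -/
theorem isInvertible_of_nondegenerate [FiniteDimensional ℝ F] (B : F →L[ℝ] F →L[ℝ] ℝ)
    (h : ∀ b, (∀ c, B b c = 0) → b = 0) : B.IsInvertible := by
  have hinj : Function.Injective (B : F →ₗ[ℝ] (F →L[ℝ] ℝ)) := by
    rw [injective_iff_map_eq_zero]
    intro b hb
    exact h b fun c => DFunLike.congr_fun hb c
  have hdim : Module.finrank ℝ F = Module.finrank ℝ (F →L[ℝ] ℝ) := by
    rw [← (LinearMap.toContinuousLinearMap (𝕜 := ℝ) (E := F) (F' := ℝ)).finrank_eq]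
    exact Subspace.dual_finrank_eq.symm
  refine ⟨(LinearMap.linearEquivOfInjective _ hinj hdim).toContinuousLinearEquiv, ?_⟩
  ext b c
  rfl

/-- The tangential part of the second derivative of an immersion. -/
def tangentHessian (ι : F → E) (Γ : E × E → E →L[ℝ] E →L[ℝ] E) (g : E × E → E →L[ℝ] E →L[ℝ] ℝ)
    (a : F × E) : F →L[ℝ] F →L[ℝ] F :=
  (ContinuousLinearMap.compL ℝ F E F (tangentProj ι g a)).comp (immersionHessian ι Γ a)

/-- The normal part of the second derivative of an immersion. -/
def normalHessian (ι : F → E) (Γ : E × E → E →L[ℝ] E →L[ℝ] E) (g : E × E → E →L[ℝ] E →L[ℝ] ℝ)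
    (a : F × E) : F →L[ℝ] F →L[ℝ] E :=
  immersionHessian ι Γ a
    - (ContinuousLinearMap.compL ℝ F F E (fderiv ℝ ι a.1)).comp (tangentHessian ι Γ g a)

theorem tangentHessian_apply (a : F × E) (u z : F) :
    tangentHessian ι Γ g a u z = tangentProj ι g a (immersionHessian ι Γ a u z) := rfl

theorem normalHessian_apply (a : F × E) (u z : F) :
    normalHessian ι Γ g a u z = immersionHessian ι Γ a u z
      - fderiv ℝ ι a.1 (tangentHessian ι Γ g a u z) := rfl

/-- No invertibility of the Gram form is needed: the normal part is by definition the remainder.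
Invertibility matters only for its orthogonality. -/
theorem immersionHessian_eq (a : F × E) (u z : F) :
    immersionHessian ι Γ a u z
      = fderiv ℝ ι a.1 (tangentHessian ι Γ g a u z) + normalHessian ι Γ g a u z := by
  rw [normalHessian_apply]
  abel

theorem contDiffAt_tangentHessian [CompleteSpace F] (h : (tangentGram ι g a).IsInvertible)
    (hι : ContDiffAt ℝ ∞ ι a.1) (hg : ContDiffAt ℝ ∞ g (ι a.1, a.2))
    (hΓ : ContDiffAt ℝ ∞ Γ (ι a.1, a.2)) : ContDiffAt ℝ ∞ (tangentHessian ι Γ g) a :=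
  have h1 : ContDiffAt ℝ ∞ (fun a => ContinuousLinearMap.compL ℝ F E F (tangentProj ι g a)) a :=
    ContDiffAt.clm_map (G := E →L[ℝ] F) (H := (F →L[ℝ] E) →L[ℝ] F →L[ℝ] F)
      (ContinuousLinearMap.compL ℝ F E F) (contDiffAt_tangentProj h hι hg)
  h1.clm_comp (contDiffAt_immersionHessian hι hΓ)

theorem contDiffAt_normalHessian [CompleteSpace F] (h : (tangentGram ι g a).IsInvertible)
    (hι : ContDiffAt ℝ ∞ ι a.1) (hg : ContDiffAt ℝ ∞ g (ι a.1, a.2))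
    (hΓ : ContDiffAt ℝ ∞ Γ (ι a.1, a.2)) : ContDiffAt ℝ ∞ (normalHessian ι Γ g) a :=
  (contDiffAt_immersionHessian hι hΓ).sub
    ((ContDiffAt.clm_map (G := F →L[ℝ] E) (H := (F →L[ℝ] F) →L[ℝ] F →L[ℝ] E)
      (ContinuousLinearMap.compL ℝ F F E) (contDiffAt_fderiv_fst hι)).clm_comp (contDiffAt_tangentHessian h hι hg hΓ))

/-- An immersion has a smooth local left inverse. -/
theorem exists_smooth_leftInverse [FiniteDimensional ℝ E] [FiniteDimensional ℝ F] {s : F}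
    (hι : ContDiffAt ℝ ∞ ι s) (hinj : Function.Injective (fderiv ℝ ι s)) :
    ∃ r : E → F, ContDiffAt ℝ ∞ r (ι s) ∧ ∀ᶠ s' in 𝓝 s, r (ι s') = s' := by
  obtain ⟨l, hl⟩ := LinearMap.exists_leftInverse_of_injective (fderiv ℝ ι s : F →ₗ[ℝ] E)
    (LinearMap.ker_eq_bot.2 hinj)
  let l' : E →L[ℝ] F := LinearMap.toContinuousLinearMap l
  have h1 : ContDiffAt ℝ ∞ (l' ∘ ι) s := l'.contDiff.contDiffAt.comp s hι
  -- For a linear left inverse l of the differential, l ∘ ι has identity derivative at s. Its local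
  -- inverse composed with l is the required map r.
  have h2 : HasFDerivAt (l' ∘ ι) ((ContinuousLinearEquiv.refl ℝ F : F ≃L[ℝ] F) : F →L[ℝ] F) s := by
    have h3 := l'.hasFDerivAt.comp s (ContDiffAt.differentiableAt_of_smooth hι).hasFDerivAt
    convert h3 using 1
    ext b
    exact (DFunLike.congr_fun hl b).symm
  have hn : (∞ : WithTop ℕ∞) ≠ 0 := by simp
  refine ⟨h1.localInverse h2 hn ∘ l', ?_, ?_⟩
  · exact ContDiffAt.comp (ι s) (h1.to_localInverse h2 hn) l'.contDiff.contDiffAt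
  · exact (h1.hasStrictFDerivAt' h2 hn).eventually_left_inverse

end TangentProjection

/-! ### The immersion in charts and derivatives of fields along it. -/

section Submanifold

variable {E : Type*} [NormedAddCommGroup E] [NormedSpace ℝ E]
  {M : Type*} [TopologicalSpace M] [ChartedSpace E M] [IsManifold 𝓘(ℝ, E) ∞ M]
  {F : Type*} [NormedAddCommGroup F] [NormedSpace ℝ F]
  {S : Type*} [TopologicalSpace S] [ChartedSpace F S] [IsManifold 𝓘(ℝ, F) ∞ S]
  {A : Set (TangentBundle 𝓘(ℝ, E) M)} {L : TangentBundle 𝓘(ℝ, E) M → ℝ} {i : S → M}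

/-- The map `i` in the preferred charts at `x₀` and `i x₀`. -/
def coordMap (E F : Type*) [NormedAddCommGroup E] [NormedSpace ℝ E] [ChartedSpace E M]
    [NormedAddCommGroup F] [NormedSpace ℝ F] [ChartedSpace F S] (i : S → M) (x₀ : S) (s : F) : E :=
  extChartAt 𝓘(ℝ, E) (i x₀) (i ((extChartAt 𝓘(ℝ, F) x₀).symm s))

/-- The point `x` and its image under `i` lie in the domains of the preferred charts at `x₀` and
`i x₀`. -/
structure InCharts (i : S → M) (x₀ x : S) : Prop where
  dom : x ∈ (chartAt F x₀).source
  cod : i x ∈ (chartAt E (i x₀)).source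

variable {x₀ x : S}

omit [NormedSpace ℝ E] [NormedSpace ℝ F] [IsManifold 𝓘(ℝ, E) ∞ M]
  [IsManifold 𝓘(ℝ, F) ∞ S] in
theorem inCharts_self (i : S → M) (x₀ : S) : InCharts (E := E) (F := F) i x₀ x₀ :=
  ⟨mem_chart_source F x₀, mem_chart_source E (i x₀)⟩

omit [IsManifold 𝓘(ℝ, E) ∞ M] [IsManifold 𝓘(ℝ, F) ∞ S] in
theorem InCharts.coordMap_eq (h : InCharts (E := E) (F := F) i x₀ x) :
    coordMap E F i x₀ (extChartAt 𝓘(ℝ, F) x₀ x) = extChartAt 𝓘(ℝ, E) (i x₀) (i x) := by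
  unfold coordMap
  rw [(extChartAt 𝓘(ℝ, F) x₀).left_inv (by rw [extChartAt_source]; exact h.dom)]

omit [NormedSpace ℝ E] [IsManifold 𝓘(ℝ, E) ∞ M] [IsManifold 𝓘(ℝ, F) ∞ S] in
theorem InCharts.eventually (h : InCharts (E := E) (F := F) i x₀ x) (hi : Continuous i) :
    ∀ᶠ s in 𝓝 (extChartAt 𝓘(ℝ, F) x₀ x),
      InCharts (E := E) (F := F) i x₀ ((extChartAt 𝓘(ℝ, F) x₀).symm s) ∧
        extChartAt 𝓘(ℝ, F) x₀ ((extChartAt 𝓘(ℝ, F) x₀).symm s) = s := by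
  have hx : x ∈ (extChartAt 𝓘(ℝ, F) x₀).source := by rw [extChartAt_source]; exact h.dom
  have hc : ContinuousAt (extChartAt 𝓘(ℝ, F) x₀).symm (extChartAt 𝓘(ℝ, F) x₀ x) :=
    continuousAt_extChartAt_symm' hx
  have h2 : ∀ᶠ y in 𝓝 ((extChartAt 𝓘(ℝ, F) x₀).symm (extChartAt 𝓘(ℝ, F) x₀ x)),
      i y ∈ (chartAt E (i x₀)).source := by
    rw [(extChartAt 𝓘(ℝ, F) x₀).left_inv hx]
    exact hi.continuousAt.eventually ((chartAt E (i x₀)).open_source.mem_nhds h.cod)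
  filter_upwards [hc.eventually h2, eventually_chart_symm ((extChartAt 𝓘(ℝ, F) x₀).map_source hx)]
    with s hs hs'
  exact ⟨⟨hs'.2.1, hs⟩, hs'.2.2⟩

theorem contDiffAt_coordMap (hi : ContMDiff 𝓘(ℝ, F) 𝓘(ℝ, E) ∞ i)
    (h : InCharts (E := E) (F := F) i x₀ x) :
    ContDiffAt ℝ ∞ (coordMap E F i x₀) (extChartAt 𝓘(ℝ, F) x₀ x) := by
  rw [← contMDiffAt_iff_contDiffAt]
  have h1 : ContMDiffAt 𝓘(ℝ, F) 𝓘(ℝ, E) ∞ (fun x => extChartAt 𝓘(ℝ, E) (i x₀) (i x)) x :=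
    ContMDiffAt.comp (I' := 𝓘(ℝ, E)) x (contMDiffAt_extChartAt' h.cod) hi.contMDiffAt
  exact (contMDiffAt_comp_chart_symm h.dom).1 h1

theorem comps_push (hi : ContMDiff 𝓘(ℝ, F) 𝓘(ℝ, E) ∞ i)
    (h : InCharts (E := E) (F := F) i x₀ x) (u : TangentSpace 𝓘(ℝ, F) x) :
    comps (i x₀) (push i u : TangentSpace 𝓘(ℝ, E) (i x))
      = fderiv ℝ (coordMap E F i x₀) (extChartAt 𝓘(ℝ, F) x₀ x) (comps x₀ u) := by
  rw [comps_eq_mfderiv h.cod]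
  have h1 := mfderiv_comp x (mdifferentiableAt_extChartAt (I := 𝓘(ℝ, E)) h.cod)
    ((hi x).mdifferentiableAt (by simp))
  have h2 := mfderiv_eq_fderiv_comps h.dom (f := extChartAt 𝓘(ℝ, E) (i x₀) ∘ i)
    (ContDiffAt.differentiableAt_of_smooth (contDiffAt_coordMap hi h)) u
  rw [h1] at h2
  exact h2

theorem fderiv_coordMap_injective (hi : ContMDiff 𝓘(ℝ, F) 𝓘(ℝ, E) ∞ i)
    (himm : Function.Injective (mfderiv 𝓘(ℝ, F) 𝓘(ℝ, E) i x))
    (h : InCharts (E := E) (F := F) i x₀ x) :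
    Function.Injective (fderiv ℝ (coordMap E F i x₀) (extChartAt 𝓘(ℝ, F) x₀ x)) := by
  intro b c hbc
  rw [← comps_ofComps h.dom b, ← comps_ofComps h.dom c, ← comps_push hi h, ← comps_push hi h] at hbc
  have h1 := congrArg (ofComps (i x₀) (i x)) hbc
  rw [ofComps_comps h.cod, ofComps_comps h.cod] at h1
  have h2 : ofComps x₀ x b = ofComps x₀ x c := himm h1
  rw [← comps_ofComps h.dom b, ← comps_ofComps h.dom c, h2]

variable [FiniteDimensional ℝ E] [FiniteDimensional ℝ F]

/-- Independence of the chosen extension is the chain rule: the derivative of an extension is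
evaluated on a vector du, so only its composition with ι matters, and that is W'. -/
theorem comps_derivAlong (hi : ContMDiff 𝓘(ℝ, F) 𝓘(ℝ, E) ∞ i)
    (himm : Function.Injective (mfderiv 𝓘(ℝ, F) 𝓘(ℝ, E) i x))
    (h : InCharts (E := E) (F := F) i x₀ x) (D : AnisotropicConnection A)
    {η : TangentSpace 𝓘(ℝ, E) (i x)} (hη : (⟨i x, η⟩ : TangentBundle 𝓘(ℝ, E) M) ∈ A)
    {W : Π s : S, TangentSpace 𝓘(ℝ, E) (i s)} {W' : F → E}
    (hW' : ContDiffAt ℝ ∞ W' (extChartAt 𝓘(ℝ, F) x₀ x))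
    (hW : ∀ᶠ s in 𝓝 (extChartAt 𝓘(ℝ, F) x₀ x),
      comps (i x₀) (W ((extChartAt 𝓘(ℝ, F) x₀).symm s)) = W' s)
    (u : TangentSpace 𝓘(ℝ, F) x) :
    comps (i x₀) (derivAlong D i η u W)
      = fderiv ℝ W' (extChartAt 𝓘(ℝ, F) x₀ x) (comps x₀ u)
        + christoffel D (i x₀) (coordMap E F i x₀ (extChartAt 𝓘(ℝ, F) x₀ x), comps (i x₀) η)
            (fderiv ℝ (coordMap E F i x₀) (extChartAt 𝓘(ℝ, F) x₀ x) (comps x₀ u))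
            (W' (extChartAt 𝓘(ℝ, F) x₀ x)) := by
  have hx : x ∈ (extChartAt 𝓘(ℝ, F) x₀).source := by rw [extChartAt_source]; exact h.dom
  have hιs := contDiffAt_coordMap hi h
  set s := extChartAt 𝓘(ℝ, F) x₀ x with hs
  -- An extension must be exhibited, since `derivAlong` is 0 otherwise. It is W' ∘ r for a smooth
  -- local left inverse r of ι.
  have hex : ∃ W'' : Π y : M, TangentSpace 𝓘(ℝ, E) y,
      SmoothFieldAt W'' (i x) ∧ ∀ᶠ s in 𝓝 x, W'' (i s) = W s := by
    obtain ⟨r, hr, hrι⟩ := exists_smooth_leftInverse hιs (fderiv_coordMap_injective hi himm h)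
    refine ⟨fieldOfComps (i x₀) (W' ∘ r), smoothFieldAt_fieldOfComps h.cod ?_, ?_⟩
    · rw [← h.coordMap_eq]
      refine ContDiffAt.comp _ ?_ hr
      rw [hrι.self_of_nhds]
      exact hW'
    · have hc : ContinuousAt (extChartAt 𝓘(ℝ, F) x₀) x := continuousAt_extChartAt' hx
      filter_upwards [hc.eventually hrι, hc.eventually hW, hc.eventually (h.eventually hi.continuous),
        (chartAt F x₀).open_source.mem_nhds h.dom] with y h1 h2 h3 h4
      have h5 : (extChartAt 𝓘(ℝ, F) x₀).symm (extChartAt 𝓘(ℝ, F) x₀ y) = y :=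
        (extChartAt 𝓘(ℝ, F) x₀).left_inv (by rwa [extChartAt_source])
      rw [h5] at h2 h3
      unfold fieldOfComps
      rw [← h3.1.coordMap_eq]
      simp only [Function.comp]
      rw [h1, ← h2, ofComps_comps h3.1.cod]
  unfold derivAlong
  rw [dif_pos hex]
  obtain ⟨hsm, hev⟩ := hex.choose_spec
  have hsm' := (smoothFieldAt_iff h.cod).1 hsm
  rw [comps_conn D h.cod hη hsm' (Filter.Eventually.of_forall fun _ => rfl), comps_push hi h,
    ← h.coordMap_eq]
  rw [← h.coordMap_eq] at hsm'
  have hc : ContinuousAt (extChartAt 𝓘(ℝ, F) x₀).symm s := continuousAt_extChartAt_symm' hx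
  have e : (fun y => comps (i x₀) (hex.choose ((extChartAt 𝓘(ℝ, E) (i x₀)).symm y)))
      ∘ coordMap E F i x₀ =ᶠ[𝓝 s] W' := by
    have hev' : ∀ᶠ y in 𝓝 ((extChartAt 𝓘(ℝ, F) x₀).symm s), hex.choose (i y) = W y := by
      rwa [hs, (extChartAt 𝓘(ℝ, F) x₀).left_inv hx]
    filter_upwards [hW, hc.eventually hev', h.eventually hi.continuous] with s' h1 h2 h3
    simp only [Function.comp]
    have h4 : (extChartAt 𝓘(ℝ, E) (i x₀)).symm (coordMap E F i x₀ s')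
        = i ((extChartAt 𝓘(ℝ, F) x₀).symm s') :=
      (extChartAt 𝓘(ℝ, E) (i x₀)).left_inv (by rw [extChartAt_source]; exact h3.1.cod)
    rw [h4, h2, h1]
  have e1 : fderiv ℝ W' s = (fderiv ℝ _ (coordMap E F i x₀ s)).comp (fderiv ℝ (coordMap E F i x₀) s) :=
    e.fderiv_eq.symm.trans (fderiv_comp s (ContDiffAt.differentiableAt_of_smooth hsm')
      (ContDiffAt.differentiableAt_of_smooth hιs))
  have e2 := e.self_of_nhds
  rw [e1, ← e2]
  rfl

end Submanifold

/-! ### The second fundamental form and the difference tensor in coordinates. -/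

section SubmanifoldTensors

variable {E : Type*} [NormedAddCommGroup E] [NormedSpace ℝ E]
  {M : Type*} [TopologicalSpace M] [ChartedSpace E M] [IsManifold 𝓘(ℝ, E) ∞ M]
  {F : Type*} [NormedAddCommGroup F] [NormedSpace ℝ F]
  {S : Type*} [TopologicalSpace S] [ChartedSpace F S] [IsManifold 𝓘(ℝ, F) ∞ S]
  {A : Set (TangentBundle 𝓘(ℝ, E) M)} {L : TangentBundle 𝓘(ℝ, E) M → ℝ} {i : S → M}

/-- The metric `g_η` is non-degenerate on the tangent space of `S`, at a point which lies in the
domains of the preferred charts at `x₀` and `i x₀`. -/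
structure IsRegular (A : Set (TangentBundle 𝓘(ℝ, E) M)) (L : TangentBundle 𝓘(ℝ, E) M → ℝ)
    (i : S → M) (x₀ : S) {x : S} (η : TangentSpace 𝓘(ℝ, E) (i x)) : Prop where
  inCharts : InCharts (E := E) (F := F) i x₀ x
  mem : (⟨i x, η⟩ : TangentBundle 𝓘(ℝ, E) M) ∈ A
  invertible : (tangentGram (coordMap E F i x₀) (coordMetric L (i x₀))
    (extChartAt 𝓘(ℝ, F) x₀ x, comps (i x₀) η)).IsInvertible

variable {x₀ x : S} {η : TangentSpace 𝓘(ℝ, E) (i x)}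

omit [IsManifold 𝓘(ℝ, F) ∞ S] in
theorem InCharts.mem_coordDomain (h : InCharts (E := E) (F := F) i x₀ x)
    (hη : (⟨i x, η⟩ : TangentBundle 𝓘(ℝ, E) M) ∈ A) :
    ((coordMap E F i x₀ (extChartAt 𝓘(ℝ, F) x₀ x), comps (i x₀) η) : E × E)
      ∈ coordDomain (i x₀) A := by
  rw [h.coordMap_eq]
  exact PseudoFinsler.mem_coordDomain h.cod hη

theorem fundTensor_sub_push (hA : IsOpen A)
    (hL : ContMDiffOn (𝓘(ℝ, E)).tangent 𝓘(ℝ, ℝ) ∞ L A) (hi : ContMDiff 𝓘(ℝ, F) 𝓘(ℝ, E) ∞ i)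
    (h : InCharts (E := E) (F := F) i x₀ x)
    (hη : (⟨i x, η⟩ : TangentBundle 𝓘(ℝ, E) M) ∈ A) (ξ : TangentSpace 𝓘(ℝ, E) (i x))
    (a b : TangentSpace 𝓘(ℝ, F) x) :
    fundTensor L η (ξ - push i a) (push i b)
      = coordMetric L (i x₀) (coordMap E F i x₀ (extChartAt 𝓘(ℝ, F) x₀ x), comps (i x₀) η)
          (comps (i x₀) ξ
            - fderiv ℝ (coordMap E F i x₀) (extChartAt 𝓘(ℝ, F) x₀ x) (comps x₀ a))
          (fderiv ℝ (coordMap E F i x₀) (extChartAt 𝓘(ℝ, F) x₀ x) (comps x₀ b)) := by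
  rw [fundTensor_eq hA hL h.cod hη, comps_sub, comps_push hi h, comps_push hi h, h.coordMap_eq]

theorem IsRegular.comps_tanPart (hA : IsOpen A)
    (hL : ContMDiffOn (𝓘(ℝ, E)).tangent 𝓘(ℝ, ℝ) ∞ L A) (hi : ContMDiff 𝓘(ℝ, F) 𝓘(ℝ, E) ∞ i)
    (h : IsRegular (F := F) A L i x₀ η) (ξ : TangentSpace 𝓘(ℝ, E) (i x)) :
    comps x₀ (tanPart (F := F) L i η ξ)
      = tangentProj (coordMap E F i x₀) (coordMetric L (i x₀))
          (extChartAt 𝓘(ℝ, F) x₀ x, comps (i x₀) η) (comps (i x₀) ξ) := by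
  have hdom := h.inCharts.dom
  -- Existence and uniqueness exclude the default value 0 of `tanPart`; both come from invertibility
  -- of the Gram form.
  have hex : ∃! a : TangentSpace 𝓘(ℝ, F) x, ∀ b : TangentSpace 𝓘(ℝ, F) x,
      fundTensor L η (ξ - push i a) (push i b) = 0 := by
    simp only [fundTensor_sub_push hA hL hi h.inCharts h.mem]
    refine ⟨ofComps x₀ x (tangentProj (coordMap E F i x₀) (coordMetric L (i x₀))
          (extChartAt 𝓘(ℝ, F) x₀ x, comps (i x₀) η) (comps (i x₀) ξ)), ?_, ?_⟩
    · intro b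
      rw [comps_ofComps hdom]
      exact tangentProj_orthogonal h.invertible _ _
    · intro c hc
      rw [← ofComps_comps hdom c]
      congr 1
      refine eq_tangentProj h.invertible fun b => ?_
      have := hc (ofComps x₀ x b)
      rwa [comps_ofComps hdom] at this
  unfold tanPart
  rw [dif_pos hex]
  refine eq_tangentProj h.invertible fun b => ?_
  have h1 := hex.choose_spec.1 (ofComps x₀ x b)
  simp only at h1
  rw [fundTensor_sub_push hA hL hi h.inCharts h.mem, comps_ofComps hdom] at h1
  exact h1

theorem IsRegular.comps_norPart (hA : IsOpen A)
    (hL : ContMDiffOn (𝓘(ℝ, E)).tangent 𝓘(ℝ, ℝ) ∞ L A) (hi : ContMDiff 𝓘(ℝ, F) 𝓘(ℝ, E) ∞ i)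
    (h : IsRegular (F := F) A L i x₀ η) (ξ : TangentSpace 𝓘(ℝ, E) (i x)) :
    comps (i x₀) (norPart (F := F) L i η ξ)
      = comps (i x₀) ξ - fderiv ℝ (coordMap E F i x₀) (extChartAt 𝓘(ℝ, F) x₀ x)
          (tangentProj (coordMap E F i x₀) (coordMetric L (i x₀))
            (extChartAt 𝓘(ℝ, F) x₀ x, comps (i x₀) η) (comps (i x₀) ξ)) := by
  unfold norPart
  rw [comps_sub, comps_push hi h.inCharts, h.comps_tanPart hA hL hi]

variable [FiniteDimensional ℝ E] [FiniteDimensional ℝ F]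

-- Regularity is an open condition, as invertibility and membership in `A` are. It is stated for all
-- coordinates near a given pair so that it applies both along vertical lines η + tξ and along the
-- extension of a tangent vector over S.
omit [FiniteDimensional ℝ E] in
theorem IsRegular.eventually (hA : IsOpen A)
    (hL : ContMDiffOn (𝓘(ℝ, E)).tangent 𝓘(ℝ, ℝ) ∞ L A) (hi : ContMDiff 𝓘(ℝ, F) 𝓘(ℝ, E) ∞ i)
    (h : IsRegular (F := F) A L i x₀ η) :
    ∀ᶠ a in 𝓝 ((extChartAt 𝓘(ℝ, F) x₀ x, comps (i x₀) η) : F × E),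
      ∀ (x' : S) (η' : TangentSpace 𝓘(ℝ, E) (i x')), InCharts (E := E) (F := F) i x₀ x' →
        extChartAt 𝓘(ℝ, F) x₀ x' = a.1 → comps (i x₀) η' = a.2 →
        IsRegular (F := F) A L i x₀ η' := by
  have : CompleteSpace F := FiniteDimensional.complete ℝ F
  have hι := contDiffAt_coordMap hi h.inCharts
  have hd := h.inCharts.mem_coordDomain h.mem
  have hc : ContinuousAt (fun a : F × E => ((coordMap E F i x₀ a.1, a.2) : E × E))
      (extChartAt 𝓘(ℝ, F) x₀ x, comps (i x₀) η) :=
    ContinuousAt.prodMk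
      (ContinuousAt.comp (g := coordMap E F i x₀) hι.continuousAt continuousAt_fst)
      continuousAt_snd
  have hinv := eventually_isInvertible_tangentGram h.invertible hι
    (contDiffAt_verticalHessian (contDiffAt_comp_ofCoords hA hL hd))
  filter_upwards [hc.eventually (eventually_mem_coordDomain hA hd), hinv]
  rintro ⟨s', ξ'⟩ h1 h2 x' η' hx' rfl rfl
  refine ⟨hx', ?_, h2⟩
  have := h1.2
  simp only at this
  rwa [hx'.coordMap_eq, ofCoords_comps hx'.cod] at this

omit [IsManifold 𝓘(ℝ, F) ∞ S] [FiniteDimensional ℝ E] [FiniteDimensional ℝ F] in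
theorem IsRegular.contDiffAt_metric (hA : IsOpen A)
    (hL : ContMDiffOn (𝓘(ℝ, E)).tangent 𝓘(ℝ, ℝ) ∞ L A) (h : IsRegular (F := F) A L i x₀ η) :
    ContDiffAt ℝ ∞ (coordMetric L (i x₀))
      (coordMap E F i x₀ (extChartAt 𝓘(ℝ, F) x₀ x), comps (i x₀) η) :=
  contDiffAt_verticalHessian
    (contDiffAt_comp_ofCoords hA hL (h.inCharts.mem_coordDomain h.mem))

omit [IsManifold 𝓘(ℝ, F) ∞ S] [FiniteDimensional ℝ F] in
theorem IsRegular.contDiffAt_christoffel (hA : IsOpen A) (D : AnisotropicConnection A)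
    (h : IsRegular (F := F) A L i x₀ η) :
    ContDiffAt ℝ ∞ (christoffel D (i x₀))
      (coordMap E F i x₀ (extChartAt 𝓘(ℝ, F) x₀ x), comps (i x₀) η) :=
  PseudoFinsler.contDiffAt_christoffel D hA (h.inCharts.mem_coordDomain h.mem)

theorem IsRegular.contDiffAt_tangentHessian (hA : IsOpen A)
    (hL : ContMDiffOn (𝓘(ℝ, E)).tangent 𝓘(ℝ, ℝ) ∞ L A) (hi : ContMDiff 𝓘(ℝ, F) 𝓘(ℝ, E) ∞ i)
    (D : AnisotropicConnection A) (h : IsRegular (F := F) A L i x₀ η) :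
    ContDiffAt ℝ ∞
      (tangentHessian (coordMap E F i x₀) (christoffel D (i x₀)) (coordMetric L (i x₀)))
      (extChartAt 𝓘(ℝ, F) x₀ x, comps (i x₀) η) :=
  have : CompleteSpace F := FiniteDimensional.complete ℝ F
  PseudoFinsler.contDiffAt_tangentHessian h.invertible (contDiffAt_coordMap hi h.inCharts)
    (h.contDiffAt_metric hA hL) (h.contDiffAt_christoffel hA D)

theorem IsRegular.contDiffAt_normalHessian (hA : IsOpen A)
    (hL : ContMDiffOn (𝓘(ℝ, E)).tangent 𝓘(ℝ, ℝ) ∞ L A) (hi : ContMDiff 𝓘(ℝ, F) 𝓘(ℝ, E) ∞ i)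
    (D : AnisotropicConnection A) (h : IsRegular (F := F) A L i x₀ η) :
    ContDiffAt ℝ ∞
      (normalHessian (coordMap E F i x₀) (christoffel D (i x₀)) (coordMetric L (i x₀)))
      (extChartAt 𝓘(ℝ, F) x₀ x, comps (i x₀) η) :=
  have : CompleteSpace F := FiniteDimensional.complete ℝ F
  PseudoFinsler.contDiffAt_normalHessian h.invertible (contDiffAt_coordMap hi h.inCharts)
    (h.contDiffAt_metric hA hL) (h.contDiffAt_christoffel hA D)

/-- Product rule for s ↦ dι_s(W'(s)): the derivative of W' contributes only a tangent vector. The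
normal projection kills it, and it cancels in the difference tensor. -/
theorem comps_derivAlong_push (hi : ContMDiff 𝓘(ℝ, F) 𝓘(ℝ, E) ∞ i)
    (himm : Function.Injective (mfderiv 𝓘(ℝ, F) 𝓘(ℝ, E) i x))
    (h : InCharts (E := E) (F := F) i x₀ x) (D : AnisotropicConnection A)
    (hη : (⟨i x, η⟩ : TangentBundle 𝓘(ℝ, E) M) ∈ A)
    {W : Π s : S, TangentSpace 𝓘(ℝ, F) s} {W' : F → F}
    (hW' : ContDiffAt ℝ ∞ W' (extChartAt 𝓘(ℝ, F) x₀ x))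
    (hW : ∀ᶠ s in 𝓝 (extChartAt 𝓘(ℝ, F) x₀ x),
      comps x₀ (W ((extChartAt 𝓘(ℝ, F) x₀).symm s)) = W' s)
    (u : TangentSpace 𝓘(ℝ, F) x) :
    comps (i x₀) (derivAlong D i η u (fun s => push i (W s)))
      = immersionHessian (coordMap E F i x₀) (christoffel D (i x₀))
          (extChartAt 𝓘(ℝ, F) x₀ x, comps (i x₀) η) (comps x₀ u) (W' (extChartAt 𝓘(ℝ, F) x₀ x))
        + fderiv ℝ (coordMap E F i x₀) (extChartAt 𝓘(ℝ, F) x₀ x)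
            (fderiv ℝ W' (extChartAt 𝓘(ℝ, F) x₀ x) (comps x₀ u)) := by
  have hι := contDiffAt_coordMap hi h
  have hι' := contDiffAt_fderiv_of_smooth hι
  have e : ∀ᶠ s in 𝓝 (extChartAt 𝓘(ℝ, F) x₀ x),
      comps (i x₀) ((fun s => (push i (W s) : TangentSpace 𝓘(ℝ, E) (i s)))
        ((extChartAt 𝓘(ℝ, F) x₀).symm s)) = fderiv ℝ (coordMap E F i x₀) s (W' s) := by
    filter_upwards [hW, h.eventually hi.continuous] with s h1 h2
    rw [comps_push hi h2.1, h2.2, h1]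
  rw [comps_derivAlong hi himm h D hη (hι'.clm_apply hW') e, immersionHessian_apply]
  have hd := (ContDiffAt.differentiableAt_of_smooth hι').hasFDerivAt.clm_apply
    (ContDiffAt.differentiableAt_of_smooth hW').hasFDerivAt
  rw [hd.fderiv]
  simp only [_root_.add_apply, ContinuousLinearMap.comp_apply, ContinuousLinearMap.flip_apply]
  abel

theorem IsRegular.comps_secondFF (hA : IsOpen A)
    (hL : ContMDiffOn (𝓘(ℝ, E)).tangent 𝓘(ℝ, ℝ) ∞ L A) (hi : ContMDiff 𝓘(ℝ, F) 𝓘(ℝ, E) ∞ i)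
    (himm : Function.Injective (mfderiv 𝓘(ℝ, F) 𝓘(ℝ, E) i x))
    (D : AnisotropicConnection A) (h : IsRegular (F := F) A L i x₀ η)
    (u w : TangentSpace 𝓘(ℝ, F) x) :
    comps (i x₀) (secondFF L D i η u w)
      = normalHessian (coordMap E F i x₀) (christoffel D (i x₀)) (coordMetric L (i x₀))
          (extChartAt 𝓘(ℝ, F) x₀ x, comps (i x₀) η) (comps x₀ u) (comps x₀ w) := by
  -- The extension of w is constant in the chart at x, not in the one at x₀, so its derivative in
  -- the chart at x₀ need not vanish. It is carried along and drops out under the normal projection.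
  have hw := (smoothFieldAt_iff h.inCharts.dom).1 (smoothFieldAt_extField w)
  have hw' : comps x₀ (extField w ((extChartAt 𝓘(ℝ, F) x₀).symm (extChartAt 𝓘(ℝ, F) x₀ x)))
      = comps x₀ w := by
    rw [(extChartAt 𝓘(ℝ, F) x₀).left_inv (by rw [extChartAt_source]; exact h.inCharts.dom)]
    exact congrArg (fun u => comps x₀ u) (FiberBundle.extend_apply_self F w)
  unfold secondFF
  rw [h.comps_norPart hA hL hi, comps_derivAlong_push hi himm h.inCharts D h.mem hw
    (Filter.Eventually.of_forall fun _ => rfl), hw', map_add,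
    tangentProj_fderiv h.invertible, map_add, normalHessian_apply, tangentHessian_apply]
  abel

theorem IsRegular.comps_diffTensor (hA : IsOpen A)
    (hL : ContMDiffOn (𝓘(ℝ, E)).tangent 𝓘(ℝ, ℝ) ∞ L A) (hi : ContMDiff 𝓘(ℝ, F) 𝓘(ℝ, E) ∞ i)
    (himm : Function.Injective (mfderiv 𝓘(ℝ, F) 𝓘(ℝ, E) i x))
    (D : AnisotropicConnection A) (D' : AnisotropicConnection (restrictDomain (F := F) i A))
    {v : TangentSpace 𝓘(ℝ, F) x} (h : IsRegular (F := F) A L i x₀ (push i v))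
    (u w : TangentSpace 𝓘(ℝ, F) x) :
    comps x₀ (diffTensor L D i D' v u w)
      = tangentHessian (coordMap E F i x₀) (christoffel D (i x₀)) (coordMetric L (i x₀))
          (extChartAt 𝓘(ℝ, F) x₀ x, fderiv ℝ (coordMap E F i x₀) (extChartAt 𝓘(ℝ, F) x₀ x)
            (comps x₀ v)) (comps x₀ u) (comps x₀ w)
        - christoffel D' x₀ (extChartAt 𝓘(ℝ, F) x₀ x, comps x₀ v) (comps x₀ u) (comps x₀ w) := by
  -- Again the extension is not constant in the chart at x₀; its derivative appears identically in
  -- the induced and in the intrinsic connection and cancels.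
  have hw := (smoothFieldAt_iff h.inCharts.dom).1 (smoothFieldAt_extField w)
  have hw' : comps x₀ (extField w ((extChartAt 𝓘(ℝ, F) x₀).symm (extChartAt 𝓘(ℝ, F) x₀ x)))
      = comps x₀ w := by
    rw [(extChartAt 𝓘(ℝ, F) x₀).left_inv (by rw [extChartAt_source]; exact h.inCharts.dom)]
    exact congrArg (fun u => comps x₀ u) (FiberBundle.extend_apply_self F w)
  have hmem : (⟨x, v⟩ : TangentBundle 𝓘(ℝ, F) S) ∈ restrictDomain (F := F) i A := h.mem
  unfold diffTensor inducedConn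
  rw [comps_sub, h.comps_tanPart hA hL hi, comps_derivAlong_push hi himm h.inCharts D h.mem hw
    (Filter.Eventually.of_forall fun _ => rfl), hw', map_add,
    tangentProj_fderiv h.invertible,
    comps_conn D' h.inCharts.dom hmem hw (Filter.Eventually.of_forall fun _ => rfl), hw',
    tangentHessian_apply, comps_push hi h.inCharts]
  abel

end SubmanifoldTensors

/-! ### Vertical and covariant derivatives of II and Q in coordinates. -/

section DerivativeTensors

variable {E : Type*} [NormedAddCommGroup E] [NormedSpace ℝ E] [FiniteDimensional ℝ E]
  {M : Type*} [TopologicalSpace M] [ChartedSpace E M] [IsManifold 𝓘(ℝ, E) ∞ M]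
  {F : Type*} [NormedAddCommGroup F] [NormedSpace ℝ F] [FiniteDimensional ℝ F]
  {S : Type*} [TopologicalSpace S] [ChartedSpace F S] [IsManifold 𝓘(ℝ, F) ∞ S]
  {A : Set (TangentBundle 𝓘(ℝ, E) M)} {L : TangentBundle 𝓘(ℝ, E) M → ℝ} {i : S → M}
  {x : S}

omit [FiniteDimensional ℝ E] in
theorem IsRegular.eventually_add_smul (hA : IsOpen A)
    (hL : ContMDiffOn (𝓘(ℝ, E)).tangent 𝓘(ℝ, ℝ) ∞ L A) (hi : ContMDiff 𝓘(ℝ, F) 𝓘(ℝ, E) ∞ i)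
    {η : TangentSpace 𝓘(ℝ, E) (i x)} (h : IsRegular (F := F) A L i x η)
    (ξ : TangentSpace 𝓘(ℝ, E) (i x)) :
    ∀ᶠ t : ℝ in 𝓝 0, IsRegular (F := F) A L i x (η + t • ξ) := by
  filter_upwards [eventually_vertical (z := comps (i x) ξ) (h.eventually hA hL hi)] with t ht
  refine ht x _ (inCharts_self i x) rfl ?_
  rw [comps_add, comps_smul]

omit [FiniteDimensional ℝ E] in
theorem IsRegular.eventually_extField (hA : IsOpen A)
    (hL : ContMDiffOn (𝓘(ℝ, E)).tangent 𝓘(ℝ, ℝ) ∞ L A) (hi : ContMDiff 𝓘(ℝ, F) 𝓘(ℝ, E) ∞ i)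
    {v : TangentSpace 𝓘(ℝ, F) x} (h : IsRegular (F := F) A L i x (push i v)) :
    ∀ᶠ s in 𝓝 (extChartAt 𝓘(ℝ, F) x x),
      IsRegular (F := F) A L i x (push i (extField v ((extChartAt 𝓘(ℝ, F) x).symm s))) := by
  have hι := contDiffAt_coordMap hi (inCharts_self (E := E) i x)
  have hc : ContinuousAt (fun s : F => ((s, fderiv ℝ (coordMap E F i x) s (comps x v)) : F × E))
      (extChartAt 𝓘(ℝ, F) x x) :=
    continuousAt_id.prodMk
      ((contDiffAt_fderiv_of_smooth hι).clm_apply contDiffAt_const).continuousAt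
  have hev := h.eventually hA hL hi
  rw [comps_push hi (inCharts_self i x)] at hev
  filter_upwards [hc.eventually hev, (inCharts_self (E := E) i x).eventually hi.continuous]
    with s h1 h2
  refine h1 _ _ h2.1 h2.2 ?_
  rw [comps_push hi h2.1, extField_apply h2.1.dom, comps_ofComps h2.1.dom, h2.2]

omit [FiniteDimensional ℝ F] in
theorem comps_extField_at {x₀ x' : S} (hx : x' ∈ (chartAt F x₀).source)
    (v : TangentSpace 𝓘(ℝ, F) x₀) : comps x₀ (extField v x') = comps x₀ v := by
  rw [extField_apply hx, comps_ofComps hx]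

theorem comps_vertDerivSecondFF (hA : IsOpen A)
    (hL : ContMDiffOn (𝓘(ℝ, E)).tangent 𝓘(ℝ, ℝ) ∞ L A) (hi : ContMDiff 𝓘(ℝ, F) 𝓘(ℝ, E) ∞ i)
    (himm : ∀ x, Function.Injective (mfderiv 𝓘(ℝ, F) 𝓘(ℝ, E) i x)) (D : AnisotropicConnection A)
    {η : TangentSpace 𝓘(ℝ, E) (i x)} (h : IsRegular (F := F) A L i x η)
    (u w : TangentSpace 𝓘(ℝ, F) x) (ξ : TangentSpace 𝓘(ℝ, E) (i x)) :
    comps (i x) (vertDerivSecondFF L D i η u w ξ)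
      = fderiv ℝ (normalHessian (coordMap E F i x) (christoffel D (i x)) (coordMetric L (i x)))
          (extChartAt 𝓘(ℝ, F) x x, comps (i x) η) (0, comps (i x) ξ) (comps x u) (comps x w) := by
  have hN := h.contDiffAt_normalHessian hA hL hi D
  unfold vertDerivSecondFF
  rw [comps_deriv]
  have e : (fun t : ℝ => comps (i x) (secondFF L D i (η + t • ξ) u w)) =ᶠ[𝓝 0] fun t =>
      normalHessian (coordMap E F i x) (christoffel D (i x)) (coordMetric L (i x))
        (extChartAt 𝓘(ℝ, F) x x, comps (i x) η + t • comps (i x) ξ) (comps x u) (comps x w) := by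
    filter_upwards [h.eventually_add_smul hA hL hi ξ] with t ht
    rw [ht.comps_secondFF hA hL hi (himm x) D, comps_add, comps_smul]
  rw [e.deriv_eq, deriv_comp_vertical
    (f := fun a => normalHessian (coordMap E F i x) (christoffel D (i x)) (coordMetric L (i x)) a
      (comps x u) (comps x w))
    (ContDiffAt.differentiableAt_of_smooth (ContDiffAt.apply_apply hN _ _)),
    fderiv_apply_apply (ContDiffAt.differentiableAt_of_smooth hN)]

/-- The extension of v gives the curve of pairs (s', dι_{s'} v), with derivative (u, D²ι(u, v)). The
ambient derivative of this extension is the Hessian D²ι(u, v) + Γ(du, dv), so subtracting the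
vertical derivative along it leaves the Γ-horizontal direction, with fibre part -Γ(du, dv). -/
theorem comps_derivSecondFF (hA : IsOpen A)
    (hL : ContMDiffOn (𝓘(ℝ, E)).tangent 𝓘(ℝ, ℝ) ∞ L A) (hi : ContMDiff 𝓘(ℝ, F) 𝓘(ℝ, E) ∞ i)
    (himm : ∀ x, Function.Injective (mfderiv 𝓘(ℝ, F) 𝓘(ℝ, E) i x)) (D : AnisotropicConnection A)
    {v : TangentSpace 𝓘(ℝ, F) x} (h : IsRegular (F := F) A L i x (push i v))
    (u w z : TangentSpace 𝓘(ℝ, F) x) :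
    let ι := coordMap E F i x
    let s := extChartAt 𝓘(ℝ, F) x x
    let Γ := christoffel D (i x)
    let B := normalHessian ι Γ (coordMetric L (i x))
    let a := (s, fderiv ℝ ι s (comps x v))
    comps (i x) (derivSecondFF L D i v u (extField w) (extField z))
      = fderiv ℝ B a (comps x u, fderiv ℝ (fderiv ℝ ι) s (comps x u) (comps x v)
            - immersionHessian ι Γ a (comps x u) (comps x v)) (comps x w) (comps x z)
        + Γ (ι s, fderiv ℝ ι s (comps x v)) (fderiv ℝ ι s (comps x u))
            (B a (comps x w) (comps x z)) := by
  intro ι s Γ B a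
  have hc := inCharts_self (E := E) (F := F) i x
  have hpv : comps (i x) (push i v) = fderiv ℝ ι s (comps x v) := comps_push hi hc v
  have hN : ContDiffAt ℝ ∞ B a := by
    have := h.contDiffAt_normalHessian hA hL hi D
    rwa [hpv] at this
  have hι : ContDiffAt ℝ ∞ ι s := contDiffAt_coordMap hi hc
  have hι' := contDiffAt_fderiv_of_smooth hι
  have hNwz := ContDiffAt.apply_apply hN (comps x w) (comps x z)
  have hself : ∀ v : TangentSpace 𝓘(ℝ, F) x, extField v x = v := fun v =>
    FiberBundle.extend_apply_self F v
  have hcurve : ContDiffAt ℝ ∞ (fun s' : F => ((s', fderiv ℝ ι s' (comps x v)) : F × E)) s :=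
    contDiffAt_id.prodMk (hι'.clm_apply contDiffAt_const)
  have e : ∀ᶠ s' in 𝓝 s, comps (i x) ((fun s => secondFF L D i (push i (extField v s))
      (extField w s) (extField z s)) ((extChartAt 𝓘(ℝ, F) x).symm s'))
      = B (s', fderiv ℝ ι s' (comps x v)) (comps x w) (comps x z) := by
    filter_upwards [h.eventually_extField hA hL hi, hc.eventually hi.continuous] with s' h1 h2
    rw [h1.comps_secondFF hA hL hi (himm _) D, comps_push hi h2.1, comps_extField_at h2.1.dom,
      comps_extField_at h2.1.dom, comps_extField_at h2.1.dom, h2.2]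
  have hV : comps (i x) (derivAlong D i (push i v) u (fun s => push i (extField v s)))
      = immersionHessian ι Γ a (comps x u) (comps x v) := by
    rw [comps_derivAlong_push hi (himm x) hc D h.mem contDiffAt_const (comps_extField v), hpv]
    simp
    rfl
  unfold derivSecondFF
  rw [comps_sub, comps_derivAlong hi (himm x) hc D h.mem
    (ContDiffAt.comp (g := fun a => B a (comps x w) (comps x z)) s hNwz hcurve) e,
    comps_vertDerivSecondFF hA hL hi himm D h, hV, hpv, hself, hself]
  have hd : fderiv ℝ (fun s' : F => B (s', fderiv ℝ ι s' (comps x v)) (comps x w) (comps x z)) s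
      (comps x u) = fderiv ℝ B a (comps x u, fderiv ℝ (fderiv ℝ ι) s (comps x u) (comps x v))
        (comps x w) (comps x z) := by
    have k1 := (hasFDerivAt_id s).prodMk
      ((ContDiffAt.differentiableAt_of_smooth hι').hasFDerivAt.clm_apply
        (hasFDerivAt_const (comps x v) s))
    have k2 := HasFDerivAt.comp (g := fun a => B a (comps x w) (comps x z)) s
      (f := fun s' : F => ((s', fderiv ℝ ι s' (comps x v)) : F × E))
      (ContDiffAt.differentiableAt_of_smooth hNwz).hasFDerivAt k1
    have k3 := DFunLike.congr_fun k2.fderiv (comps x u)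
    refine k3.trans ?_
    rw [ContinuousLinearMap.comp_apply, fderiv_apply_apply
      (ContDiffAt.differentiableAt_of_smooth hN)]
    simp [a]
  have split : ((comps x u, fderiv ℝ (fderiv ℝ ι) s (comps x u) (comps x v)
      - immersionHessian ι Γ a (comps x u) (comps x v)) : F × E)
      = (comps x u, fderiv ℝ (fderiv ℝ ι) s (comps x u) (comps x v))
        - (0, immersionHessian ι Γ a (comps x u) (comps x v)) := by
    ext
    · simp
    · simp
  rw [split, map_sub]
  simp only [_root_.sub_apply]
  rw [← hd]
  change fderiv ℝ (fun s' : F => B (s', fderiv ℝ ι s' (comps x v)) (comps x w) (comps x z)) s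
      (comps x u) + Γ (ι s, fderiv ℝ ι s (comps x v)) (fderiv ℝ ι s (comps x u))
    (B a (comps x w) (comps x z)) - fderiv ℝ B a _ _ _ = _
  abel

/-- The difference tensor in coordinates. -/
def coordDiffTensor (L : TangentBundle 𝓘(ℝ, E) M → ℝ) (D : AnisotropicConnection A) (i : S → M)
    (D' : AnisotropicConnection (restrictDomain (F := F) i A)) (x : S) (a : F × F) :
    F →L[ℝ] F →L[ℝ] F :=
  tangentHessian (coordMap E F i x) (christoffel D (i x)) (coordMetric L (i x))
    (a.1, fderiv ℝ (coordMap E F i x) a.1 a.2) - christoffel D' x a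

omit [FiniteDimensional ℝ E] [FiniteDimensional ℝ F] in
theorem isOpen_restrictDomain (hA : IsOpen A) (hi : ContMDiff 𝓘(ℝ, F) 𝓘(ℝ, E) ∞ i) :
    IsOpen (restrictDomain (F := F) i A) :=
  hA.preimage (hi.continuous_tangentMap (by simp))

theorem contDiffAt_tangentHessian_push (hA : IsOpen A)
    (hL : ContMDiffOn (𝓘(ℝ, E)).tangent 𝓘(ℝ, ℝ) ∞ L A) (hi : ContMDiff 𝓘(ℝ, F) 𝓘(ℝ, E) ∞ i)
    (D : AnisotropicConnection A)
    {v : TangentSpace 𝓘(ℝ, F) x} (h : IsRegular (F := F) A L i x (push i v)) :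
    ContDiffAt ℝ ∞ (fun a : F × F =>
      tangentHessian (coordMap E F i x) (christoffel D (i x)) (coordMetric L (i x))
        (a.1, fderiv ℝ (coordMap E F i x) a.1 a.2)) (extChartAt 𝓘(ℝ, F) x x, comps x v) := by
  have hc := inCharts_self (E := E) (F := F) i x
  have hq := h.contDiffAt_tangentHessian hA hL hi D
  rw [comps_push hi hc] at hq
  refine ContDiffAt.comp (g := tangentHessian (coordMap E F i x) (christoffel D (i x))
    (coordMetric L (i x))) (f := fun a : F × F => ((a.1, fderiv ℝ (coordMap E F i x) a.1 a.2) :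
      F × E)) (extChartAt 𝓘(ℝ, F) x x, comps x v) hq (contDiffAt_fst.prodMk ?_)
  exact (ContDiffAt.comp (g := fderiv ℝ (coordMap E F i x)) (f := Prod.fst)
    (extChartAt 𝓘(ℝ, F) x x, comps x v)
    (contDiffAt_fderiv_of_smooth (contDiffAt_coordMap hi hc)) contDiffAt_fst).clm_apply
    contDiffAt_snd

theorem contDiffAt_coordDiffTensor (hA : IsOpen A)
    (hL : ContMDiffOn (𝓘(ℝ, E)).tangent 𝓘(ℝ, ℝ) ∞ L A) (hi : ContMDiff 𝓘(ℝ, F) 𝓘(ℝ, E) ∞ i)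
    (D : AnisotropicConnection A) (D' : AnisotropicConnection (restrictDomain (F := F) i A))
    {v : TangentSpace 𝓘(ℝ, F) x} (h : IsRegular (F := F) A L i x (push i v)) :
    ContDiffAt ℝ ∞ (coordDiffTensor L D i D' x) (extChartAt 𝓘(ℝ, F) x x, comps x v) := by
  have hmem : (⟨x, v⟩ : TangentBundle 𝓘(ℝ, F) S) ∈ restrictDomain (F := F) i A := h.mem
  exact (contDiffAt_tangentHessian_push hA hL hi D h).sub
    (contDiffAt_christoffel D' (isOpen_restrictDomain hA hi)
      (mem_coordDomain (mem_chart_source F x) hmem))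

theorem comps_diffTensor_self (hA : IsOpen A)
    (hL : ContMDiffOn (𝓘(ℝ, E)).tangent 𝓘(ℝ, ℝ) ∞ L A) (hi : ContMDiff 𝓘(ℝ, F) 𝓘(ℝ, E) ∞ i)
    (himm : ∀ x, Function.Injective (mfderiv 𝓘(ℝ, F) 𝓘(ℝ, E) i x)) (D : AnisotropicConnection A)
    (D' : AnisotropicConnection (restrictDomain (F := F) i A)) {x' : S}
    {v : TangentSpace 𝓘(ℝ, F) x'} (h : IsRegular (F := F) A L i x (push i v))
    (u w : TangentSpace 𝓘(ℝ, F) x') :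
    comps x (diffTensor L D i D' v u w)
      = coordDiffTensor L D i D' x (extChartAt 𝓘(ℝ, F) x x', comps x v) (comps x u) (comps x w) :=
  h.comps_diffTensor hA hL hi (himm x') D D' u w

theorem comps_vertDeriv_diffTensor (hA : IsOpen A)
    (hL : ContMDiffOn (𝓘(ℝ, E)).tangent 𝓘(ℝ, ℝ) ∞ L A) (hi : ContMDiff 𝓘(ℝ, F) 𝓘(ℝ, E) ∞ i)
    (himm : ∀ x, Function.Injective (mfderiv 𝓘(ℝ, F) 𝓘(ℝ, E) i x)) (D : AnisotropicConnection A)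
    (D' : AnisotropicConnection (restrictDomain (F := F) i A))
    {v : TangentSpace 𝓘(ℝ, F) x} (h : IsRegular (F := F) A L i x (push i v))
    (u w z : TangentSpace 𝓘(ℝ, F) x) :
    comps x (vertDerivTensor (fun _ y => diffTensor L D i D' y) v u w z)
      = fderiv ℝ (coordDiffTensor L D i D' x) (extChartAt 𝓘(ℝ, F) x x, comps x v)
          (0, comps x z) (comps x u) (comps x w) := by
  have hQ := contDiffAt_coordDiffTensor hA hL hi D D' h
  unfold vertDerivTensor
  rw [comps_deriv]
  have e : (fun t : ℝ => comps x (diffTensor L D i D' (v + t • z) u w)) =ᶠ[𝓝 0] fun t =>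
      coordDiffTensor L D i D' x (extChartAt 𝓘(ℝ, F) x x, comps x v + t • comps x z)
        (comps x u) (comps x w) := by
    filter_upwards [h.eventually_add_smul hA hL hi (push i z)] with t ht
    have hp : (push i v + t • push i z : TangentSpace 𝓘(ℝ, E) (i x)) = push i (v + t • z) := by
      unfold push
      rw [map_add, map_smul]
    rw [hp] at ht
    rw [comps_diffTensor_self hA hL hi himm D D' ht, comps_add, comps_smul]
  rw [e.deriv_eq, deriv_comp_vertical
    (f := fun a => coordDiffTensor L D i D' x a (comps x u) (comps x w))
    (ContDiffAt.differentiableAt_of_smooth (ContDiffAt.apply_apply hQ _ _)),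
    fderiv_apply_apply (ContDiffAt.differentiableAt_of_smooth hQ)]

/-- As for the curvature, constant extensions reduce the first two terms of the definition to a
derivative in the direction (u, -γ(u, v)). -/
theorem comps_covDeriv_diffTensor (hA : IsOpen A)
    (hL : ContMDiffOn (𝓘(ℝ, E)).tangent 𝓘(ℝ, ℝ) ∞ L A) (hi : ContMDiff 𝓘(ℝ, F) 𝓘(ℝ, E) ∞ i)
    (himm : ∀ x, Function.Injective (mfderiv 𝓘(ℝ, F) 𝓘(ℝ, E) i x)) (D : AnisotropicConnection A)
    (D' : AnisotropicConnection (restrictDomain (F := F) i A))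
    {v : TangentSpace 𝓘(ℝ, F) x} (h : IsRegular (F := F) A L i x (push i v))
    (u w z : TangentSpace 𝓘(ℝ, F) x) :
    comps x (covDerivTensor D' (fun _ y => diffTensor L D i D' y) v u w z)
      = coordCovDeriv (christoffel D' x) (coordDiffTensor L D i D' x)
          (extChartAt 𝓘(ℝ, F) x x, comps x v) (comps x u) (comps x w) (comps x z) := by
  have hc := inCharts_self (E := E) (F := F) i x
  have hQ := contDiffAt_coordDiffTensor hA hL hi D D' h
  have hQwz := ContDiffAt.apply_apply hQ (comps x w) (comps x z)
  have hmem : (⟨x, v⟩ : TangentBundle 𝓘(ℝ, F) S) ∈ restrictDomain (F := F) i A := h.mem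
  have e : ∀ᶠ s in 𝓝 (extChartAt 𝓘(ℝ, F) x x), comps x ((fun s => diffTensor L D i D'
      (extField v s) (extField w s) (extField z s)) ((extChartAt 𝓘(ℝ, F) x).symm s))
      = coordDiffTensor L D i D' x (s, comps x v) (comps x w) (comps x z) := by
    filter_upwards [h.eventually_extField hA hL hi, hc.eventually hi.continuous] with s h1 h2
    rw [comps_diffTensor_self hA hL hi himm D D' h1, comps_extField_at h2.1.dom,
      comps_extField_at h2.1.dom, comps_extField_at h2.1.dom, h2.2]
  unfold covDerivTensor coordCovDeriv
  rw [comps_sub, comps_sub, comps_sub,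
    comps_conn D' (mem_chart_source F x) hmem (contDiffAt_prodMk_const hQwz) e,
    comps_vertDeriv_diffTensor hA hL hi himm D D' h,
    comps_diffTensor_self hA hL hi himm D D' h, comps_diffTensor_self hA hL hi himm D D' h,
    comps_conn_extField D' hmem, comps_conn_extField D' hmem, comps_conn_extField D' hmem,
    fderiv_prodMk_const (ContDiffAt.differentiableAt_of_smooth hQwz),
    fderiv_apply_apply (ContDiffAt.differentiableAt_of_smooth hQ)]
  have split : ∀ b c : F, ((b, -c) : F × F) = (b, 0) - (0, c) := by
    intro b c
    ext
    · simp
    · simp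
  rw [split, map_sub]
  simp only [_root_.sub_apply]
  abel

end DerivativeTensors

/-! ### The Gauss–Codazzi equations in coordinates. -/

section GaussCodazzi

variable {E : Type*} [NormedAddCommGroup E] [NormedSpace ℝ E]
  {F : Type*} [NormedAddCommGroup F] [NormedSpace ℝ F]
  {ι : F → E} {s v : F} {Γ : E × E → E →L[ℝ] E →L[ℝ] E} {g : E × E → E →L[ℝ] E →L[ℝ] ℝ}

theorem fderiv_horizontal_sub {G : Type*} [NormedAddCommGroup G] [NormedSpace ℝ G]
    (T : F × E →L[ℝ] F →L[ℝ] F →L[ℝ] G) (u : F) (c e : E) (w z : F) :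
    T (u, c - e) w z = T (u, c) w z - T (0, e) w z := by
  have split : ((u, c - e) : F × E) = (u, c) - (0, e) := by
    ext
    · simp
    · simp
  rw [split, map_sub]
  rfl

/-- The Gauss–Codazzi equations in coordinates: `γ` are the Christoffel symbols of an arbitrary
symmetric connection of the submanifold. -/
theorem gauss_codazzi_coord [CompleteSpace F] (hι : ContDiffAt ℝ ∞ ι s)
    (hinv : (tangentGram ι g (s, fderiv ℝ ι s v)).IsInvertible)
    (hΓ : ContDiffAt ℝ ∞ Γ (ι s, fderiv ℝ ι s v)) (hg : ContDiffAt ℝ ∞ g (ι s, fderiv ℝ ι s v))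
    (hmet : ∀ u y z, fderiv ℝ g (ι s, fderiv ℝ ι s v) (u, 0) y z
      = g (ι s, fderiv ℝ ι s v) (Γ (ι s, fderiv ℝ ι s v) u y) z
        + g (ι s, fderiv ℝ ι s v) y (Γ (ι s, fderiv ℝ ι s v) u z)
        + fderiv ℝ g (ι s, fderiv ℝ ι s v)
            (0, Γ (ι s, fderiv ℝ ι s v) u (fderiv ℝ ι s v)) y z)
    {γ Q : F × F → F →L[ℝ] F →L[ℝ] F} (hγ : DifferentiableAt ℝ γ (s, v))
    (hQ : DifferentiableAt ℝ Q (s, v))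
    (hqQ : ∀ a : F × F, tangentHessian ι Γ g (a.1, fderiv ℝ ι a.1 a.2) = γ a + Q a)
    (hsymm : ∀ u w, γ (s, v) u w = γ (s, v) w u)
    (u w z b : F) (n : E) (hn : ∀ c, g (ι s, fderiv ℝ ι s v) (fderiv ℝ ι s c) n = 0) :
    let d := fderiv ℝ ι s
    let G := g (ι s, d v)
    let dG := fderiv ℝ g (ι s, d v)
    let dΓ := fderiv ℝ Γ (ι s, d v)
    let B := normalHessian ι Γ g (s, d v)
    let dB := fderiv ℝ (normalHessian ι Γ g) (s, d v)
    let q := Q (s, v)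
    let γ₀ := γ (s, v)
    let nB := fun u w z : F => dB (u, fderiv ℝ (fderiv ℝ ι) s u v
        - immersionHessian ι Γ (s, d v) u v) w z + Γ (ι s, d v) (d u) (B w z)
      - B (γ₀ u w) z - B w (γ₀ u z)
    G (coordCurvature Γ (ι s, d v) (d u) (d w) (d z)) (d b)
      = G (d (coordCurvature γ (s, v) u w z)) (d b)
        - G (B w z) (B u b) + G (B u z) (B w b)
        - dG (0, B u v) (B w z) (d b) + dG (0, B w v) (B u z) (d b)
        + G (dΓ (0, B w v) (d u) (d z) - dΓ (0, B u v) (d w) (d z)) (d b)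
        + G (d (fderiv ℝ γ (s, v) (0, q w v) u z - fderiv ℝ γ (s, v) (0, q u v) w z)) (d b)
        + G (d (coordCovDeriv γ Q (s, v) u w z - coordCovDeriv γ Q (s, v) w u z)) (d b)
        + G (d (fderiv ℝ Q (s, v) (0, q w v) u z - fderiv ℝ Q (s, v) (0, q u v) w z)) (d b)
        + G (d (q u (q w z) - q w (q u z))) (d b) ∧
    G (coordCurvature Γ (ι s, d v) (d u) (d w) (d z)) n
      = G (nB u w z) n - G (nB w u z) n
        + G (B u (q w z)) n - G (B w (q u z)) n
        + G (dB (0, B u v) w z) n - G (dB (0, B w v) u z) n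
        + G (dΓ (0, B w v) (d u) (d z)) n - G (dΓ (0, B u v) (d w) (d z)) n := by
  intro d G dG dΓ B dB q γ₀ nB
  have hB : DifferentiableAt ℝ (normalHessian ι Γ g) (s, d v) :=
    ContDiffAt.differentiableAt_of_smooth (contDiffAt_normalHessian hinv hι hg hΓ)
  have hT : DifferentiableAt ℝ (tangentHessian ι Γ g) (s, d v) :=
    ContDiffAt.differentiableAt_of_smooth (contDiffAt_tangentHessian hinv hι hg hΓ)
  have hΓd := ContDiffAt.differentiableAt_of_smooth hΓ
  have hgd := ContDiffAt.differentiableAt_of_smooth hg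
  have hdec : ∀ (a : F × E) (u z : F), immersionHessian ι Γ a u z
      = fderiv ℝ ι a.1 (tangentHessian ι Γ g a u z) + normalHessian ι Γ g a u z :=
    fun a u z => immersionHessian_eq a u z
  have horth : ∀ a : F × E, (tangentGram ι g a).IsInvertible → ∀ w z b,
      g (ι a.1, a.2) (normalHessian ι Γ g a w z) (fderiv ℝ ι a.1 b) = 0 :=
    fun a ha w z b => tangentProj_orthogonal ha _ b
  have hperp : ∀ᶠ a in 𝓝 (s, d v), ∀ w z b,
      g (ι a.1, a.2) (normalHessian ι Γ g a w z) (fderiv ℝ ι a.1 b) = 0 :=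
    (eventually_isInvertible_tangentGram hinv hι hg).mono horth
  have hperp0 : ∀ w z b, G (B w z) (d b) = 0 := horth (s, d v) hinv
  have hq0 : ∀ w z, tangentHessian ι Γ g (s, d v) w z = γ₀ w z + q w z := fun w z =>
    congrArg (fun T : F →L[ℝ] F →L[ℝ] F => T w z) (hqQ (s, v))
  have hcurv := coordCurvature_immersion hι hΓd hT hB
    (Filter.Eventually.of_forall hdec) u w z
  have hfun : (fun a : F × F => tangentHessian ι Γ g (a.1, fderiv ℝ ι a.1 a.2))
      = fun a => γ a + Q a := funext hqQ
  have hK := fun u w b => metric_normal_deriv hι hB hgd hmet (hdec (s, d v)) hperp u w z b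
  simp only at hcurv hK
  rw [hfun, coordCurvature_add hγ hQ hsymm] at hcurv
  -- X is the derivative of B in the direction (u, h) of the curvature computation, whereas ∇II uses
  -- the Γ-horizontal direction.
  set X : F → F → E := fun u w => dB (u, fderiv ℝ (fderiv ℝ ι) s u v
    - d (tangentHessian ι Γ g (s, d v) u v)) w z + Γ (ι s, d v) (d u) (B w z) with hX
  have hcurv' : coordCurvature Γ (ι s, d v) (d u) (d w) (d z)
      = d (coordCurvature γ (s, v) u w z
          + (fderiv ℝ γ (s, v) (0, q w v) u z - fderiv ℝ γ (s, v) (0, q u v) w z)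
          + (coordCovDeriv γ Q (s, v) u w z - coordCovDeriv γ Q (s, v) w u z)
          + (fderiv ℝ Q (s, v) (0, q w v) u z - fderiv ℝ Q (s, v) (0, q u v) w z)
          + (q u (q w z) - q w (q u z)))
        + ((B u (γ₀ w z + q w z) + X u w - dΓ (0, B u v) (d w) (d z))
          - (B w (γ₀ u z + q u z) + X w u - dΓ (0, B w v) (d u) (d z))) := by
    rw [← hq0, ← hq0]
    exact hcurv
  have hK' : ∀ u w, G (X u w) (d b) = -G (B w z) (B u b) - dG (0, B u v) (B w z) (d b) :=
    fun u w => hK u w b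
  -- The two directions differ by (0, B(u, v)), which is the source of the ∂^ν II terms in the
  -- Codazzi equation.
  have hnB : ∀ u w, nB u w z = X u w - dB (0, B u v) w z - B (γ₀ u w) z - B w (γ₀ u z) := by
    intro u w
    have e : fderiv ℝ (fderiv ℝ ι) s u v - immersionHessian ι Γ (s, d v) u v
        = fderiv ℝ (fderiv ℝ ι) s u v - d (tangentHessian ι Γ g (s, d v) u v) - B u v := by
      rw [hdec]
      exact sub_add_eq_sub_sub _ _ _
    simp only [nB, hX]
    rw [e, fderiv_horizontal_sub dB]
    abel
  rw [hcurv', hnB, hnB]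
  constructor
  -- Against db the values of B vanish, and `hK'` evaluates the derivative X.
  · simp only [map_add, map_sub, _root_.add_apply, _root_.sub_apply, hperp0, hK']
    ring
  -- Against n the tangential terms vanish. The terms B(γ(u, w), z) cancel by symmetry of γ, and
  -- B(u, γ(w, z)) is the connection term in the other covariant derivative.
  · have hn' : ∀ c, G (d c) n = 0 := hn
    have hs : γ₀ w u = γ₀ u w := hsymm w u
    simp only [map_add, map_sub, _root_.add_apply, _root_.sub_apply, hn', hs]
    ring

end GaussCodazzi

end PseudoFinsler

end

/-! ### The Gauss–Codazzi equations on the manifold. -/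

theorem theorem3
    {E : Type*} [NormedAddCommGroup E] [NormedSpace ℝ E] [FiniteDimensional ℝ E]
    {M : Type*} [TopologicalSpace M] [ChartedSpace E M] [IsManifold 𝓘(ℝ, E) ∞ M]
    {F : Type*} [NormedAddCommGroup F] [NormedSpace ℝ F] [FiniteDimensional ℝ F]
    {S : Type*} [TopologicalSpace S] [ChartedSpace F S] [IsManifold 𝓘(ℝ, F) ∞ S]
    (A : Set (TangentBundle 𝓘(ℝ, E) M)) (L : TangentBundle 𝓘(ℝ, E) M → ℝ)
    (hL : IsPseudoFinsler A L)
    (i : S → M) (hi : IsNondegenerateSubmanifold (F := F) A L i)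
    -- the Levi-Civita–Chern connections of `(M, L)` and of `(S, L|_S)`
    (D : AnisotropicConnection A) (hD : IsLeviCivitaChern L D)
    (D' : AnisotropicConnection (restrictDomain (F := F) i A))
    (hD' : IsLeviCivitaChern (restrictMetric (F := F) i L) D')
    (x : S) (v : TangentSpace 𝓘(ℝ, F) x)
    (hv : (⟨x, v⟩ : TangentBundle 𝓘(ℝ, F) S) ∈ restrictDomain (F := F) i A)
    (u w z b : TangentSpace 𝓘(ℝ, F) x) (n : TangentSpace 𝓘(ℝ, E) (i x))
    (hn : ∀ a : TangentSpace 𝓘(ℝ, F) x, fundTensor L (push i v) n (push i a) = 0) :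
    -- the tensors at `v`, for arguments in `T_xS` or (for `C` and `P̃`) in `T_{i x}M`
    let d : TangentSpace 𝓘(ℝ, F) x → TangentSpace 𝓘(ℝ, E) (i x) := fun a => push i a
    let g := fundTensor L (d v)
    let C := cartanTensor L (d v)
    let II := secondFF L D i (d v)
    let dII := vertDerivSecondFF L D i (d v)
    let nII := covDerivSecondFF L D i D' v
    let Q := diffTensor L D i D' v
    let dQ := vertDerivTensor (fun _ y => diffTensor L D i D' y) v
    let nQ := covDerivTensor D' (fun _ y => diffTensor L D i D' y) v
    let Pt := vertDeriv D (d v)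
    let P := vertDeriv D' v
    let Rt := curvature D (d v)
    let R := curvature D' v
    (g (Rt (d u) (d w) (d z)) (d b)
      = g (d (R u w z)) (d b)
        - g (II w z) (II u b) + g (II u z) (II w b)
        - 2 * C (II u v) (II w z) (d b) + 2 * C (II w v) (II u z) (d b)
        + g (Pt (d u) (d z) (II w v) - Pt (d w) (d z) (II u v)) (d b)
        + g (d (P u z (Q w v) - P w z (Q u v))) (d b)
        + g (d (nQ u w z - nQ w u z)) (d b)
        + g (d (dQ u z (Q w v) - dQ w z (Q u v))) (d b)
        + g (d (Q u (Q w z) - Q w (Q u z))) (d b)) ∧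
    (g (Rt (d u) (d w) (d z)) n
      = g (nII u w z) n - g (nII w u z) n
        + g (II u (Q w z)) n - g (II w (Q u z)) n
        + g (dII w z (II u v)) n - g (dII u z (II w v)) n
        + g (Pt (d u) (d z) (II w v)) n - g (Pt (d w) (d z) (II u v)) n) := by
  intro d g C II dII nII Q dQ nQ Pt P Rt R
  have : CompleteSpace F := FiniteDimensional.complete ℝ F
  have hA := hL.isOpen
  have hs := hL.smooth
  have hism := hi.smooth
  have himm := hi.immersion
  have hA' : IsOpen (restrictDomain (F := F) i A) := isOpen_restrictDomain hA hism
  have hc := inCharts_self (E := E) (F := F) i x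
  have hpush : ∀ a : TangentSpace 𝓘(ℝ, F) x, comps (i x) (d a)
      = fderiv ℝ (coordMap E F i x) (extChartAt 𝓘(ℝ, F) x x) (comps x a) := comps_push hism hc
  have hg : ∀ a c, g a c = coordMetric L (i x)
      (coordMap E F i x (extChartAt 𝓘(ℝ, F) x x), fderiv ℝ (coordMap E F i x)
        (extChartAt 𝓘(ℝ, F) x x) (comps x v)) (comps (i x) a) (comps (i x) c) := by
    intro a c
    rw [hc.coordMap_eq, ← hpush]
    exact fundTensor_eq hA hs hc.cod hv a c
  have hinv : (tangentGram (coordMap E F i x) (coordMetric L (i x))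
      (extChartAt 𝓘(ℝ, F) x x, fderiv ℝ (coordMap E F i x)
        (extChartAt 𝓘(ℝ, F) x x) (comps x v))).IsInvertible := by
    refine isInvertible_of_nondegenerate _ fun c hc' => ?_
    rw [← comps_ofComps hc.dom c,
      hi.nondegenerate x v hv (ofComps x x c) fun e => ?_, comps_zero]
    refine (hg _ _).trans ?_
    rw [hpush, hpush, comps_ofComps hc.dom]
    exact hc' _
  have hreg : IsRegular (F := F) A L i x (push i v) := by
    refine ⟨hc, hv, ?_⟩
    have := hpush v
    rw [show comps (i x) (push i v) = _ from this]
    exact hinv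
  have hdM : ((coordMap E F i x (extChartAt 𝓘(ℝ, F) x x), fderiv ℝ (coordMap E F i x)
        (extChartAt 𝓘(ℝ, F) x x) (comps x v)) : E × E)
      = (extChartAt 𝓘(ℝ, E) (i x) (i x), comps (i x) (d v)) := by
    rw [hc.coordMap_eq, ← hpush]
  have hmemM := mem_coordDomain hc.cod hv
  have hmemS := mem_coordDomain hc.dom hv
  rw [hpush, ← hc.coordMap_eq] at hmemM
  have hcurv : ∀ u w z, comps (i x) (Rt (d u) (d w) (d z)) = coordCurvature (christoffel D (i x))
      (coordMap E F i x (extChartAt 𝓘(ℝ, F) x x), fderiv ℝ (coordMap E F i x)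
        (extChartAt 𝓘(ℝ, F) x x) (comps x v)) (fderiv ℝ (coordMap E F i x)
        (extChartAt 𝓘(ℝ, F) x x) (comps x u)) (fderiv ℝ (coordMap E F i x)
        (extChartAt 𝓘(ℝ, F) x x) (comps x w)) (fderiv ℝ (coordMap E F i x)
        (extChartAt 𝓘(ℝ, F) x x) (comps x z)) := by
    intro u w z
    rw [hdM, ← hpush, ← hpush, ← hpush]
    exact comps_curvature D hA hv _ _ _
  have hPt : ∀ u w ξ, comps (i x) (Pt (d u) (d w) ξ) = fderiv ℝ (christoffel D (i x))
      (coordMap E F i x (extChartAt 𝓘(ℝ, F) x x), fderiv ℝ (coordMap E F i x)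
        (extChartAt 𝓘(ℝ, F) x x) (comps x v)) (0, comps (i x) ξ) (fderiv ℝ (coordMap E F i x)
        (extChartAt 𝓘(ℝ, F) x x) (comps x u)) (fderiv ℝ (coordMap E F i x)
        (extChartAt 𝓘(ℝ, F) x x) (comps x w)) := by
    intro u w ξ
    rw [hdM, ← hpush, ← hpush]
    exact comps_vertDeriv D hA hv _ _ _
  have hP : ∀ u w ξ, comps x (P u w ξ) = fderiv ℝ (christoffel D' x)
      (extChartAt 𝓘(ℝ, F) x x, comps x v) (0, comps x ξ) (comps x u) (comps x w) :=
    comps_vertDeriv D' hA' hv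
  have hR : ∀ u w z, comps x (R u w z) = coordCurvature (christoffel D' x)
      (extChartAt 𝓘(ℝ, F) x x, comps x v) (comps x u) (comps x w) (comps x z) :=
    comps_curvature D' hA' hv
  have hII : ∀ u w, comps (i x) (II u w) = normalHessian (coordMap E F i x)
      (christoffel D (i x)) (coordMetric L (i x)) (extChartAt 𝓘(ℝ, F) x x,
        fderiv ℝ (coordMap E F i x) (extChartAt 𝓘(ℝ, F) x x) (comps x v))
      (comps x u) (comps x w) := by
    intro u w
    rw [← hpush]
    exact hreg.comps_secondFF hA hs hism (himm x) D u w
  have hdII : ∀ u w ξ, comps (i x) (dII u w ξ) = fderiv ℝ (normalHessian (coordMap E F i x)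
      (christoffel D (i x)) (coordMetric L (i x))) (extChartAt 𝓘(ℝ, F) x x,
        fderiv ℝ (coordMap E F i x) (extChartAt 𝓘(ℝ, F) x x) (comps x v)) (0, comps (i x) ξ)
      (comps x u) (comps x w) := by
    intro u w ξ
    rw [← hpush]
    exact comps_vertDerivSecondFF hA hs hism himm D hreg u w ξ
  have hQ : ∀ u w, comps x (Q u w) = coordDiffTensor L D i D' x
      (extChartAt 𝓘(ℝ, F) x x, comps x v) (comps x u) (comps x w) :=
    comps_diffTensor_self hA hs hism himm D D' hreg
  have hdQ : ∀ u w ξ, comps x (dQ u w ξ) = fderiv ℝ (coordDiffTensor L D i D' x)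
      (extChartAt 𝓘(ℝ, F) x x, comps x v) (0, comps x ξ) (comps x u) (comps x w) :=
    comps_vertDeriv_diffTensor hA hs hism himm D D' hreg
  have hnQ : ∀ u w z, comps x (nQ u w z) = coordCovDeriv (christoffel D' x)
      (coordDiffTensor L D i D' x) (extChartAt 𝓘(ℝ, F) x x, comps x v)
      (comps x u) (comps x w) (comps x z) :=
    comps_covDeriv_diffTensor hA hs hism himm D D' hreg
  have hl := contDiffAt_comp_ofCoords hA hs hmemM
  have hle := (eventually_mem_coordDomain hA hmemM).mono fun a ha =>
    contDiffAt_comp_ofCoords hA hs ha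
  -- The Cartan tensor differentiates along its last argument db; total symmetry makes II(u, v) the
  -- direction instead, as in the coordinate formula.
  have hCII : ∀ u w, 2 * C (II u v) (II w z) (d b) = fderiv ℝ (coordMetric L (i x))
      (coordMap E F i x (extChartAt 𝓘(ℝ, F) x x), fderiv ℝ (coordMap E F i x)
        (extChartAt 𝓘(ℝ, F) x x) (comps x v)) (0, comps (i x) (II u v)) (comps (i x) (II w z))
        (comps (i x) (d b)) := by
    intro u w
    have h1 : C (II u v) (II w z) (d b) = _ := cartanTensor_eq hA hs hc.cod hv _ _ _
    rw [h1, ← mul_assoc, ← hpush, ← hc.coordMap_eq, hpush v]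
    have h2 := fderiv_verticalHessian_swap hl (comps (i x) (d b)) (comps (i x) (II u v))
      (comps (i x) (II w z))
    have h3 := fderiv_verticalHessian_symm hle (0, comps (i x) (II u v)) (comps (i x) (d b))
      (comps (i x) (II w z))
    norm_num
    exact h2.trans h3
  have hnpush : ∀ c, coordMetric L (i x) (coordMap E F i x (extChartAt 𝓘(ℝ, F) x x),
      fderiv ℝ (coordMap E F i x) (extChartAt 𝓘(ℝ, F) x x) (comps x v))
      (fderiv ℝ (coordMap E F i x) (extChartAt 𝓘(ℝ, F) x x) c) (comps (i x) n) = 0 := by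
    intro c
    have h1 := (hg _ _).symm.trans (hn (ofComps x x c))
    have h2 : comps (i x) (push i (ofComps x x c)) = _ := hpush (ofComps x x c)
    rw [h2, comps_ofComps hc.dom] at h1
    rw [← h1]
    exact verticalHessian_symm hl _ _
  -- The normal projection in ∇II removes a tangent vector, which is orthogonal to n, so it can be
  -- dropped under this pairing.
  have hnII : ∀ u w, g (nII u w z) n = coordMetric L (i x)
      (coordMap E F i x (extChartAt 𝓘(ℝ, F) x x), fderiv ℝ (coordMap E F i x)
        (extChartAt 𝓘(ℝ, F) x x) (comps x v))
      (fderiv ℝ (normalHessian (coordMap E F i x) (christoffel D (i x)) (coordMetric L (i x)))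
          (extChartAt 𝓘(ℝ, F) x x, fderiv ℝ (coordMap E F i x) (extChartAt 𝓘(ℝ, F) x x) (comps x v))
          (comps x u, fderiv ℝ (fderiv ℝ (coordMap E F i x)) (extChartAt 𝓘(ℝ, F) x x) (comps x u)
              (comps x v)
            - immersionHessian (coordMap E F i x) (christoffel D (i x)) (extChartAt 𝓘(ℝ, F) x x,
                fderiv ℝ (coordMap E F i x) (extChartAt 𝓘(ℝ, F) x x) (comps x v)) (comps x u)
                (comps x v)) (comps x w) (comps x z)
        + christoffel D (i x) (coordMap E F i x (extChartAt 𝓘(ℝ, F) x x), fderiv ℝ (coordMap E F i x)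
            (extChartAt 𝓘(ℝ, F) x x) (comps x v)) (fderiv ℝ (coordMap E F i x)
              (extChartAt 𝓘(ℝ, F) x x) (comps x u)) (comps (i x) (II w z))
        - normalHessian (coordMap E F i x) (christoffel D (i x)) (coordMetric L (i x))
            (extChartAt 𝓘(ℝ, F) x x, fderiv ℝ (coordMap E F i x) (extChartAt 𝓘(ℝ, F) x x) (comps x v))
            (christoffel D' x (extChartAt 𝓘(ℝ, F) x x, comps x v) (comps x u) (comps x w)) (comps x z)
        - normalHessian (coordMap E F i x) (christoffel D (i x)) (coordMetric L (i x))
            (extChartAt 𝓘(ℝ, F) x x, fderiv ℝ (coordMap E F i x) (extChartAt 𝓘(ℝ, F) x x) (comps x v))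
            (comps x w) (christoffel D' x (extChartAt 𝓘(ℝ, F) x x, comps x v) (comps x u) (comps x z)))
      (comps (i x) n) := by
    intro u w
    rw [hg]
    have h1 := comps_derivSecondFF hA hs hism himm D hreg u w z
    have h2 := hreg.comps_norPart hA hs hism
      (derivSecondFF L D i v u (extField w) (extField z))
    have h3 := hreg.comps_secondFF hA hs hism (himm x) D (D'.toFun x v (extField w) u) z
    have h4 := hreg.comps_secondFF hA hs hism (himm x) D w (D'.toFun x v (extField z) u)
    have h5 : comps (i x) (push i v) = _ := hpush v
    rw [h5] at h2 h3 h4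
    rw [comps_conn_extField D' hv] at h3 h4
    have h6 : comps (i x) (nII u w z) = _ := (comps_sub _ _ _).trans
      (congrArg₂ (· - ·) ((comps_sub _ _ _).trans (congrArg₂ (· - ·) h2 h3)) h4)
    rw [h6, h1, hII]
    simp only [map_sub, _root_.sub_apply, hnpush, sub_zero]
  -- The splitting q = γ + Q holds at every coordinate pair, because `coordDiffTensor` is defined as
  -- the difference q - γ.
  have key := gauss_codazzi_coord (contDiffAt_coordMap hism hc) hinv
    (contDiffAt_christoffel D hA hmemM) (contDiffAt_verticalHessian hl)
    (fun u y z => by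
      have h1 := christoffel_metric hA hs hD hv u y z
      have h2 : comps (i x) (push i v) = _ := hpush v
      rw [h2, ← hc.coordMap_eq] at h1
      exact h1)
    (ContDiffAt.differentiableAt_of_smooth (contDiffAt_christoffel D' hA' hmemS))
    (ContDiffAt.differentiableAt_of_smooth (contDiffAt_coordDiffTensor hA hs hism D D' hreg))
    (fun a => (add_sub_cancel _ _).symm) (christoffel_symm hD' hv)
    (comps x u) (comps x w) (comps x z) (comps x b) (comps (i x) n) hnpush
  simp only at key
  constructor
  · have h1 := hCII u w
    have h2 := hCII w u
    rw [h1, h2]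
    simp only [hg, comps_sub, hpush, hcurv, hPt, hP, hR, hII, hQ, hdQ, hnQ]
    exact key.1
  · rw [hnII, hnII]
    simp only [hg, hcurv, hPt, hII, hdII, hQ]
    exact key.2
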